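/- Let $\Omega\subset\{(r,z): r>0\}$ be the bounded open meridian domain of an axisymmetric domain $\breve\Omega\subset\mathbb R^3$ (so $\breve\Omega$ is obtained by rotating $\Omega$, together with the part of its boundary on the axis, around the $z$-axis), let $\breve\Omega$ be convex, and let $k$ be an integer with $|k|\ge 1$. For $\alpha\in\mathbb Z$ put $\|f\|_{L^2_{r^\alpha}(\Omega)}^2=\int_\Omega f^2r^\alpha\,dr\,dz$; let $H^1_r(\Omega)$ be the space of all $f\in L^2_r(\Omega)$ with weak gradient in $L^2_r(\Omega)$, with seminorm $|f|_{H^1_r(\Omega)}=\|\nabla f\|_{L^2_r(\Omega)}$, and put $\|f\|_{\tilde H^1_r(\Omega)}^2=\|f\|_{L^2_r(\Omega)}^2+|f|_{H^1_r(\Omega)}^2+\|f\|_{L^2_{1/r}(\Omega)}^2$. For $u=(u_r,u_\theta,u_z)$ write $u_{rz}=(u_r,u_z)$. Define, in the sense of distributions on $\Omega$, $$\operatorname{grad}^kf=\begin{pmatrix}\partial_rf\\-\tfrac krf\\\partial_zf\end{pmatrix},\quad \operatorname{curl}^ku=\begin{pmatrix}-(\tfrac kru_z+\partial_zu_\theta)\\\partial_zu_r-\partial_ru_z\\\tfrac{ku_r+u_\theta}r+\partial_ru_\theta\end{pmatrix},\quad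 \operatorname{div}^ku=\partial_ru_r+\tfrac{u_r-ku_\theta}r+\partial_zu_z,$$ with domains the $L^2_r$ functions or fields whose image is in $L^2_r$. For a conforming triangulation $\mathcal T_h$ of $\Omega$ with meshsize $h=\max_{K\in\mathcal T_h}\operatorname{diam}K$, let $A_h$, $B_h$, $C_h$ be the sets of elements of the domains of $\operatorname{grad}^k$, $\operatorname{curl}^k$, $\operatorname{div}^k$ whose restrictions to each triangle have, respectively, the form $$\alpha_1r+\alpha_2r^2+\alpha_3rz,\qquad \begin{pmatrix}\beta_1+\beta_4r+\beta_3z-\beta_6rz\\-k\beta_1+\beta_2r-k\beta_3z\\\beta_5r+\beta_6r^2\end{pmatrix},\qquad \begin{pmatrix}k\gamma_1+\gamma_2r\\\gamma_1+\gamma_3r\\\gamma_4+\gamma_2z\end{pmatrix}$$ with real coefficients, and let $D_h$ be the set of functions that are constant on each triangle. By commuting projections with bound $M$ we mean bounded linear projections $\Pi_h^{g,k},\Pi_h^{c,k},\Pi_h^{d,k},\Pi_h^{o,k}$ of (scalar or vector-valued) $L^2_r(\Omega)$ onto $A_h,B_h,C_h,D_h$, with operator norms at most $M$, such that $\operatorname{grad}^k\Pi_h^{g,k}=\Pi_h^{c,k}\operatorname{grad}^k$,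 $\operatorname{curl}^k\Pi_h^{c,k}=\Pi_h^{d,k}\operatorname{curl}^k$ and $\operatorname{div}^k\Pi_h^{d,k}=\Pi_h^{o,k}\operatorname{div}^k$ on the domains of $\operatorname{grad}^k$, $\operatorname{curl}^k$, $\operatorname{div}^k$. Theorem. For all real $\sigma$ and $M$ there is a constant $C>0$, depending only on $\Omega$, $k$, $\sigma$ and $M$, such that the following holds for every conforming triangulation $\mathcal T_h$ of $\Omega$ that is shape regular with constant $\sigma$ (each triangle $K$ contains a closed disc of diameter $\rho_K$ with $\operatorname{diam}K\le\sigma\rho_K$) and for every $u=(u_r,u_\theta,u_z)$ with all components in $H^1_r(\Omega)$ and $ku_\theta-u_r\in L^2_{1/r}(\Omega)$. For all commuting projections with bound $M$, $$\|u-\Pi_h^{d,k}u\|_{L^2_r(\Omega)}\le C\,h\,\bigl(|u_{rz}|_{H^1_r(\Omega)}+\|ku_\theta-u_r\|_{\tilde H^1_r(\Omega)}\bigr),$$ and also $$\min_{u_h\in C_h}\|u-u_h\|_{L^2_r(\Omega)}\le C\,h\,\bigl(|u_{rz}|_{H^1_r(\Omega)}+\|ku_\theta-u_r\|_{\tilde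 H^1_r(\Omega)}\bigr).$$ -/

import Mathlib

open MeasureTheory Set
open scoped ContDiff

noncomputable section

namespace Axisym

/-- The plane of the meridian coordinates, with the Euclidean norm; `x 0 = r` and `x 1 = z`. -/
abbrev Plane := EuclideanSpace ℝ (Fin 2)

/-- Values of vector fields in cylindrical components: index `0` is `r`, `1` is `θ`, `2` is `z`. -/
abbrev Vec3 := EuclideanSpace ℝ (Fin 3)

/-- The set obtained by rotating a set `S` of the half plane `r ≥ 0` around the `z`-axis. -/
def rotate (S : Set Plane) : Set (EuclideanSpace ℝ (Fin 3)) :=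
  {p | !₂[Real.sqrt (p 0 ^ 2 + p 1 ^ 2), p 2] ∈ S}

/-- `Ω` is the (open) meridian domain of a bounded convex axisymmetric domain of `ℝ³`.
`Ω` lies in `r > 0`, hence does not contain the points of the axis; the three-dimensional domain
is the interior of `rotate (closure Ω)`, and it is convex iff `rotate (closure Ω)` is. -/
structure IsMeridianDomain (Ω : Set Plane) : Prop where
  isOpen : IsOpen Ω
  nonempty : Ω.Nonempty
  isBounded : Bornology.IsBounded Ω
  pos_radius : ∀ x ∈ Ω, 0 < x 0
  /-- no slits or punctures -/
  interior_closure : interior (closure Ω) = Ω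
  convex_rotate : Convex ℝ (rotate (closure Ω))

/-! ### Weighted Lebesgue spaces -/

/-- The measure `r ^ α dr dz` on `Ω`. -/
def wMeasure (Ω : Set Plane) (α : ℤ) : Measure Plane :=
  (volume.restrict Ω).withDensity fun x => ENNReal.ofReal (x 0 ^ α)

/-- Scalar `L²_r(Ω)`. -/
abbrev L2r (Ω : Set Plane) := Lp ℝ 2 (wMeasure Ω 1)

/-- Vector-valued `L²_r(Ω)`, with the norm `(∫ (u_r² + u_θ² + u_z²) r dr dz) ^ (1/2)`. -/
abbrev L2rVec (Ω : Set Plane) := Lp Vec3 2 (wMeasure Ω 1)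

/-- The norm of `L²_{r^α}(Ω)` (used for functions that belong to that space). -/
def wNorm (Ω : Set Plane) (α : ℤ) (f : Plane → ℝ) : ℝ :=
  (eLpNorm f 2 (wMeasure Ω α)).toReal

/-! ### Weak derivatives and weighted Sobolev spaces -/

/-- Test functions: smooth functions with compact support in `Ω`. -/
def IsTest (Ω : Set Plane) (φ : Plane → ℝ) : Prop :=
  ContDiff ℝ ∞ φ ∧ HasCompactSupport φ ∧ tsupport φ ⊆ Ω

/-- Classical partial derivative; `i = 0` is `∂_r` and `i = 1` is `∂_z`. -/
def pd (i : Fin 2) (φ : Plane → ℝ) (x : Plane) : ℝ :=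
  fderiv ℝ φ x (EuclideanSpace.single i 1)

/-- `g` is the weak (distributional) partial derivative `∂_i f` on `Ω`. -/
def HasWeakPartial (Ω : Set Plane) (i : Fin 2) (f g : Plane → ℝ) : Prop :=
  LocallyIntegrableOn f Ω ∧ LocallyIntegrableOn g Ω ∧
    ∀ φ, IsTest Ω φ → ∫ x in Ω, f x * pd i φ x = -∫ x in Ω, g x * φ x

open Classical in
/-- The weak partial derivative `∂_i f` on `Ω` (unique almost everywhere on `Ω` if it exists). -/
def weakPartial (Ω : Set Plane) (i : Fin 2) (f : Plane → ℝ) : Plane → ℝ :=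
  if h : ∃ g, HasWeakPartial Ω i f g then h.choose else 0

/-- `f ∈ H¹_r(Ω)`. -/
def MemH1r (Ω : Set Plane) (f : Plane → ℝ) : Prop :=
  MemLp f 2 (wMeasure Ω 1) ∧
    ∀ i, ∃ g, HasWeakPartial Ω i f g ∧ MemLp g 2 (wMeasure Ω 1)

/-- The seminorm `|f|_{H¹_r(Ω)}`. -/
def h1rSeminorm (Ω : Set Plane) (f : Plane → ℝ) : ℝ :=
  Real.sqrt (∑ i, wNorm Ω 1 (weakPartial Ω i f) ^ 2)

/-- The norm of `H̃¹_r(Ω) = H¹_r(Ω) ∩ L²_{1/r}(Ω)`. -/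
def h1tildeNorm (Ω : Set Plane) (f : Plane → ℝ) : ℝ :=
  Real.sqrt (wNorm Ω 1 f ^ 2 + h1rSeminorm Ω f ^ 2 + wNorm Ω (-1) f ^ 2)

/-- The scalar function `k u_θ - u_r`. -/
def kThetaSubR {Ω : Set Plane} (k : ℤ) (u : L2rVec Ω) (x : Plane) : ℝ :=
  (k : ℝ) * u x 1 - u x 0

/-- The space of all `u` with components in `H¹_r(Ω)` and with `k u_θ - u_r ∈ L²_{1/r}(Ω)`. -/
def MemH1star {Ω : Set Plane} (k : ℤ) (u : L2rVec Ω) : Prop :=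
  (∀ j : Fin 3, MemH1r Ω fun x => u x j) ∧ MemLp (kThetaSubR k u) 2 (wMeasure Ω (-1))

/-- The seminorm `|u_rz|_{H¹_r(Ω)}` of the meridian part `u_rz = (u_r, u_z)`. -/
def rzSeminorm {Ω : Set Plane} (u : L2rVec Ω) : ℝ :=
  Real.sqrt (h1rSeminorm Ω (fun x => u x 0) ^ 2 + h1rSeminorm Ω (fun x => u x 2) ^ 2)

/-! ### The operators `grad^k`, `curl^k`, `div^k` (in the sense of distributions on `Ω`) -/

/-- `f` lies in the domain of `grad^k` and `grad^k f = (∂_r f, -(k/r) f, ∂_z f) = w`. -/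
def IsGradK {Ω : Set Plane} (k : ℤ) (f : L2r Ω) (w : L2rVec Ω) : Prop :=
  HasWeakPartial Ω 0 f (fun x => w x 0) ∧
  (∀ᵐ x ∂(volume.restrict Ω), w x 1 = -((k : ℝ) / x 0) * f x) ∧
  HasWeakPartial Ω 1 f (fun x => w x 2)

/-- `u` lies in the domain of `curl^k` and
`curl^k u = (-((k/r) u_z + ∂_z u_θ), ∂_z u_r - ∂_r u_z, (k u_r + u_θ)/r + ∂_r u_θ) = w`. -/
def IsCurlK {Ω : Set Plane} (k : ℤ) (u w : L2rVec Ω) : Prop :=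
  ∀ φ, IsTest Ω φ →
    (∫ x in Ω, w x 0 * φ x = ∫ x in Ω, (-((k : ℝ) / x 0 * u x 2) * φ x + u x 1 * pd 1 φ x)) ∧
    (∫ x in Ω, w x 1 * φ x = ∫ x in Ω, (-(u x 0) * pd 1 φ x + u x 2 * pd 0 φ x)) ∧
    (∫ x in Ω, w x 2 * φ x =
      ∫ x in Ω, (((k : ℝ) * u x 0 + u x 1) / x 0 * φ x - u x 1 * pd 0 φ x))

/-- `u` lies in the domain of `div^k` and
`div^k u = ∂_r u_r + (u_r - k u_θ)/r + ∂_z u_z = q`. -/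
def IsDivK {Ω : Set Plane} (k : ℤ) (u : L2rVec Ω) (q : L2r Ω) : Prop :=
  ∀ φ, IsTest Ω φ →
    ∫ x in Ω, q x * φ x =
      ∫ x in Ω, (-(u x 0) * pd 0 φ x + (u x 0 - (k : ℝ) * u x 1) / x 0 * φ x - u x 2 * pd 1 φ x)

/-! ### Triangulations and Fourier finite element spaces -/

/-- The closed triangle with vertex set `s`. -/
abbrev tri (s : Finset Plane) : Set Plane := convexHull ℝ (s : Set Plane)

/-- A conforming triangulation of `Ω`; triangles are given by their vertex sets.
Two triangles meet in the convex hull of their common vertices, that is, they are disjoint, share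
exactly one vertex, share exactly one full edge, or are equal. -/
structure Triangulation (Ω : Set Plane) where
  cells : Finset (Finset Plane)
  card_eq : ∀ s ∈ cells, s.card = 3
  affineIndependent : ∀ s ∈ cells, AffineIndependent ℝ ((↑) : s → Plane)
  conforming : ∀ s ∈ cells, ∀ t ∈ cells, tri s ∩ tri t = convexHull ℝ ((s : Set Plane) ∩ t)
  cover : ⋃ s ∈ cells, tri s = closure Ω

namespace Triangulation

variable {Ω : Set Plane}

/-- The meshsize `h`: the largest diameter of a triangle. -/
def meshSize (T : Triangulation Ω) : ℝ := ⨆ s : T.cells, Metric.diam (tri s)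

/-- Shape regularity with constant `σ`: every triangle `K` contains a closed disc of
diameter `ρ` with `diam K ≤ σ ρ`. -/
def ShapeRegular (T : Triangulation Ω) (σ : ℝ) : Prop :=
  ∀ s ∈ T.cells, ∃ (c : Plane) (ρ : ℝ),
    0 ≤ ρ ∧ Metric.closedBall c (ρ / 2) ⊆ tri s ∧ Metric.diam (tri s) ≤ σ * ρ

/-- `A_h`. -/
def spaceA (T : Triangulation Ω) (k : ℤ) : Set (L2r Ω) :=
  {f | (∃ w, IsGradK k f w) ∧
    ∀ s ∈ T.cells, ∃ a : Fin 3 → ℝ, ∀ᵐ x ∂(volume.restrict (tri s)),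
      f x = a 0 * x 0 + a 1 * x 0 ^ 2 + a 2 * (x 0 * x 1)}

/-- `B_h`. -/
def spaceB (T : Triangulation Ω) (k : ℤ) : Set (L2rVec Ω) :=
  {u | (∃ w, IsCurlK k u w) ∧
    ∀ s ∈ T.cells, ∃ b : Fin 6 → ℝ, ∀ᵐ x ∂(volume.restrict (tri s)),
      u x = !₂[b 0 + b 3 * x 0 + b 2 * x 1 - b 5 * (x 0 * x 1),
               -(k : ℝ) * b 0 + b 1 * x 0 - (k : ℝ) * b 2 * x 1,
               b 4 * x 0 + b 5 * x 0 ^ 2]}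

/-- `C_h`. -/
def spaceC (T : Triangulation Ω) (k : ℤ) : Set (L2rVec Ω) :=
  {u | (∃ q, IsDivK k u q) ∧
    ∀ s ∈ T.cells, ∃ c : Fin 4 → ℝ, ∀ᵐ x ∂(volume.restrict (tri s)),
      u x = !₂[(k : ℝ) * c 0 + c 1 * x 0, c 0 + c 2 * x 0, c 3 + c 1 * x 1]}

/-- `D_h`. -/
def spaceD (T : Triangulation Ω) : Set (L2r Ω) :=
  {q | ∀ s ∈ T.cells, ∃ c : ℝ, ∀ᵐ x ∂(volume.restrict (tri s)), q x = c}

end Triangulation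

/-- Commuting projections for the Fourier mode `k` on the mesh `T`: projections of `L²_r`
onto `A_h`, `B_h`, `C_h`, `D_h` whose `L²_r` operator norms are at most `M` and which commute with
`grad^k`, `curl^k` and `div^k` (on the domains of these operators). -/
structure CommutingProjections {Ω : Set Plane} (T : Triangulation Ω) (k : ℤ) (M : ℝ) where
  projG : L2r Ω →L[ℝ] L2r Ω
  projC : L2rVec Ω →L[ℝ] L2rVec Ω
  projD : L2rVec Ω →L[ℝ] L2rVec Ω
  projO : L2r Ω →L[ℝ] L2r Ω
  norm_g : ‖projG‖ ≤ M
  norm_c : ‖projC‖ ≤ M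
  norm_d : ‖projD‖ ≤ M
  norm_o : ‖projO‖ ≤ M
  mem_g : ∀ f, projG f ∈ T.spaceA k
  mem_c : ∀ u, projC u ∈ T.spaceB k
  mem_d : ∀ u, projD u ∈ T.spaceC k
  mem_o : ∀ q, projO q ∈ T.spaceD
  id_g : ∀ f ∈ T.spaceA k, projG f = f
  id_c : ∀ u ∈ T.spaceB k, projC u = u
  id_d : ∀ u ∈ T.spaceC k, projD u = u
  id_o : ∀ q ∈ T.spaceD, projO q = q
  comm_grad : ∀ f w, IsGradK k f w → IsGradK k (projG f) (projC w)
  comm_curl : ∀ u w, IsCurlK k u w → IsCurlK k (projC u) (projD w)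
  comm_div : ∀ u q, IsDivK k u q → IsDivK k (projD u) (projO q)

end Axisym

end

noncomputable section

namespace Axisym

/-! ### Differences of weakly differentiable functions along translations -/

theorem integrable_comp_add_smul_prod {G : Plane → ℝ} (hG : Integrable G) (ξ : Plane) :
    Integrable (fun q : Plane × ℝ => G (q.1 + q.2 • ξ))
      (volume.prod (volume.restrict (Ioc (0 : ℝ) 1))) := by
  have hmp : MeasurePreserving (fun q : ℝ × Plane => (q.1, q.2 + q.1 • ξ))
      ((volume.restrict (Ioc (0 : ℝ) 1)).prod volume)
      ((volume.restrict (Ioc (0 : ℝ) 1)).prod volume) := by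
    refine (MeasurePreserving.id _).skew_product (g := fun (t : ℝ) (y : Plane) => y + t • ξ) ?_ ?_
    · fun_prop
    · exact Filter.Eventually.of_forall fun t => map_add_right_eq_self volume (t • ξ)
  have h2 : Integrable (fun q : ℝ × Plane => G q.2)
      ((volume.restrict (Ioc (0 : ℝ) 1)).prod volume) := hG.comp_snd _
  exact (hmp.integrable_comp_of_integrable h2).swap

theorem integral_mul_difference_eq_zero {f G : Plane → ℝ} (hf : Integrable f) (hG : Integrable G)
    (ξ : Plane) {φ : Plane → ℝ} (hφ : ContDiff ℝ ∞ φ) (hφc : HasCompactSupport φ)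
    (hw : ∀ t ∈ Ioc (0 : ℝ) 1,
      ∫ y, f y * fderiv ℝ φ (y - t • ξ) ξ = -∫ y, G y * φ (y - t • ξ)) :
    ∫ x, φ x * (f (x + ξ) - f x - ∫ t in Ioc (0 : ℝ) 1, G (x + t • ξ)) = 0 := by
  have hφ1 : ContDiff ℝ 1 φ := hφ.of_le (by simp)
  have hcont : Continuous φ := hφ.continuous
  have hdcont : Continuous fun y => fderiv ℝ φ y ξ :=
    (hφ1.continuous_fderiv one_ne_zero).clm_apply continuous_const
  obtain ⟨A, hA⟩ := hcont.bounded_above_of_compact_support hφc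
  obtain ⟨B, hB⟩ := hdcont.bounded_above_of_compact_support
    ((hφc.fderiv (𝕜 := ℝ)).comp_left (g := fun L : Plane →L[ℝ] ℝ => L ξ) rfl)
  -- the derivative term
  have h1 : Integrable (fun q : Plane × ℝ => f q.1 * fderiv ℝ φ (q.1 - q.2 • ξ) ξ)
      (volume.prod (volume.restrict (Ioc (0 : ℝ) 1))) := by
    refine (hf.comp_fst _).mul_bdd (c := B) ?_ ?_
    · exact (hdcont.comp (by fun_prop)).aestronglyMeasurable
    · exact Filter.Eventually.of_forall fun q => hB _
  have e1 : ∫ t in Ioc (0 : ℝ) 1, ∫ y, f y * fderiv ℝ φ (y - t • ξ) ξ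
      = ∫ y, f y * (φ y - φ (y - ξ)) := by
    rw [← integral_integral_swap (f := fun y t => f y * fderiv ℝ φ (y - t • ξ) ξ) h1]
    refine integral_congr_ae (Filter.Eventually.of_forall fun y => ?_)
    simp only
    rw [integral_const_mul]
    congr 1
    have hd : ∀ t ∈ uIcc (0 : ℝ) 1,
        HasDerivAt (fun t : ℝ => -φ (y - t • ξ)) (fderiv ℝ φ (y - t • ξ) ξ) t := by
      intro t _
      have hφd : HasFDerivAt φ (fderiv ℝ φ (y - t • ξ)) (y - t • ξ) :=
        ((hφ1.differentiable one_ne_zero) _).hasFDerivAt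
      have hl : HasDerivAt (fun t : ℝ => y - t • ξ) (-((1 : ℝ) • ξ)) t :=
        ((hasDerivAt_id t).smul_const ξ).const_sub y
      have := (hφd.comp_hasDerivAt t hl).fun_neg
      simpa [Function.comp_def] using this
    have := intervalIntegral.integral_eq_sub_of_hasDerivAt hd
      ((hdcont.comp (by fun_prop : Continuous fun t : ℝ => y - t • ξ)).intervalIntegrable 0 1)
    rw [intervalIntegral.integral_of_le zero_le_one] at this
    rw [this]
    simp
    ring
  -- the gradient term
  have h2 : Integrable (fun q : Plane × ℝ => φ q.1 * G (q.1 + q.2 • ξ))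
      (volume.prod (volume.restrict (Ioc (0 : ℝ) 1))) := by
    refine (integrable_comp_add_smul_prod hG ξ).bdd_mul (c := A) ?_ ?_
    · exact (hcont.comp continuous_fst).aestronglyMeasurable
    · exact Filter.Eventually.of_forall fun q => hA _
  have e2 : ∫ t in Ioc (0 : ℝ) 1, ∫ y, G y * φ (y - t • ξ)
      = ∫ x, φ x * ∫ t in Ioc (0 : ℝ) 1, G (x + t • ξ) := by
    have : ∀ t : ℝ, ∫ y, G y * φ (y - t • ξ) = ∫ x, φ x * G (x + t • ξ) := by
      intro t
      rw [← integral_add_right_eq_self (fun y => G y * φ (y - t • ξ)) (t • ξ)]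
      simp [mul_comm]
    simp_rw [this]
    rw [← integral_integral_swap (f := fun x t => φ x * G (x + t • ξ)) h2]
    simp_rw [integral_const_mul]
  have e3 : ∫ y, f y * (φ y - φ (y - ξ)) = -∫ x, φ x * ∫ t in Ioc (0 : ℝ) 1, G (x + t • ξ) := by
    rw [← e1, ← e2, ← integral_neg]
    exact setIntegral_congr_fun measurableSet_Ioc hw
  have i1 : Integrable fun x => φ x * f (x + ξ) :=
    (hf.comp_add_right ξ).bdd_mul (c := A) hcont.aestronglyMeasurable
      (Filter.Eventually.of_forall fun q => hA _)
  have i2 : Integrable fun x => φ x * f x :=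
    hf.bdd_mul (c := A) hcont.aestronglyMeasurable (Filter.Eventually.of_forall fun q => hA _)
  have i3 : Integrable fun x => φ x * ∫ t in Ioc (0 : ℝ) 1, G (x + t • ξ) :=
    ((integrable_comp_add_smul_prod hG ξ).integral_prod_left).bdd_mul (c := A)
      hcont.aestronglyMeasurable (Filter.Eventually.of_forall fun q => hA _)
  have i4 : Integrable fun y => f y * φ (y - ξ) :=
    hf.mul_bdd (c := A) (hcont.comp (by fun_prop)).aestronglyMeasurable
      (Filter.Eventually.of_forall fun q => hA _)
  have e4 : ∫ y, f y * φ (y - ξ) = ∫ x, φ x * f (x + ξ) := by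
    rw [← integral_add_right_eq_self (fun y => f y * φ (y - ξ)) ξ]
    simp [mul_comm]
  have e5 : ∫ y, f y * (φ y - φ (y - ξ)) = (∫ x, φ x * f x) - ∫ x, φ x * f (x + ξ) := by
    rw [← e4, ← integral_sub i2 i4]
    refine integral_congr_ae (Filter.Eventually.of_forall fun y => ?_)
    simp only
    ring
  have e6 : ∫ x, (φ x * f (x + ξ) - φ x * f x - φ x * ∫ t in Ioc (0 : ℝ) 1, G (x + t • ξ))
      = (∫ x, (φ x * f (x + ξ) - φ x * f x)) - ∫ x, φ x * ∫ t in Ioc (0 : ℝ) 1, G (x + t • ξ) :=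
    integral_sub (i1.sub i2) i3
  simp_rw [mul_sub]
  rw [e6, integral_sub i1 i2]
  linarith

theorem HasWeakPartial.integral_mul_fderiv {Ω : Set Plane} {f g₀ g₁ : Plane → ℝ}
    (h₀ : HasWeakPartial Ω 0 f g₀) (h₁ : HasWeakPartial Ω 1 f g₁) (ξ : Plane)
    {φ : Plane → ℝ} (hφ : IsTest Ω φ) :
    ∫ x in Ω, f x * fderiv ℝ φ x ξ = -∫ x in Ω, (g₀ x * ξ 0 + g₁ x * ξ 1) * φ x := by
  have hφ1 : ContDiff ℝ 1 φ := hφ.1.of_le (by simp)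
  have hInt : ∀ {a : Plane → ℝ} {ψ : Plane → ℝ}, LocallyIntegrableOn a Ω → Continuous ψ →
      tsupport ψ ⊆ tsupport φ → Integrable (fun x => a x * ψ x) (volume.restrict Ω) := by
    intro a ψ ha hψ hs
    have hc : IsCompact (tsupport φ) := hφ.2.1
    have : IntegrableOn (fun x => a x * ψ x) (tsupport φ) :=
      (ha.integrableOn_compact_subset hφ.2.2 hc).mul_continuousOn hψ.continuousOn hc
    have h2 : Integrable (fun x => a x * ψ x) :=
      (integrableOn_iff_integrable_of_support_subset (fun x hx => hs (subset_tsupport _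
        (fun h => hx (by simp [h]))))).1 this
    exact h2.integrableOn
  have hpd : ∀ i, Continuous (pd i φ) := fun i =>
    (hφ1.continuous_fderiv one_ne_zero).clm_apply continuous_const
  have hpds : ∀ i, tsupport (pd i φ) ⊆ tsupport φ := fun i =>
    tsupport_fderiv_apply_subset ℝ _
  have hξ : ∀ x, fderiv ℝ φ x ξ = ξ 0 * pd 0 φ x + ξ 1 * pd 1 φ x := by
    intro x
    have : ξ = ξ 0 • EuclideanSpace.single 0 1 + ξ 1 • EuclideanSpace.single 1 1 := by
      ext i; fin_cases i <;> simp
    conv_lhs => rw [this]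
    simp [pd]
  have a0 := hInt h₀.1 (hpd 0) (hpds 0)
  have a1 := hInt h₀.1 (hpd 1) (hpds 1)
  have b0 := hInt h₀.2.1 hφ.1.continuous le_rfl
  have b1 := hInt h₁.2.1 hφ.1.continuous le_rfl
  have e0 := h₀.2.2 φ hφ
  have e1 := h₁.2.2 φ hφ
  have l : ∫ x in Ω, f x * fderiv ℝ φ x ξ
      = ξ 0 * (∫ x in Ω, f x * pd 0 φ x) + ξ 1 * ∫ x in Ω, f x * pd 1 φ x := by
    rw [← integral_const_mul, ← integral_const_mul,
      ← integral_add (a0.const_mul _) (a1.const_mul _)]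
    refine integral_congr_ae (Filter.Eventually.of_forall fun y => ?_)
    simp only [hξ]; ring
  have r : ∫ x in Ω, (g₀ x * ξ 0 + g₁ x * ξ 1) * φ x
      = ξ 0 * (∫ x in Ω, g₀ x * φ x) + ξ 1 * ∫ x in Ω, g₁ x * φ x := by
    rw [← integral_const_mul, ← integral_const_mul,
      ← integral_add (b0.const_mul _) (b1.const_mul _)]
    refine integral_congr_ae (Filter.Eventually.of_forall fun y => ?_)
    simp only; ring
  rw [l, r, e0, e1]; ring

/-- A weakly differentiable function on a convex open set is, along almost every segment of a given
direction, the integral of its weak gradient. -/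
theorem HasWeakPartial.ae_sub_eq_integral {Ω K : Set Plane} (hK : IsOpen K) (hKc : Convex ℝ K)
    (hKΩ : K ⊆ Ω) {f g₀ g₁ : Plane → ℝ} (h₀ : HasWeakPartial Ω 0 f g₀)
    (h₁ : HasWeakPartial Ω 1 f g₁) (ξ : Plane) :
    ∀ᵐ x, x ∈ K → x + ξ ∈ K → f (x + ξ) - f x =
      ∫ t in Ioc (0 : ℝ) 1, (g₀ (x + t • ξ) * ξ 0 + g₁ (x + t • ξ) * ξ 1) := by
  set G : Plane → ℝ := fun x => g₀ x * ξ 0 + g₁ x * ξ 1 with hGdef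
  have hfl : LocallyIntegrableOn f K := h₀.1.mono_set hKΩ
  have hGl : LocallyIntegrableOn G K := by
    have : G = ξ 0 • g₀ + ξ 1 • g₁ := by
      funext x
      simp [hGdef, mul_comm]
    rw [this]
    exact ((h₀.2.1.mono_set hKΩ).smul (ξ 0)).add ((h₁.2.1.mono_set hKΩ).smul (ξ 1))
  set U : Set Plane := K ∩ (fun x => x + ξ) ⁻¹' K with hU
  have hUo : IsOpen U := hK.inter (hK.preimage (by fun_prop))
  -- the union of the segments that start in a compact subset of `U`
  have sweep : ∀ C : Set Plane, IsCompact C → C ⊆ U → ∃ C' : Set Plane, IsCompact C' ∧ C' ⊆ K ∧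
      ∀ x ∈ C, ∀ t ∈ Icc (0 : ℝ) 1, x + t • ξ ∈ C' := by
    intro C hC hCU
    refine ⟨(fun q : Plane × ℝ => q.1 + q.2 • ξ) '' (C ×ˢ Icc 0 1),
      (hC.prod isCompact_Icc).image (by fun_prop), ?_, fun x hx t ht => ⟨(x, t), ⟨hx, ht⟩, rfl⟩⟩
    rintro _ ⟨⟨x, t⟩, ⟨hx, ht⟩, rfl⟩
    have h1 := hKc (hCU hx).1 (hCU hx).2 (sub_nonneg.2 ht.2) ht.1 (by ring)
    convert h1 using 1
    simp only
    module
  have cut : ∀ C' : Set Plane, IsCompact C' → C' ⊆ K →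
      Integrable (C'.indicator f) ∧ Integrable (C'.indicator G) := fun C' hC' hCK =>
    ⟨(hfl.integrableOn_compact_subset hCK hC').integrable_indicator hC'.measurableSet,
      (hGl.integrableOn_compact_subset hCK hC').integrable_indicator hC'.measurableSet⟩
  have key : ∀ C C' : Set Plane, (∀ x ∈ C, ∀ t ∈ Icc (0 : ℝ) 1, x + t • ξ ∈ C') → ∀ x ∈ C,
      C'.indicator f (x + ξ) - C'.indicator f x
        - ∫ t in Ioc (0 : ℝ) 1, C'.indicator G (x + t • ξ)
      = f (x + ξ) - f x - ∫ t in Ioc (0 : ℝ) 1, G (x + t • ξ) := by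
    intro C C' h x hx
    have m0 : x ∈ C' := by simpa using h x hx 0 (by simp)
    have m1 : x + ξ ∈ C' := by simpa using h x hx 1 (by simp)
    rw [indicator_of_mem m0, indicator_of_mem m1]
    congr 1
    exact setIntegral_congr_fun measurableSet_Ioc fun t ht =>
      indicator_of_mem (h x hx t ⟨ht.1.le, ht.2⟩) _
  have main := hUo.ae_eq_zero_of_integral_contDiff_smul_eq_zero (μ := volume)
    (f := fun x => f (x + ξ) - f x - ∫ t in Ioc (0 : ℝ) 1, G (x + t • ξ)) ?_ ?_
  · filter_upwards [main] with x hx h1 h2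
    have := hx ⟨h1, h2⟩
    linarith
  · rw [locallyIntegrableOn_iff hUo.isLocallyClosed]
    intro C hCU hC
    obtain ⟨C', hC', hCK, hsw⟩ := sweep C hC hCU
    obtain ⟨i1, i2⟩ := cut C' hC' hCK
    have := ((i1.comp_add_right ξ).sub i1).sub
      (integrable_comp_add_smul_prod i2 ξ).integral_prod_left
    exact (this.integrableOn (s := C)).congr_fun (key C C' hsw) hC.measurableSet
  · intro φ hφ hφc hφU
    obtain ⟨C', hC', hCK, hsw⟩ := sweep (tsupport φ) hφc hφU
    obtain ⟨i1, i2⟩ := cut C' hC' hCK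
    have := integral_mul_difference_eq_zero i1 i2 ξ hφ hφc ?_
    · refine Eq.trans ?_ this
      refine integral_congr_ae (Filter.Eventually.of_forall fun x => ?_)
      simp only [smul_eq_mul]
      by_cases hx : x ∈ tsupport φ
      · rw [key _ C' hsw x hx]
      · simp [image_eq_zero_of_notMem_tsupport hx]
    · intro t ht
      have hts : tsupport (fun y => φ (y - t • ξ)) ⊆ C' := by
        have : tsupport (fun y => φ (y - t • ξ)) = (fun y => y - t • ξ) ⁻¹' tsupport φ := by
          exact tsupport_comp_eq_preimage φ (Homeomorph.subRight (t • ξ))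
        rw [this]
        intro y hy
        simpa using hsw _ hy t ⟨ht.1.le, ht.2⟩
      have htest : IsTest Ω (fun y => φ (y - t • ξ)) := by
        refine ⟨hφ.comp (by fun_prop), ?_, hts.trans (hCK.trans hKΩ)⟩
        exact hC'.of_isClosed_subset (isClosed_tsupport _) hts
      have hfd : ∀ y, fderiv ℝ (fun y => φ (y - t • ξ)) y ξ = fderiv ℝ φ (y - t • ξ) ξ := by
        intro y; rw [fderiv_comp_sub]
      have e := h₀.integral_mul_fderiv h₁ ξ htest
      have conv : ∀ (a ψ : Plane → ℝ), (∀ y, y ∉ C' → ψ y = 0) →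
          ∫ y in Ω, a y * ψ y = ∫ y, C'.indicator a y * ψ y := by
        intro a ψ hψ
        rw [setIntegral_eq_integral_of_forall_compl_eq_zero]
        · refine integral_congr_ae (Filter.Eventually.of_forall fun y => ?_)
          by_cases hy : y ∈ C'
          · simp [hy]
          · simp [hψ y hy]
        · intro y hy
          rw [hψ y fun h => hy (hKΩ (hCK h)), mul_zero]
      rw [conv f _ ?_, conv _ _ ?_] at e
      · simpa only [hfd] using e
      · intro y hy
        exact image_eq_zero_of_notMem_tsupport (f := fun y => φ (y - t • ξ)) fun h => hy (hts h)
      · intro y hy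
        refine image_eq_zero_of_notMem_tsupport
          (f := fun y => fderiv ℝ (fun y => φ (y - t • ξ)) y ξ) fun h => hy (hts ?_)
        exact tsupport_fderiv_apply_subset ℝ _ h

/-! ### A weighted Poincaré inequality on convex sets -/

theorem lintegral_comp_lineMap_le {q : Plane → ENNReal} (hq : Measurable q) {t : ℝ}
    (ht : t ∈ Icc (0 : ℝ) (1 / 2)) (y : Plane) :
    ∫⁻ x, q (x + t • (y - x)) ≤ 4 * ∫⁻ x, q x := by
  have h1 : ∀ x, x + t • (y - x) = (1 - t) • x + t • y := fun x => by module
  have hpos : 1 / 2 ≤ 1 - t := by linarith [ht.2]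
  have hmap := Measure.map_addHaar_smul (volume : Measure Plane) (r := 1 - t) (by linarith)
  have h2 : ∫⁻ x, q (x + t • (y - x)) = ∫⁻ z, q (z + t • y) ∂(volume.map ((1 - t) • ·)) := by
    rw [lintegral_map (by fun_prop) (by fun_prop)]
    simp_rw [h1]
  rw [h2, hmap, lintegral_smul_measure, lintegral_add_right_eq_self q, smul_eq_mul]
  gcongr
  rw [show (4 : ENNReal) = ENNReal.ofReal 4 by simp]
  apply ENNReal.ofReal_le_ofReal
  simp only [finrank_euclideanSpace, Fintype.card_fin]
  rw [abs_of_nonneg (by positivity), inv_le_comm₀ (by nlinarith) (by norm_num)]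
  nlinarith

section Poincare

variable {K : Set Plane} {q : Plane → ENNReal}

theorem setLIntegral_comp_lineMap_mul_le (hK : MeasurableSet K) (hKc : Convex ℝ K)
    (hr : ∀ x ∈ K, 0 ≤ x 0) (hq : Measurable q) {t : ℝ}
    (ht : t ∈ Icc (0 : ℝ) (1 / 2)) {y : Plane} (hy : y ∈ K) :
    ∫⁻ x in K, q (x + t • (y - x)) * ENNReal.ofReal (x 0)
      ≤ 8 * ∫⁻ x in K, q x * ENNReal.ofReal (x 0) := by
  set F : Plane → ENNReal := K.indicator fun x => q x * ENNReal.ofReal (x 0)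
  have hF : Measurable F := Measurable.indicator (by fun_prop) hK
  calc ∫⁻ x in K, q (x + t • (y - x)) * ENNReal.ofReal (x 0)
      ≤ ∫⁻ x in K, 2 * F (x + t • (y - x)) := by
        refine setLIntegral_mono' hK fun x hx => ?_
        have hz : x + t • (y - x) ∈ K := by
          have := hKc hx hy (by linarith [ht.2] : 0 ≤ 1 - t) ht.1 (by ring)
          convert this using 1
          module
        simp only [F, indicator_of_mem hz]
        rw [mul_left_comm]
        gcongr
        have h2 : (2 : ENNReal) * ENNReal.ofReal ((x + t • (y - x)) 0)
            = ENNReal.ofReal (2 * (x + t • (y - x)) 0) := by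
          rw [ENNReal.ofReal_mul (by norm_num)]; simp
        rw [h2]
        apply ENNReal.ofReal_le_ofReal
        have h0 := hr x hx
        have h1 := hr y hy
        simp only [PiLp.add_apply, PiLp.smul_apply, PiLp.sub_apply, smul_eq_mul]
        nlinarith [ht.1, ht.2, mul_nonneg ht.1 h1, mul_nonneg h0 (sub_nonneg.2 ht.2)]
    _ ≤ ∫⁻ x, 2 * F (x + t • (y - x)) := setLIntegral_le_lintegral _ _
    _ = 2 * ∫⁻ x, F (x + t • (y - x)) := lintegral_const_mul _ (by fun_prop)
    _ ≤ 2 * (4 * ∫⁻ x, F x) := by gcongr; exact lintegral_comp_lineMap_le hF ht y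
    _ = 8 * ∫⁻ x in K, q x * ENNReal.ofReal (x 0) := by
        rw [← mul_assoc, lintegral_indicator hK]; norm_num

theorem lintegral_lintegral_comp_lineMap_le (hK : MeasurableSet K) (hKc : Convex ℝ K)
    (hr : ∀ x ∈ K, 0 ≤ x 0) (hq : Measurable q) {t : ℝ} (ht : t ∈ Icc (0 : ℝ) 1) :
    ∫⁻ x in K, ∫⁻ y in K, q (x + t • (y - x)) * (ENNReal.ofReal (x 0) * ENNReal.ofReal (y 0))
      ≤ 8 * (∫⁻ x in K, q x * ENNReal.ofReal (x 0)) * ∫⁻ x in K, ENNReal.ofReal (x 0) := by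
  have half : ∀ t ∈ Icc (0 : ℝ) (1 / 2), ∫⁻ y in K, ∫⁻ x in K,
      q (x + t • (y - x)) * (ENNReal.ofReal (x 0) * ENNReal.ofReal (y 0))
      ≤ 8 * (∫⁻ x in K, q x * ENNReal.ofReal (x 0)) * ∫⁻ x in K, ENNReal.ofReal (x 0) := by
    intro t ht
    rw [← lintegral_const_mul _ (by fun_prop)]
    refine setLIntegral_mono' hK fun y hy => ?_
    simp_rw [← mul_assoc]
    rw [lintegral_mul_const _ (by fun_prop)]
    gcongr
    exact setLIntegral_comp_lineMap_mul_le hK hKc hr hq ht hy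
  rcases le_total t (1 / 2) with h | h
  · rw [lintegral_lintegral_swap (by fun_prop)]
    exact half t ⟨ht.1, h⟩
  · have := half (1 - t) ⟨by linarith [ht.2], by linarith⟩
    refine le_of_eq_of_le ?_ this
    refine lintegral_congr fun x => lintegral_congr fun y => ?_
    rw [show x + t • (y - x) = y + (1 - t) • (x - y) by module,
      mul_comm (ENNReal.ofReal (x 0))]

theorem sq_integral_le_lintegral_sq {G : ℝ → ℝ} {Q : ℝ → ENNReal} (hQ : Measurable Q) {A : ENNReal}
    (h : ∀ t, ‖G t‖ₑ ^ 2 ≤ A * Q t) :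
    ‖∫ t in Ioc (0 : ℝ) 1, G t‖ₑ ^ 2 ≤ A * ∫⁻ t in Ioc (0 : ℝ) 1, Q t := by
  by_cases hG : AEStronglyMeasurable G (volume.restrict (Ioc (0 : ℝ) 1))
  · have : IsProbabilityMeasure (volume.restrict (Ioc (0 : ℝ) 1)) := ⟨by simp⟩
    have h1 : ‖∫ t in Ioc (0 : ℝ) 1, G t‖ₑ ≤ eLpNorm G 2 (volume.restrict (Ioc (0 : ℝ) 1)) := by
      refine (enorm_integral_le_lintegral_enorm _).trans ?_
      rw [← eLpNorm_one_eq_lintegral_enorm]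
      exact eLpNorm_le_eLpNorm_of_exponent_le (by norm_num) hG
    have h2 : eLpNorm G 2 (volume.restrict (Ioc (0 : ℝ) 1)) ^ 2
        = ∫⁻ t in Ioc (0 : ℝ) 1, ‖G t‖ₑ ^ 2 := by
      have := eLpNorm_nnreal_pow_eq_lintegral (f := G) (p := 2)
        (μ := volume.restrict (Ioc (0 : ℝ) 1)) (by norm_num)
      simpa using this
    calc _ ≤ eLpNorm G 2 (volume.restrict (Ioc (0 : ℝ) 1)) ^ 2 := by gcongr
      _ = ∫⁻ t in Ioc (0 : ℝ) 1, ‖G t‖ₑ ^ 2 := h2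
      _ ≤ ∫⁻ t in Ioc (0 : ℝ) 1, A * Q t := lintegral_mono h
      _ = _ := lintegral_const_mul _ hQ
  · rw [integral_non_aestronglyMeasurable hG]
    simp

theorem ofReal_sq_eq_enorm_sq (a : ℝ) : ENNReal.ofReal (a ^ 2) = ‖a‖ₑ ^ 2 := by
  rw [← sq_abs, ENNReal.ofReal_pow (abs_nonneg a), Real.enorm_eq_ofReal_abs]

theorem poincare_of_isOpen {Ω : Set Plane} (hK : IsOpen K) (hKc : Convex ℝ K) (hKΩ : K ⊆ Ω)
    (hr : ∀ x ∈ K, 0 ≤ x 0) {d : ℝ} (hd : ∀ x ∈ K, ∀ y ∈ K, dist x y ≤ d)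
    {f g₀ g₁ : Plane → ℝ} (hf : Measurable f) (hg₀ : Measurable g₀) (hg₁ : Measurable g₁)
    (h₀ : HasWeakPartial Ω 0 f g₀) (h₁ : HasWeakPartial Ω 1 f g₁) :
    ∫⁻ x in K, ∫⁻ y in K, ENNReal.ofReal ((f x - f y) ^ 2) *
        (ENNReal.ofReal (x 0) * ENNReal.ofReal (y 0))
      ≤ ENNReal.ofReal (8 * d ^ 2) *
        (∫⁻ x in K, ENNReal.ofReal (g₀ x ^ 2 + g₁ x ^ 2) * ENNReal.ofReal (x 0)) *
        ∫⁻ x in K, ENNReal.ofReal (x 0) := by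
  set q : Plane → ENNReal := fun x => ENNReal.ofReal (g₀ x ^ 2 + g₁ x ^ 2) with hqdef
  have hq : Measurable q := by fun_prop
  have hKm := hK.measurableSet
  have step : ∀ ξ : Plane, ∀ᵐ x, x ∈ K → x + ξ ∈ K → ENNReal.ofReal ((f x - f (x + ξ)) ^ 2)
      ≤ ENNReal.ofReal (d ^ 2) * ∫⁻ t in Ioc (0 : ℝ) 1, q (x + t • ξ) := by
    intro ξ
    filter_upwards [HasWeakPartial.ae_sub_eq_integral hK hKc hKΩ h₀ h₁ ξ] with x hx h1 h2
    have hξ : ‖ξ‖ ≤ d := by simpa [dist_eq_norm] using hd (x + ξ) h2 x h1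
    rw [← neg_sub, neg_sq, hx h1 h2, ofReal_sq_eq_enorm_sq]
    refine sq_integral_le_lintegral_sq (by fun_prop) fun t => ?_
    rw [← ofReal_sq_eq_enorm_sq, ← ENNReal.ofReal_mul (by positivity)]
    apply ENNReal.ofReal_le_ofReal
    have hn : ‖ξ‖ ^ 2 = ξ 0 ^ 2 + ξ 1 ^ 2 := by
      rw [EuclideanSpace.norm_sq_eq]; simp
    have hd2 : ξ 0 ^ 2 + ξ 1 ^ 2 ≤ d ^ 2 := by
      rw [← hn]; gcongr
    set u := g₀ (x + t • ξ)
    set v := g₁ (x + t • ξ)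
    nlinarith [sq_nonneg (u * ξ 1 - v * ξ 0), sq_nonneg u, sq_nonneg v]
  -- both sides as iterated integrals over the whole plane
  have conv : ∀ H : Plane → Plane → ENNReal, Measurable (fun p : Plane × Plane => H p.1 p.2) →
      ∫⁻ x in K, ∫⁻ y in K, H x y
        = ∫⁻ ξ, ∫⁻ x, K.indicator 1 x * (K.indicator 1 (x + ξ) * H x (x + ξ)) := by
    intro H hH
    have hI : Measurable (K.indicator (1 : Plane → ENNReal)) := measurable_one.indicator hKm
    have hI' : Measurable fun p : Plane × Plane =>
        K.indicator (1 : Plane → ENNReal) p.1 * (K.indicator 1 p.2 * H p.1 p.2) := by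
      exact (hI.comp measurable_fst).mul ((hI.comp measurable_snd).mul hH)
    rw [← lintegral_indicator hKm, lintegral_lintegral_swap]
    · refine lintegral_congr fun x => ?_
      rw [lintegral_add_left_eq_self
        (fun y => K.indicator (1 : Plane → ENNReal) x * (K.indicator 1 y * H x y)) x]
      by_cases hx : x ∈ K
      · simp only [indicator_of_mem hx, Pi.one_apply, one_mul]
        rw [← lintegral_indicator hKm]
        refine lintegral_congr fun y => ?_
        by_cases hy : y ∈ K <;> simp [hy]
      · simp [hx]
    · exact (hI'.comp (f := fun p : Plane × Plane => (p.2, p.2 + p.1)) (by fun_prop)).aemeasurable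
  have hQm : Measurable fun p : Plane × Plane =>
      ∫⁻ t in Ioc (0 : ℝ) 1, q (p.1 + t • (p.2 - p.1)) := by
    refine Measurable.lintegral_prod_right' (f := fun z : (Plane × Plane) × ℝ =>
      q (z.1.1 + z.2 • (z.1.2 - z.1.1))) ?_
    fun_prop
  calc _ ≤ ∫⁻ x in K, ∫⁻ y in K, ENNReal.ofReal (d ^ 2) *
          (∫⁻ t in Ioc (0 : ℝ) 1, q (x + t • (y - x))) *
            (ENNReal.ofReal (x 0) * ENNReal.ofReal (y 0)) := by
        rw [conv _ (by fun_prop), conv _ (by fun_prop)]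
        refine lintegral_mono fun ξ => lintegral_mono_ae ?_
        filter_upwards [step ξ] with x hx
        by_cases h1 : x ∈ K
        · by_cases h2 : x + ξ ∈ K
          · have := hx h1 h2
            simp only [add_sub_cancel_left]
            gcongr
          · simp [h2]
        · simp [h1]
    _ = ENNReal.ofReal (d ^ 2) * ∫⁻ t in Ioc (0 : ℝ) 1, ∫⁻ x in K, ∫⁻ y in K,
          q (x + t • (y - x)) * (ENNReal.ofReal (x 0) * ENNReal.ofReal (y 0)) := by
        have e : ∫⁻ t in Ioc (0 : ℝ) 1, ∫⁻ x in K, ∫⁻ y in K,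
            q (x + t • (y - x)) * (ENNReal.ofReal (x 0) * ENNReal.ofReal (y 0))
            = ∫⁻ x in K, ∫⁻ y in K, (∫⁻ t in Ioc (0 : ℝ) 1, q (x + t • (y - x))) *
              (ENNReal.ofReal (x 0) * ENNReal.ofReal (y 0)) := by
          rw [lintegral_lintegral_swap]
          · refine lintegral_congr fun x => ?_
            rw [lintegral_lintegral_swap (by fun_prop)]
            exact lintegral_congr fun y => lintegral_mul_const _ (by fun_prop)
          · refine Measurable.aemeasurable ?_
            exact Measurable.lintegral_prod_right' (f := fun z : (ℝ × Plane) × Plane =>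
              q (z.1.2 + z.1.1 • (z.2 - z.1.2)) *
                (ENNReal.ofReal (z.1.2 0) * ENNReal.ofReal (z.2 0))) (by fun_prop)
        rw [e, ← lintegral_const_mul]
        · refine lintegral_congr fun x => ?_
          rw [← lintegral_const_mul]
          · simp_rw [mul_assoc]
          · exact (hQm.comp (f := fun y : Plane => (x, y)) (by fun_prop)).mul (by fun_prop)
        · exact Measurable.lintegral_prod_right' (f := fun p : Plane × Plane =>
            (∫⁻ t in Ioc (0 : ℝ) 1, q (p.1 + t • (p.2 - p.1))) *
              (ENNReal.ofReal (p.1 0) * ENNReal.ofReal (p.2 0))) (hQm.mul (by fun_prop))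
    _ ≤ ENNReal.ofReal (d ^ 2) * ∫⁻ t in Ioc (0 : ℝ) 1,
          8 * (∫⁻ x in K, q x * ENNReal.ofReal (x 0)) * ∫⁻ x in K, ENNReal.ofReal (x 0) := by
        refine mul_le_mul_right ?_ _
        exact setLIntegral_mono' measurableSet_Ioc fun t ht =>
          lintegral_lintegral_comp_lineMap_le hKm hKc hr hq ⟨ht.1.le, ht.2⟩
    _ = _ := by
        rw [ENNReal.ofReal_mul (by norm_num)]
        simp
        ring

end Poincare

/-! ### Integration over triangles -/

/-- The two-dimensional cross product. -/
def cr (x y : Plane) : ℝ := x 0 * y 1 - x 1 * y 0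

theorem mem_convexHull_triple {a b p x : Plane} :
    x ∈ convexHull ℝ {a, b, p} ↔
      ∃ α β γ : ℝ, 0 ≤ α ∧ 0 ≤ β ∧ 0 ≤ γ ∧ α + β + γ = 1 ∧ α • a + β • b + γ • p = x := by
  constructor
  · intro hx
    have hconv : Convex ℝ {x : Plane | ∃ α β γ : ℝ, 0 ≤ α ∧ 0 ≤ β ∧ 0 ≤ γ ∧ α + β + γ = 1 ∧
        α • a + β • b + γ • p = x} := by
      rintro _ ⟨α, β, γ, h1, h2, h3, h4, rfl⟩ _ ⟨α', β', γ', h1', h2', h3', h4', rfl⟩ s t hs ht hst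
      refine ⟨s * α + t * α', s * β + t * β', s * γ + t * γ', by positivity, by positivity,
        by positivity, ?_, by module⟩
      linear_combination s * h4 + t * h4' + hst
    refine convexHull_min ?_ hconv hx
    rintro y (rfl | rfl | rfl)
    · exact ⟨1, 0, 0, by simp⟩
    · exact ⟨0, 1, 0, by simp⟩
    · exact ⟨0, 0, 1, by simp⟩
  · rintro ⟨α, β, γ, h1, h2, h3, h4, rfl⟩
    have h := (convex_convexHull ℝ ({a, b, p} : Set Plane)).sum_mem (t := Finset.univ)
      (w := ![α, β, γ]) (z := ![a, b, p]) ?_ ?_ ?_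
    · simpa [Fin.sum_univ_three] using h
    · intro i _; fin_cases i <;> simpa
    · simp [Fin.sum_univ_three, h4]
    · intro i _
      apply subset_convexHull
      fin_cases i <;> simp

/-- The reference triangle. -/
def refTriangle : Set (ℝ × ℝ) := {z | 0 ≤ z.1 ∧ 0 ≤ z.2 ∧ z.1 + z.2 ≤ 1}

theorem isCompact_refTriangle : IsCompact refTriangle := by
  refine (isCompact_Icc.prod isCompact_Icc : IsCompact (Icc (0 : ℝ) 1 ×ˢ Icc (0 : ℝ) 1))
    |>.of_isClosed_subset ?_ ?_
  · exact (isClosed_le continuous_const continuous_fst).inter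
      ((isClosed_le continuous_const continuous_snd).inter
        (isClosed_le (continuous_fst.add continuous_snd) continuous_const))
  · rintro ⟨x, y⟩ ⟨h1, h2, h3⟩
    simp only at h1 h2 h3
    exact ⟨⟨h1, by simp only; linarith⟩, ⟨h2, by simp only; linarith⟩⟩

theorem setIntegral_refTriangle {G : ℝ × ℝ → ℝ} (hG : Continuous G) :
    ∫ z in refTriangle, G z = ∫ ξ in (0 : ℝ)..1, ∫ η in (0 : ℝ)..(1 - ξ), G (ξ, η) := by
  have hm := isCompact_refTriangle.measurableSet
  have hInt : Integrable (refTriangle.indicator G) :=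
    (hG.continuousOn.integrableOn_compact isCompact_refTriangle).integrable_indicator hm
  rw [← integral_indicator hm, Measure.volume_eq_prod, integral_prod _ hInt,
    intervalIntegral.integral_of_le zero_le_one, ← integral_Icc_eq_integral_Ioc,
    ← integral_indicator measurableSet_Icc]
  refine integral_congr_ae (Filter.Eventually.of_forall fun ξ => ?_)
  by_cases hξ : ξ ∈ Icc (0 : ℝ) 1
  · simp only [indicator_of_mem hξ]
    rw [intervalIntegral.integral_of_le (by linarith [hξ.2]), ← integral_Icc_eq_integral_Ioc,
      ← integral_indicator measurableSet_Icc]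
    refine integral_congr_ae (Filter.Eventually.of_forall fun η => ?_)
    by_cases hη : η ∈ Icc (0 : ℝ) (1 - ξ)
    · have : (ξ, η) ∈ refTriangle := ⟨hξ.1, hη.1, by simp only; linarith [hη.2]⟩
      simp only [indicator_of_mem hη, indicator_of_mem this]
    · have : (ξ, η) ∉ refTriangle := fun h =>
        hη ⟨h.2.1, by have := h.2.2; simp only at this; linarith⟩
      simp only [indicator_of_notMem hη, indicator_of_notMem this]
  · simp only [indicator_of_notMem hξ]
    have : ∀ η, (ξ, η) ∉ refTriangle := fun η h => hξ
      ⟨h.1, by have h1 := h.2.2; have h2 := h.2.1; simp only at h1 h2; linarith⟩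
    simp [this]

/-- Coordinates on the plane as a measure preserving equivalence. -/
def planeProd : Plane ≃ᵐ ℝ × ℝ :=
  (MeasurableEquiv.toLp 2 (Fin 2 → ℝ)).symm.trans MeasurableEquiv.finTwoArrow

theorem planeProd_apply (x : Plane) : planeProd x = (x 0, x 1) := rfl

theorem measurePreserving_planeProd : MeasurePreserving planeProd :=
  (EuclideanSpace.volume_preserving_symm_measurableEquiv_toLp (Fin 2)).trans
    (volume_preserving_finTwoArrow ℝ)

theorem det_of_columns (u v : Plane) (L : Plane →L[ℝ] Plane)
    (hL : ∀ y, L y = y 0 • u + y 1 • v) : L.det = cr u v := by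
  rw [ContinuousLinearMap.det, ← LinearMap.det_toMatrix (EuclideanSpace.basisFun (Fin 2) ℝ).toBasis,
    Matrix.det_fin_two]
  simp [LinearMap.toMatrix_apply, hL, cr]
  ring

theorem setIntegral_triangle {a b p : Plane} (h : cr (a - p) (b - p) ≠ 0) {F : Plane → ℝ}
    (hF : Continuous F) :
    ∫ x in convexHull ℝ {a, b, p}, F x = |cr (a - p) (b - p)| *
      ∫ ξ in (0 : ℝ)..1, ∫ η in (0 : ℝ)..(1 - ξ), F (p + ξ • (a - p) + η • (b - p)) := by
  set L : Plane →L[ℝ] Plane := (EuclideanSpace.proj 0).smulRight (a - p) +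
    (EuclideanSpace.proj 1).smulRight (b - p) with hLdef
  have hL : ∀ y, L y = y 0 • (a - p) + y 1 • (b - p) := fun y => by simp [hLdef]
  have hdet := det_of_columns _ _ L hL
  set S : Set Plane := planeProd ⁻¹' refTriangle with hS
  have hSm : MeasurableSet S := planeProd.measurable isCompact_refTriangle.measurableSet
  have himg : (fun y => p + L y) '' S = convexHull ℝ {a, b, p} := by
    ext x
    rw [mem_convexHull_triple]
    constructor
    · rintro ⟨y, ⟨h1, h2, h3⟩, rfl⟩
      rw [planeProd_apply] at h1 h2 h3
      refine ⟨y 0, y 1, 1 - y 0 - y 1, h1, h2, by simp only at h3; linarith, by ring, ?_⟩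
      simp only [hL]
      module
    · rintro ⟨α, β, γ, h1, h2, h3, h4, rfl⟩
      refine ⟨!₂[α, β], ⟨by simpa [planeProd_apply] using h1, by simpa [planeProd_apply] using h2,
        by simp [planeProd_apply]; linarith⟩, ?_⟩
      simp only [hL]
      obtain rfl : γ = 1 - α - β := by linarith
      simp
      module
  have hinj : InjOn (fun y => p + L y) S := by
    have hLi : Function.Injective L := by
      have : IsUnit L.det := by rw [hdet]; exact h.isUnit
      rw [ContinuousLinearMap.det] at this
      exact (LinearMap.ker_eq_bot.1 (LinearMap.isUnit_iff_ker_eq_bot _ |>.1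
        ((LinearMap.isUnit_iff_isUnit_det _).2 this)))
    intro x _ y _ hxy
    exact hLi (add_left_cancel hxy)
  rw [← himg, integral_image_eq_integral_abs_det_fderiv_smul volume hSm
    (f' := fun _ => L) (fun x _ => (L.hasFDerivAt.const_add p).hasFDerivWithinAt) hinj]
  simp only [smul_eq_mul]
  rw [integral_const_mul, hdet, ← setIntegral_refTriangle
    (G := fun z => F (p + z.1 • (a - p) + z.2 • (b - p))) (by fun_prop)]
  rw [← measurePreserving_planeProd.setIntegral_preimage_emb planeProd.measurableEmbedding]
  congr 1
  refine setIntegral_congr_fun hSm fun y _ => ?_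
  simp only [hL, planeProd_apply, add_assoc]

theorem setIntegral_radius_triangle {a b p : Plane} (h : cr (a - p) (b - p) ≠ 0) :
    ∫ x in convexHull ℝ {a, b, p}, x 0 = |cr (a - p) (b - p)| * ((a 0 + b 0 + p 0) / 6) := by
  rw [setIntegral_triangle h (by fun_prop)]
  congr 1
  have h1 : ∀ ξ : ℝ, ∫ η in (0 : ℝ)..(1 - ξ), (p + ξ • (a - p) + η • (b - p)) 0
      = (p 0 + ξ * (a 0 - p 0)) * (1 - ξ) + (b 0 - p 0) * ((1 - ξ) ^ 2 / 2) := by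
    intro ξ
    simp only [PiLp.add_apply, PiLp.smul_apply, PiLp.sub_apply, smul_eq_mul]
    rw [intervalIntegral.integral_add (by simp) (by apply Continuous.intervalIntegrable; fun_prop)]
    simp
    ring
  simp_rw [h1]
  have h2 : ∀ ξ ∈ uIcc (0 : ℝ) 1, HasDerivAt (fun ξ : ℝ => p 0 * (ξ - ξ ^ 2 / 2) +
      (a 0 - p 0) * (ξ ^ 2 / 2 - ξ ^ 3 / 3) + (b 0 - p 0) * (-(1 - ξ) ^ 3 / 6))
      ((p 0 + ξ * (a 0 - p 0)) * (1 - ξ) + (b 0 - p 0) * ((1 - ξ) ^ 2 / 2)) ξ := by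
    intro ξ _
    have d0 := hasDerivAt_id ξ
    have d1 : HasDerivAt (fun ξ : ℝ => 1 - ξ) (-1) ξ := by simpa using d0.const_sub 1
    have := (((d0.sub ((d0.pow 2).div_const 2)).const_mul (p 0)).add
      ((((d0.pow 2).div_const 2).sub ((d0.pow 3).div_const 3)).const_mul (a 0 - p 0))).add
      ((((d1.pow 3).neg).div_const 6).const_mul (b 0 - p 0))
    refine this.congr_deriv ?_
    simp
    ring
  rw [intervalIntegral.integral_eq_sub_of_hasDerivAt h2
    (by apply Continuous.intervalIntegrable; fun_prop)]
  norm_num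
  ring

theorem setIntegral_triangle_partial {a b p : Plane} (h : cr (a - p) (b - p) ≠ 0) {φ : Plane → ℝ}
    (hφ : ContDiff ℝ 1 φ) :
    ∫ x in convexHull ℝ {a, b, p}, (φ x +
        cr (a - p) (x - p) / cr (a - p) (b - p) * fderiv ℝ φ x (b - p))
      = |cr (a - p) (b - p)| * ∫ ξ in (0 : ℝ)..1, (1 - ξ) * φ (b + ξ • (a - b)) := by
  have hd : Continuous fun x => fderiv ℝ φ x (b - p) :=
    (hφ.continuous_fderiv one_ne_zero).clm_apply continuous_const
  have hφc := hφ.continuous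
  have hF : Continuous fun x => φ x +
      cr (a - p) (x - p) / cr (a - p) (b - p) * fderiv ℝ φ x (b - p) := by
    unfold cr
    fun_prop
  rw [setIntegral_triangle h hF]
  congr 1
  refine intervalIntegral.integral_congr fun ξ _ => ?_
  beta_reduce
  have hη : ∀ η : ℝ, cr (a - p) (p + ξ • (a - p) + η • (b - p) - p) / cr (a - p) (b - p) = η := by
    intro η
    rw [div_eq_iff h]
    simp [cr]
    ring
  simp_rw [hη]
  have hD : ∀ η ∈ uIcc (0 : ℝ) (1 - ξ),
      HasDerivAt (fun η : ℝ => η * φ (p + ξ • (a - p) + η • (b - p)))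
        (φ (p + ξ • (a - p) + η • (b - p)) +
          η * fderiv ℝ φ (p + ξ • (a - p) + η • (b - p)) (b - p)) η := by
    intro η _
    have hφd : HasFDerivAt φ (fderiv ℝ φ (p + ξ • (a - p) + η • (b - p)))
        (p + ξ • (a - p) + η • (b - p)) := ((hφ.differentiable one_ne_zero) _).hasFDerivAt
    have hl : HasDerivAt (fun η : ℝ => p + ξ • (a - p) + η • (b - p)) ((1 : ℝ) • (b - p)) η :=
      ((hasDerivAt_id η).smul_const _).const_add _
    have := (hasDerivAt_id η).mul (hφd.comp_hasDerivAt η hl)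
    refine this.congr_deriv ?_
    simp
  rw [intervalIntegral.integral_eq_sub_of_hasDerivAt hD]
  · simp
    left
    congr 1
    module
  · apply Continuous.intervalIntegrable
    have := hd.comp (by fun_prop : Continuous fun η : ℝ => p + ξ • (a - p) + η • (b - p))
    simp only [Function.comp_def] at this
    fun_prop

theorem cr_smul_eq (u v w : Plane) : cr u v • w = cr u w • v - cr v w • u := by
  ext i
  fin_cases i <;> (simp [cr]; ring)

theorem cr_neg_swap (x y : Plane) : cr x y = -cr y x := by simp [cr]; ring

/-- Gauss–Green for the field `x ↦ x - p` on a triangle with vertex `p`: only the edge opposite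
to `p` contributes. -/
theorem gauss_green_triangle {a b p : Plane} (h : cr (a - p) (b - p) ≠ 0) {φ : Plane → ℝ}
    (hφ : ContDiff ℝ 1 φ) :
    ∫ x in convexHull ℝ {a, b, p}, (fderiv ℝ φ x (x - p) + 2 * φ x)
      = |cr (a - p) (b - p)| * ∫ t in (0 : ℝ)..1, φ (a + t • (b - a)) := by
  have h' : cr (b - p) (a - p) ≠ 0 := by rw [cr_neg_swap]; exact neg_ne_zero.2 h
  have e1 := setIntegral_triangle_partial h hφ
  have e2 := setIntegral_triangle_partial h' hφ
  rw [Set.insert_comm b a, cr_neg_swap (b - p) (a - p), abs_neg] at e2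
  have hφc := hφ.continuous
  have hd : ∀ v : Plane, Continuous fun x => fderiv ℝ φ x v := fun v =>
    (hφ.continuous_fderiv one_ne_zero).clm_apply continuous_const
  have hcomp : IsCompact (convexHull ℝ {a, b, p}) :=
    (Set.toFinite {a, b, p}).isCompact_convexHull (𝕜 := ℝ)
  have hi : ∀ (v w : Plane) (c : ℝ), IntegrableOn (fun x => φ x +
      cr v (x - p) / c * fderiv ℝ φ x w) (convexHull ℝ {a, b, p}) := by
    intro v w c
    have := hd w
    refine ContinuousOn.integrableOn_compact hcomp ?_
    unfold cr
    fun_prop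
  have hsplit : ∫ x in convexHull ℝ {a, b, p}, (fderiv ℝ φ x (x - p) + 2 * φ x)
      = (∫ x in convexHull ℝ {a, b, p}, (φ x +
        cr (a - p) (x - p) / cr (a - p) (b - p) * fderiv ℝ φ x (b - p))) +
        ∫ x in convexHull ℝ {a, b, p}, (φ x +
        cr (b - p) (x - p) / -cr (a - p) (b - p) * fderiv ℝ φ x (a - p)) := by
    rw [← integral_add (hi _ _ _) (hi _ _ _)]
    refine integral_congr_ae (Filter.Eventually.of_forall fun x => ?_)
    have hx : x - p = (cr (a - p) (x - p) / cr (a - p) (b - p)) • (b - p) +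
        (cr (b - p) (x - p) / -cr (a - p) (b - p)) • (a - p) := by
      rw [eq_comm, div_neg, neg_smul, ← sub_eq_add_neg, div_eq_inv_mul, div_eq_inv_mul, mul_smul,
        mul_smul, ← smul_sub, ← cr_smul_eq, inv_smul_smul₀ h]
    simp only
    conv_lhs => rw [hx]
    rw [map_add, map_smul, map_smul]
    simp only [smul_eq_mul]
    ring
  rw [hsplit, e1, e2, ← mul_add]
  congr 1
  have e3 : ∫ ξ in (0 : ℝ)..1, (1 - ξ) * φ (b + ξ • (a - b))
      = ∫ ξ in (0 : ℝ)..1, ξ * φ (a + ξ • (b - a)) := by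
    have := intervalIntegral.integral_comp_sub_left (a := (0 : ℝ)) (b := 1)
      (fun ξ : ℝ => ξ * φ (a + ξ • (b - a))) 1
    simp only [sub_self, sub_zero] at this
    rw [← this]
    refine intervalIntegral.integral_congr fun ξ _ => ?_
    beta_reduce
    congr 2
    module
  rw [e3, ← intervalIntegral.integral_add]
  · refine intervalIntegral.integral_congr fun ξ _ => ?_
    beta_reduce
    ring
  all_goals
    apply Continuous.intervalIntegrable
    fun_prop

/-! ### Plane geometry of triangles -/

theorem abs_cr_le (x y : Plane) : |cr x y| ≤ ‖x‖ * ‖y‖ := by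
  refine abs_le_of_sq_le_sq ?_ (by positivity)
  rw [mul_pow, EuclideanSpace.norm_sq_eq, EuclideanSpace.norm_sq_eq]
  simp only [Fin.sum_univ_two, Real.norm_eq_abs, sq_abs, cr]
  nlinarith [sq_nonneg (x 0 * y 0 + x 1 * y 1)]

/-- Barycentric coordinates. -/
theorem cr_smul_eq_barycentric (a b p x : Plane) : cr (a - p) (b - p) • x =
    cr (b - x) (p - b) • a + cr (p - x) (a - p) • b + cr (a - x) (b - x) • p := by
  ext i
  fin_cases i <;> (simp [cr]; ring)

theorem cr_eq_sum_barycentric (a b p x : Plane) : cr (a - p) (b - p) =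
    cr (b - x) (p - b) + cr (p - x) (a - p) + cr (a - x) (b - x) := by
  simp [cr]
  ring

theorem eq_barycentric {a b p : Plane} (h : cr (a - p) (b - p) ≠ 0) (x : Plane) :
    x = (cr (b - x) (p - b) / cr (a - p) (b - p)) • a +
      (cr (p - x) (a - p) / cr (a - p) (b - p)) • b +
      (cr (a - x) (b - x) / cr (a - p) (b - p)) • p := by
  rw [eq_comm, div_eq_inv_mul, div_eq_inv_mul, div_eq_inv_mul, mul_smul, mul_smul, mul_smul,
    ← smul_add, ← smul_add, ← cr_smul_eq_barycentric, inv_smul_smul₀ h]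

theorem barycentric_sum {a b p : Plane} (h : cr (a - p) (b - p) ≠ 0) (x : Plane) :
    cr (b - x) (p - b) / cr (a - p) (b - p) + cr (p - x) (a - p) / cr (a - p) (b - p) +
      cr (a - x) (b - x) / cr (a - p) (b - p) = 1 := by
  rw [← add_div, ← add_div, ← cr_eq_sum_barycentric, div_self h]

theorem cr_sub_comb {a b p : Plane} {α β γ : ℝ} (h : α + β + γ = 1) :
    cr (a - (α • a + β • b + γ • p)) (b - (α • a + β • b + γ • p)) = γ * cr (a - p) (b - p) := by
  obtain rfl : α = 1 - β - γ := by linarith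
  simp [cr]
  ring

theorem cr_eq_zero_of_mem_segment {a b x : Plane} (hx : x ∈ convexHull ℝ {a, b}) :
    cr (a - x) (b - x) = 0 := by
  rw [convexHull_pair] at hx
  obtain ⟨s, t, hs, ht, hst, rfl⟩ := hx
  obtain rfl : s = 1 - t := by linarith
  simp [cr]
  ring

/-- If two triangles with a common edge meet in that edge only, they lie on opposite sides. -/
theorem cr_mul_cr_neg {a b p p' : Plane} (h : cr (a - p) (b - p) ≠ 0)
    (h' : cr (a - p') (b - p') ≠ 0)
    (hi : convexHull ℝ {a, b, p} ∩ convexHull ℝ {a, b, p'} ⊆ convexHull ℝ {a, b}) :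
    cr (a - p) (b - p) * cr (a - p') (b - p') < 0 := by
  by_contra hcon
  have hpos : 0 < cr (a - p) (b - p) * cr (a - p') (b - p') :=
    lt_of_le_of_ne (not_lt.1 hcon) (mul_ne_zero h h').symm
  have hγ : 0 < cr (a - p') (b - p') / cr (a - p) (b - p) := by
    rw [div_eq_mul_inv]
    rcases mul_pos_iff.1 hpos with ⟨h1, h2⟩ | ⟨h1, h2⟩
    · positivity
    · exact mul_pos_of_neg_of_neg h2 (inv_lt_zero.2 h1)
  have hp' := eq_barycentric h p'
  have hsum := barycentric_sum h p'
  set α := cr (b - p') (p - b) / cr (a - p) (b - p)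
  set β := cr (p - p') (a - p) / cr (a - p) (b - p)
  set γ := cr (a - p') (b - p') / cr (a - p) (b - p)
  have hD : 0 < 1 + 2 * |α| + 2 * |β| := by positivity
  set ε := (1 + 2 * |α| + 2 * |β|)⁻¹ with hε
  have hε0 : 0 < ε := inv_pos.2 hD
  have hε1 : ε * (1 + 2 * |α| + 2 * |β|) = 1 := inv_mul_cancel₀ hD.ne'
  have ha : 0 ≤ ε * (|α| + α) := mul_nonneg hε0.le (by linarith [neg_abs_le α])
  have hb : 0 ≤ ε * (|β| + β) := mul_nonneg hε0.le (by linarith [neg_abs_le β])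
  have ha' : 0 ≤ ε * |α| := by positivity
  have hb' : 0 ≤ ε * |β| := by positivity
  set y : Plane := ((1 - ε) / 2) • a + ((1 - ε) / 2) • b + ε • p' with hy
  have hy' : y = ((1 - ε) / 2 + ε * α) • a + ((1 - ε) / 2 + ε * β) • b + (ε * γ) • p := by
    rw [hy, hp']; module
  have m1 : y ∈ convexHull ℝ {a, b, p'} :=
    mem_convexHull_triple.2 ⟨_, _, _, by nlinarith, by nlinarith, hε0.le, by ring, rfl⟩
  have m2 : y ∈ convexHull ℝ {a, b, p} :=
    mem_convexHull_triple.2 ⟨_, _, _, by nlinarith, by nlinarith, by positivity,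
      by linear_combination ε * hsum, hy'.symm⟩
  have h0 := cr_eq_zero_of_mem_segment (hi ⟨m2, m1⟩)
  rw [hy, cr_sub_comb (by ring)] at h0
  exact mul_ne_zero hε0.ne' h' h0

/-- The triangle contracted towards the midpoint of the edge `a b`. -/
def contractVertex (t : ℝ) (a b p : Plane) : Plane :=
  ((1 - t) / 2) • a + ((1 - t) / 2) • b + t • p

theorem cr_contractVertex (t : ℝ) (a b p : Plane) :
    cr (a - contractVertex t a b p) (b - contractVertex t a b p) = t * cr (a - p) (b - p) :=
  cr_sub_comb (by ring)

theorem contract_subset {t : ℝ} (ht0 : 0 ≤ t) (ht1 : t ≤ 1) (a b p : Plane) :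
    convexHull ℝ {a, b, contractVertex t a b p} ⊆ convexHull ℝ {a, b, p} := by
  intro x hx
  obtain ⟨α, β, γ, h1, h2, h3, h4, rfl⟩ := mem_convexHull_triple.1 hx
  have : 0 ≤ γ * ((1 - t) / 2) := mul_nonneg h3 (by linarith)
  refine mem_convexHull_triple.2 ⟨α + γ * ((1 - t) / 2), β + γ * ((1 - t) / 2), γ * t,
    by linarith, by linarith, by positivity, by linear_combination h4, ?_⟩
  rw [contractVertex]
  module

theorem mem_convexHull_of_contract {a b p p' : Plane} {t α β γ A B G G' : ℝ} (ht0 : 0 ≤ t)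
    (ht1 : t ≤ 1) (hp' : p' = α • a + β • b + γ • p) (hs : α + β + γ = 1)
    (hα : t * (1 - 2 * α) ≤ 1) (hβ : t * (1 - 2 * β) ≤ 1)
    (hA : 0 ≤ A) (hB : 0 ≤ B) (hG : 0 ≤ G) (hG' : 0 ≤ G') (hsum : A + B + G + G' = 1)
    (hc : 0 ≤ G + γ * G') :
    A • a + B • b + G • contractVertex t a b p + G' • contractVertex t a b p' ∈
      convexHull ℝ {a, b, p} := by
  have h1 : 0 ≤ G * ((1 - t) / 2) := mul_nonneg hG (by linarith)
  have h2 : 0 ≤ G' * ((1 - t) / 2 + t * α) := mul_nonneg hG' (by linarith)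
  have h3 : 0 ≤ G' * ((1 - t) / 2 + t * β) := mul_nonneg hG' (by linarith)
  refine mem_convexHull_triple.2 ⟨A + G * ((1 - t) / 2) + G' * ((1 - t) / 2 + t * α),
    B + G * ((1 - t) / 2) + G' * ((1 - t) / 2 + t * β), t * (G + γ * G'), by positivity,
    by positivity, by positivity, by linear_combination hsum + G' * t * hs, ?_⟩
  rw [contractVertex, contractVertex, hp']
  module

/-- For two triangles on opposite sides of a common edge, the convex hull of the two contracted
triangles is contained in the union of the triangles. -/
theorem convexHull_contract_union_subset {a b p p' : Plane} {t α β γ : ℝ} (ht0 : 0 ≤ t)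
    (ht1 : t ≤ 1) (hp' : p' = α • a + β • b + γ • p) (hs : α + β + γ = 1) (hγ : γ < 0)
    (hα : t * (1 - 2 * α) ≤ 1) (hβ : t * (1 - 2 * β) ≤ 1)
    (hα' : t * (1 - 2 * (-α / γ)) ≤ 1) (hβ' : t * (1 - 2 * (-β / γ)) ≤ 1) :
    convexHull ℝ (convexHull ℝ {a, b, contractVertex t a b p} ∪
        convexHull ℝ {a, b, contractVertex t a b p'}) ⊆
      convexHull ℝ {a, b, p} ∪ convexHull ℝ {a, b, p'} := by
  have hne : ∀ q : Plane, (convexHull ℝ {a, b, q}).Nonempty := fun q => by simp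
  rw [(convex_convexHull ℝ _).convexHull_union (convex_convexHull ℝ _) (hne _) (hne _)]
  intro x hx
  obtain ⟨y, hy, z, hz, s, r, hs0, hr0, hsr, rfl⟩ := mem_convexJoin.1 hx
  obtain ⟨A, B, G, h1, h2, h3, h4, rfl⟩ := mem_convexHull_triple.1 hy
  obtain ⟨A', B', G', h1', h2', h3', h4', rfl⟩ := mem_convexHull_triple.1 hz
  rcases le_total 0 (s * G + γ * (r * G')) with hc | hc
  · left
    have := mem_convexHull_of_contract (A := s * A + r * A') (B := s * B + r * B') (G := s * G)
      (G' := r * G') ht0 ht1 hp' hs hα hβ (by positivity) (by positivity) (by positivity)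
      (by positivity) (by linear_combination s * h4 + r * h4' + hsr) hc
    convert this using 1
    module
  · right
    have hp : p = (-α / γ) • a + (-β / γ) • b + γ⁻¹ • p' := by
      rw [hp', smul_add, smul_add, smul_smul, smul_smul, inv_smul_smul₀ hγ.ne]
      have e1 : -α / γ + γ⁻¹ * α = 0 := by ring
      have e2 : -β / γ + γ⁻¹ * β = 0 := by ring
      have : p = (-α / γ + γ⁻¹ * α) • a + (-β / γ + γ⁻¹ * β) • b + p := by rw [e1, e2]; simp
      nth_rw 1 [this]
      module
    have hs' : -α / γ + -β / γ + γ⁻¹ = 1 := by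
      have := hγ.ne
      field_simp
      linarith
    have hc' : 0 ≤ r * G' + γ⁻¹ * (s * G) := by
      have : r * G' + γ⁻¹ * (s * G) = γ⁻¹ * (s * G + γ * (r * G')) := by
        have := hγ.ne
        field_simp
        ring
      rw [this]
      exact mul_nonneg_of_nonpos_of_nonpos (inv_nonpos.2 hγ.le) hc
    have := mem_convexHull_of_contract (A := s * A + r * A') (B := s * B + r * B') (G := r * G')
      (G' := s * G) ht0 ht1 hp hs' hα' hβ' (by positivity) (by positivity) (by positivity)
      (by positivity) (by linear_combination s * h4 + r * h4' + hsr) hc'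
    convert this using 1
    module

theorem mul_dist_le_of_closedBall_subset {a b p c : Plane} {ρ : ℝ} (hρ : 0 ≤ ρ)
    (h : Metric.closedBall c (ρ / 2) ⊆ convexHull ℝ {a, b, p}) :
    ρ * dist a b ≤ |cr (a - p) (b - p)| := by
  rcases eq_or_ne a b with rfl | hab
  · simp
  have hd : 0 < dist a b := dist_pos.2 hab
  have hbound : ∀ x ∈ convexHull ℝ {a, b, p}, ∃ γ ∈ Icc (0 : ℝ) 1,
      cr (a - x) (b - x) = γ * cr (a - p) (b - p) := by
    intro x hx
    obtain ⟨α, β, γ, h1, h2, h3, h4, rfl⟩ := mem_convexHull_triple.1 hx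
    exact ⟨γ, ⟨h3, by linarith⟩, cr_sub_comb h4⟩
  set n : Plane := !₂[-(b 1 - a 1), b 0 - a 0] with hn
  have hnn : ‖n‖ = dist a b := by
    rw [EuclideanSpace.dist_eq, EuclideanSpace.norm_eq]
    congr 1
    simp [hn, Fin.sum_univ_two, Real.dist_eq, sq_abs]
    ring
  set s := ρ / 2 / dist a b with hs
  have hs0 : 0 ≤ s := by positivity
  have hsd : s * dist a b = ρ / 2 := by rw [hs]; field_simp
  have hm1 : c + s • n ∈ Metric.closedBall c (ρ / 2) := by
    rw [Metric.mem_closedBall, dist_eq_norm, add_sub_cancel_left, norm_smul, hnn,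
      Real.norm_of_nonneg hs0, hsd]
  have hm2 : c - s • n ∈ Metric.closedBall c (ρ / 2) := by
    rw [Metric.mem_closedBall, dist_eq_norm, sub_sub_cancel_left, norm_neg, norm_smul, hnn,
      Real.norm_of_nonneg hs0, hsd]
  obtain ⟨γ₁, ⟨h1, h1'⟩, e1⟩ := hbound _ (h hm1)
  obtain ⟨γ₂, ⟨h2, h2'⟩, e2⟩ := hbound _ (h hm2)
  have hdsq : dist a b ^ 2 = (b 0 - a 0) ^ 2 + (b 1 - a 1) ^ 2 := by
    rw [← hnn, EuclideanSpace.norm_sq_eq]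
    simp [hn, Fin.sum_univ_two]
    ring
  have e3 : cr (a - (c + s • n)) (b - (c + s • n)) - cr (a - (c - s • n)) (b - (c - s • n))
      = 2 * s * dist a b ^ 2 := by
    rw [hdsq]
    simp [cr, hn]
    ring
  have e4 : ρ * dist a b = (γ₁ - γ₂) * cr (a - p) (b - p) := by
    have : 2 * s * dist a b ^ 2 = ρ * dist a b := by
      have : ρ = 2 * (s * dist a b) := by rw [hsd]; ring
      rw [this]; ring
    rw [← this, ← e3, e1, e2]; ring
  calc ρ * dist a b ≤ |(γ₁ - γ₂) * cr (a - p) (b - p)| := by rw [e4]; exact le_abs_self _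
    _ = |γ₁ - γ₂| * |cr (a - p) (b - p)| := abs_mul _ _
    _ ≤ 1 * |cr (a - p) (b - p)| := by
        gcongr
        rw [abs_le]
        constructor <;> linarith
    _ = _ := one_mul _

theorem notMem_convexHull_pair_of_coord {a b p x : Plane} {τ : ℝ} (h : cr (a - p) (b - p) ≠ 0)
    (hτ : τ ∈ Ioo (0 : ℝ) 1) (hx : x = a + τ • (b - a)) :
    x ∉ convexHull ℝ {b, p} ∧ x ∉ convexHull ℝ {a, p} := by
  constructor
  · intro hm
    have h0 := cr_eq_zero_of_mem_segment hm
    have : cr (b - x) (p - x) = (1 - τ) * cr (a - p) (b - p) := by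
      rw [hx]; simp [cr]; ring
    rw [this] at h0
    exact mul_ne_zero (by linarith [hτ.2]) h h0
  · intro hm
    have h0 := cr_eq_zero_of_mem_segment hm
    have : cr (a - x) (p - x) = -τ * cr (a - p) (b - p) := by
      rw [hx]; simp [cr]; ring
    rw [this] at h0
    exact mul_ne_zero (by linarith [hτ.1]) h h0

/-! ### Combinatorics of conforming triangulations -/

theorem cr_ne_zero_of_affineIndependent {a b p : Plane} (hab : AffineIndependent ℝ ![a, b, p]) :
    cr (b - a) (p - a) ≠ 0 := by
  intro h
  have hne : b - a ≠ 0 := sub_ne_zero.2 (hab.injective.ne (by decide : (1 : Fin 3) ≠ 0))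
  rw [affineIndependent_iff_not_collinear_set] at hab
  apply hab
  rw [collinear_iff_of_mem (p₀ := a) (by simp)]
  refine ⟨b - a, ?_⟩
  have hr : ∃ r : ℝ, p - a = r • (b - a) := by
    by_cases h0 : (b - a) 0 = 0
    · have h1 : (b - a) 1 ≠ 0 := by
        intro h1
        apply hne
        ext i
        fin_cases i <;> assumption
      refine ⟨(p - a) 1 / (b - a) 1, ?_⟩
      have : (p - a) 0 = 0 := by
        have h2 : (b - a) 1 * (p - a) 0 = 0 := by
          rw [cr, h0] at h
          linarith
        exact (mul_eq_zero.1 h2).resolve_left h1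
      ext i
      fin_cases i
      · change (p - a) 0 = (p - a) 1 / (b - a) 1 * (b - a) 0
        rw [this, h0, mul_zero]
      · change (p - a) 1 = (p - a) 1 / (b - a) 1 * (b - a) 1
        field_simp
    · refine ⟨(p - a) 0 / (b - a) 0, ?_⟩
      ext i
      fin_cases i
      · change (p - a) 0 = (p - a) 0 / (b - a) 0 * (b - a) 0
        field_simp
      · change (p - a) 1 = (p - a) 0 / (b - a) 0 * (b - a) 1
        rw [cr] at h
        field_simp
        linarith
  obtain ⟨r, hr⟩ := hr
  rintro x (rfl | rfl | rfl)
  · exact ⟨0, by simp⟩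
  · exact ⟨1, by simp⟩
  · exact ⟨r, by rw [← hr]; simp⟩

namespace Triangulation

variable {Ω : Set Plane} (T : Triangulation Ω)

theorem exists_vertices (s : T.cells) : ∃ v : Fin 3 → Plane, Function.Injective v ∧
    (s.1 : Set Plane) = {v 0, v 1, v 2} ∧ cr (v 1 - v 0) (v 2 - v 0) ≠ 0 := by
  obtain ⟨a, b, p, hab, hap, hbp, hs⟩ := Finset.card_eq_three.1 (T.card_eq s.1 s.2)
  have hmem : ∀ i : Fin 3, ![a, b, p] i ∈ s.1 := by
    intro i
    rw [hs]
    fin_cases i <;> simp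
  have hinj : Function.Injective ![a, b, p] := by
    intro i j hij
    fin_cases i <;> fin_cases j <;> simp_all
  refine ⟨![a, b, p], hinj, by rw [hs]; simp, ?_⟩
  have h := (T.affineIndependent s.1 s.2).comp_embedding
    ⟨fun i : Fin 3 => (⟨![a, b, p] i, hmem i⟩ : s.1), fun i j hij => hinj (Subtype.ext_iff.1 hij)⟩
  exact cr_ne_zero_of_affineIndependent h

/-- An enumeration of the vertices of a cell. -/
def vtx (s : T.cells) : Fin 3 → Plane := (T.exists_vertices s).choose

/-- The signed doubled area of a cell. -/
def orient (s : T.cells) : ℝ := cr (T.vtx s 1 - T.vtx s 0) (T.vtx s 2 - T.vtx s 0)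

/-- The first vertex of the edge with index `q.2` of the cell `q.1`. -/
def va (q : T.cells × Fin 3) : Plane := T.vtx q.1 (q.2 + 1)

/-- The second vertex of the edge with index `q.2` of the cell `q.1`. -/
def vb (q : T.cells × Fin 3) : Plane := T.vtx q.1 (q.2 + 2)

/-- The vertex opposite to the edge with index `q.2` of the cell `q.1`. -/
def vp (q : T.cells × Fin 3) : Plane := T.vtx q.1 q.2

/-- The end points of the edge with index `q.2` of the cell `q.1`. -/
def edge (q : T.cells × Fin 3) : Set Plane := {T.va q, T.vb q}

theorem vtx_injective (s : T.cells) : Function.Injective (T.vtx s) :=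
  (T.exists_vertices s).choose_spec.1

theorem orient_ne_zero (s : T.cells) : T.orient s ≠ 0 := (T.exists_vertices s).choose_spec.2.2

theorem coe_cell (q : T.cells × Fin 3) : (q.1.1 : Set Plane) = {T.va q, T.vb q, T.vp q} := by
  obtain ⟨s, i⟩ := q
  have h : (s.1 : Set Plane) = {T.vtx s 0, T.vtx s 1, T.vtx s 2} :=
    (T.exists_vertices s).choose_spec.2.1
  rw [h]
  ext x
  fin_cases i <;> simp [va, vb, vp] <;> tauto

theorem tri_eq (q : T.cells × Fin 3) :
    tri q.1.1 = convexHull ℝ {T.va q, T.vb q, T.vp q} := by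
  rw [tri, T.coe_cell q]

theorem cr_eq_orient (q : T.cells × Fin 3) :
    cr (T.va q - T.vp q) (T.vb q - T.vp q) = T.orient q.1 := by
  obtain ⟨s, i⟩ := q
  fin_cases i <;> simp [va, vb, vp, orient, cr] <;> ring

theorem vp_notMem_edge (q : T.cells × Fin 3) : T.vp q ∉ T.edge q := by
  obtain ⟨s, i⟩ := q
  rintro (h | h) <;> have := T.vtx_injective s h <;> revert this <;> fin_cases i <;> simp

theorem va_ne_vb (q : T.cells × Fin 3) : T.va q ≠ T.vb q := by
  obtain ⟨s, i⟩ := q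
  intro h
  have := T.vtx_injective s h
  revert this
  fin_cases i <;> simp

theorem coe_cell_eq_insert (q : T.cells × Fin 3) :
    (q.1.1 : Set Plane) = insert (T.vp q) (T.edge q) := by
  rw [T.coe_cell q, edge]
  ext x
  simp
  tauto

theorem eq_of_edge_eq {q q' : T.cells × Fin 3} (h : T.edge q = T.edge q') (hc : q.1 = q'.1) :
    q = q' := by
  have hm : T.vp q' ∈ insert (T.vp q) (T.edge q) := by
    rw [← T.coe_cell_eq_insert q, hc, T.coe_cell_eq_insert q']
    exact mem_insert _ _
  have h1 : T.vp q' = T.vp q := by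
    rcases hm with hm | hm
    · exact hm
    · rw [h] at hm
      exact absurd hm (T.vp_notMem_edge q')
  obtain ⟨s, i⟩ := q
  obtain ⟨s', i'⟩ := q'
  obtain rfl : s = s' := hc
  exact Prod.ext rfl (T.vtx_injective s h1).symm

theorem edge_subset (q : T.cells × Fin 3) : T.edge q ⊆ q.1.1 := by
  rw [T.coe_cell_eq_insert q]
  exact subset_insert _ _

theorem inter_eq_edge {q : T.cells × Fin 3} {t : T.cells} (ht : q.1 ≠ t)
    (he : T.edge q ⊆ t.1) : (q.1.1 : Set Plane) ∩ t.1 = T.edge q := by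
  refine Subset.antisymm ?_ (subset_inter (T.edge_subset q) he)
  rintro x ⟨hx, hxt⟩
  rw [T.coe_cell_eq_insert q] at hx
  rcases hx with rfl | hx
  · exfalso
    apply ht
    have hsub : (q.1.1 : Set Plane) ⊆ t.1 := by
      rw [T.coe_cell_eq_insert q]
      exact insert_subset hxt he
    exact Subtype.ext (Finset.eq_of_subset_of_card_le (Finset.coe_subset.1 hsub)
      (by rw [T.card_eq _ q.1.2, T.card_eq _ t.2]))
  · exact hx

theorem tri_eq_of_edge_eq {q q' : T.cells × Fin 3} (h : T.edge q = T.edge q') :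
    tri q'.1.1 = convexHull ℝ {T.va q, T.vb q, T.vp q'} := by
  rw [tri, T.coe_cell_eq_insert q', ← h, edge]
  congr 1
  ext x
  simp
  tauto

theorem abs_cr_eq_of_edge_eq {q q' : T.cells × Fin 3} (h : T.edge q = T.edge q') :
    |cr (T.va q - T.vp q') (T.vb q - T.vp q')| = |T.orient q'.1| := by
  rw [← T.cr_eq_orient q']
  rcases Set.pair_eq_pair_iff.1 h with ⟨h1, h2⟩ | ⟨h1, h2⟩
  · rw [h1, h2]
  · rw [h1, h2, cr_neg_swap, abs_neg]

/-- Two cells with a common edge lie on opposite sides of it. -/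
theorem cr_mul_cr_neg_of_edge_eq {q q' : T.cells × Fin 3} (h : T.edge q = T.edge q')
    (hne : q.1 ≠ q'.1) :
    cr (T.va q - T.vp q) (T.vb q - T.vp q) * cr (T.va q - T.vp q') (T.vb q - T.vp q') < 0 := by
  apply cr_mul_cr_neg
  · rw [T.cr_eq_orient]
    exact T.orient_ne_zero _
  · rw [← abs_ne_zero, T.abs_cr_eq_of_edge_eq h, abs_ne_zero]
    exact T.orient_ne_zero _
  · rw [← T.tri_eq q, ← T.tri_eq_of_edge_eq h, T.conforming _ q.1.2 _ q'.1.2,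
      T.inter_eq_edge hne (h ▸ T.edge_subset q')]
    exact subset_rfl

/-- An edge belongs to at most two cells. -/
theorem eq_of_edge_eq_of_ne {q q₁ q₂ : T.cells × Fin 3} (h₁ : T.edge q = T.edge q₁)
    (hne₁ : q.1 ≠ q₁.1) (h₂ : T.edge q = T.edge q₂) (hne₂ : q.1 ≠ q₂.1) : q₁ = q₂ := by
  refine T.eq_of_edge_eq (h₁.symm.trans h₂) ?_
  by_contra hne
  have e1 := T.cr_mul_cr_neg_of_edge_eq h₁ hne₁
  have e2 := T.cr_mul_cr_neg_of_edge_eq h₂ hne₂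
  have e3 := T.cr_mul_cr_neg_of_edge_eq (h₁.symm.trans h₂) hne
  have e3' : cr (T.va q - T.vp q₁) (T.vb q - T.vp q₁) *
      cr (T.va q - T.vp q₂) (T.vb q - T.vp q₂) < 0 := by
    rcases Set.pair_eq_pair_iff.1 h₁ with ⟨h1, h2⟩ | ⟨h1, h2⟩
    · rwa [h1, h2]
    · rw [h1, h2, cr_neg_swap, cr_neg_swap (T.vb q₁ - T.vp q₂)]
      linarith
  set x := cr (T.va q - T.vp q) (T.vb q - T.vp q)
  set y := cr (T.va q - T.vp q₁) (T.vb q - T.vp q₁)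
  set z := cr (T.va q - T.vp q₂) (T.vb q - T.vp q₂)
  have : 0 < (x * y) * (x * z) := mul_pos_of_neg_of_neg e1 e2
  nlinarith [sq_nonneg x, mul_nonneg (sq_nonneg x) (neg_nonneg.2 e3'.le)]

/-- An edge of a single cell does not meet the open domain. -/
theorem notMem_of_boundary_edge {q : T.cells × Fin 3}
    (hb : ∀ q' : T.cells × Fin 3, T.edge q = T.edge q' → q.1 = q'.1) (hΩ : IsOpen Ω) {τ : ℝ}
    (hτ : τ ∈ Ioo (0 : ℝ) 1) : T.va q + τ • (T.vb q - T.va q) ∉ Ω := by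
  intro hx
  set a := T.va q with ha
  set b := T.vb q with hb'
  set p := T.vp q with hp
  have hc : cr (a - p) (b - p) ≠ 0 := by rw [T.cr_eq_orient]; exact T.orient_ne_zero _
  set x := a + τ • (b - a) with hxdef
  set O : Set Plane := {y ∈ Ω | cr (a - y) (b - y) * cr (a - p) (b - p) < 0} with hO
  -- `x` is a limit of points of the domain beyond the edge
  have hxO : x ∈ closure O := by
    have hcont : Continuous fun ε : ℝ => x - ε • (p - x) := by fun_prop
    have htend : Filter.Tendsto (fun ε : ℝ => x - ε • (p - x)) (nhdsWithin 0 (Ioi 0)) (nhds x) := by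
      have := (hcont.tendsto 0).mono_left (nhdsWithin_le_nhds (s := Ioi (0 : ℝ)))
      simpa using this
    refine mem_closure_of_tendsto htend ?_
    filter_upwards [htend.eventually (hΩ.mem_nhds hx), self_mem_nhdsWithin] with ε h1 h2
    refine ⟨h1, ?_⟩
    have : cr (a - (x - ε • (p - x))) (b - (x - ε • (p - x))) = -ε * cr (a - p) (b - p) := by
      rw [hxdef]; simp [cr]; ring
    rw [this]
    have := mul_pos (show (0 : ℝ) < ε from h2) (mul_self_pos.2 hc)
    linarith
  have hcov : O ⊆ ⋃ s ∈ T.cells, (tri s ∩ O) := by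
    intro y hy
    have : y ∈ ⋃ s ∈ T.cells, tri s := by rw [T.cover]; exact subset_closure hy.1
    simp only [mem_iUnion] at this ⊢
    obtain ⟨s, hs, hys⟩ := this
    exact ⟨s, hs, hys, hy⟩
  have hx2 := closure_mono hcov hxO
  rw [Finset.closure_biUnion] at hx2
  simp only [mem_iUnion] at hx2
  obtain ⟨t, ht, hxt⟩ := hx2
  have hclosed : IsClosed (tri t) := t.finite_toSet.isClosed_convexHull ℝ
  have hxt' : x ∈ tri t := closure_minimal inter_subset_left hclosed hxt
  obtain ⟨y, hyt, -, hy⟩ := closure_nonempty_iff.1 ⟨x, hxt⟩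
  have htne : q.1 ≠ ⟨t, ht⟩ := by
    rintro h
    have hyq : y ∈ tri q.1.1 := by rw [h]; exact hyt
    rw [T.tri_eq q] at hyq
    obtain ⟨α, β, γ, h1, h2, h3, h4, rfl⟩ := mem_convexHull_triple.1 hyq
    rw [cr_sub_comb h4, mul_assoc] at hy
    exact absurd hy (not_lt.2 (mul_nonneg h3 (mul_self_nonneg _)))
  have hxq : x ∈ tri q.1.1 := by
    rw [T.tri_eq q]
    refine mem_convexHull_triple.2 ⟨1 - τ, τ, 0, by linarith [hτ.2], hτ.1.le, le_rfl, by ring, ?_⟩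
    rw [hxdef]
    module
  have hxi : x ∈ convexHull ℝ ((q.1.1 : Set Plane) ∩ t) := by
    rw [← T.conforming _ q.1.2 _ ht]
    exact ⟨hxq, hxt'⟩
  obtain ⟨n1, n2⟩ := notMem_convexHull_pair_of_coord hc hτ hxdef
  have hat : a ∈ t := by
    by_contra hat
    refine n1 (convexHull_mono ?_ hxi)
    rintro z ⟨hz, hzt⟩
    rw [T.coe_cell q] at hz
    rcases hz with rfl | hz
    · exact absurd hzt hat
    · exact hz
  have hbt : b ∈ t := by
    by_contra hbt
    refine n2 (convexHull_mono ?_ hxi)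
    rintro z ⟨hz, hzt⟩
    rw [T.coe_cell q] at hz
    rcases hz with rfl | rfl | hz
    · exact mem_insert _ _
    · exact absurd hzt hbt
    · exact mem_insert_of_mem _ hz
  -- the edge is an edge of `t`
  have hab : a ≠ b := T.va_ne_vb q
  obtain ⟨j, hj⟩ : ∃ j, T.edge q = T.edge (⟨t, ht⟩, j) := by
    have hcell := T.coe_cell (⟨t, ht⟩, 0)
    have h1 : a ∈ ({T.vtx ⟨t, ht⟩ 1, T.vtx ⟨t, ht⟩ 2, T.vtx ⟨t, ht⟩ 0} : Set Plane) :=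
      hcell ▸ hat
    have h2 : b ∈ ({T.vtx ⟨t, ht⟩ 1, T.vtx ⟨t, ht⟩ 2, T.vtx ⟨t, ht⟩ 0} : Set Plane) :=
      hcell ▸ hbt
    have key : ∀ j, (a = T.vtx ⟨t, ht⟩ (j + 1) ∧ b = T.vtx ⟨t, ht⟩ (j + 2)) ∨
        (a = T.vtx ⟨t, ht⟩ (j + 2) ∧ b = T.vtx ⟨t, ht⟩ (j + 1)) →
        T.edge q = T.edge (⟨t, ht⟩, j) := by
      intro j hj
      exact Set.pair_eq_pair_iff.2 hj
    rcases h1 with h1 | h1 | h1 <;> rcases h2 with h2 | h2 | h2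
    · exact absurd (h1.trans h2.symm) hab
    · exact ⟨0, key 0 (Or.inl ⟨h1, h2⟩)⟩
    · exact ⟨2, key 2 (Or.inr ⟨h1, h2⟩)⟩
    · exact ⟨0, key 0 (Or.inr ⟨h1, h2⟩)⟩
    · exact absurd (h1.trans h2.symm) hab
    · exact ⟨1, key 1 (Or.inl ⟨h1, h2⟩)⟩
    · exact ⟨2, key 2 (Or.inl ⟨h1, h2⟩)⟩
    · exact ⟨1, key 1 (Or.inr ⟨h1, h2⟩)⟩
    · exact absurd (h1.trans h2.symm) hab
  exact htne (hb _ hj)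

/-- A sum over pairs of a cell and an edge vanishes if the two contributions of interior edges
cancel and those of boundary edges vanish. -/
theorem sum_edges_eq_zero (F : T.cells × Fin 3 → ℝ)
    (hInt : ∀ q q', T.edge q = T.edge q' → q.1 ≠ q'.1 → F q + F q' = 0)
    (hbd : ∀ q, (∀ q', T.edge q = T.edge q' → q.1 = q'.1) → F q = 0) : ∑ q, F q = 0 := by
  classical
  set g : T.cells × Fin 3 → T.cells × Fin 3 := fun q =>
    if h : ∃ q', T.edge q = T.edge q' ∧ q.1 ≠ q'.1 then h.choose else q with hg
  have hg1 : ∀ q, (∃ q', T.edge q = T.edge q' ∧ q.1 ≠ q'.1) →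
      T.edge q = T.edge (g q) ∧ q.1 ≠ (g q).1 := by
    intro q h
    simp only [hg, dif_pos h]
    exact h.choose_spec
  have hg2 : ∀ q, (¬ ∃ q', T.edge q = T.edge q' ∧ q.1 ≠ q'.1) → g q = q := by
    intro q h
    simp only [hg, dif_neg h]
  have hbd' : ∀ q, (¬ ∃ q', T.edge q = T.edge q' ∧ q.1 ≠ q'.1) → F q = 0 := by
    intro q h
    push Not at h
    exact hbd q h
  refine Finset.sum_involution (fun q _ => g q) ?_ ?_ (fun _ _ => Finset.mem_univ _) ?_
  · intro q _
    by_cases h : ∃ q', T.edge q = T.edge q' ∧ q.1 ≠ q'.1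
    · exact hInt q _ (hg1 q h).1 (hg1 q h).2
    · rw [hg2 q h, hbd' q h, add_zero]
  · intro q _ hne
    by_cases h : ∃ q', T.edge q = T.edge q' ∧ q.1 ≠ q'.1
    · intro heq
      exact (hg1 q h).2 (by rw [heq])
    · exact absurd (hbd' q h) hne
  · intro q _
    by_cases h : ∃ q', T.edge q = T.edge q' ∧ q.1 ≠ q'.1
    · obtain ⟨h1, h2⟩ := hg1 q h
      obtain ⟨h3, h4⟩ := hg1 (g q) ⟨q, h1.symm, h2.symm⟩
      exact T.eq_of_edge_eq_of_ne h3 h4 h1.symm h2.symm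
    · rw [hg2 q h, hg2 q h]

theorem card_filter_edge_le (q : T.cells × Fin 3) [DecidablePred fun q' => T.edge q' = T.edge q] :
    (Finset.univ.filter fun q' => T.edge q' = T.edge q).card ≤ 2 := by
  classical
  by_cases h : ∃ q₁, T.edge q = T.edge q₁ ∧ q.1 ≠ q₁.1
  · obtain ⟨q₁, h1, h2⟩ := h
    refine (Finset.card_le_card (t := {q, q₁}) fun q' hq' => ?_).trans Finset.card_le_two
    have hq := (Finset.mem_filter.1 hq').2
    by_cases hc : q'.1 = q.1
    · simp [T.eq_of_edge_eq hq hc]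
    · simp [T.eq_of_edge_eq_of_ne hq.symm (Ne.symm hc) h1 h2]
  · push Not at h
    refine (Finset.card_le_card (t := {q}) fun q' hq' => ?_).trans (by simp)
    have hq := (Finset.mem_filter.1 hq').2
    simp [T.eq_of_edge_eq hq (h q' hq.symm).symm]

end Triangulation

/-! ### The weighted measure -/

namespace IsMeridianDomain

variable {Ω : Set Plane}

theorem radius_nonneg (hΩ : IsMeridianDomain Ω) {x : Plane} (hx : x ∈ closure Ω) : 0 ≤ x 0 := by
  have hc : IsClosed {x : Plane | 0 ≤ x 0} := isClosed_le continuous_const (by fun_prop)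
  exact closure_minimal (fun y hy => (hΩ.pos_radius y hy).le) hc hx

theorem convex_closure (hΩ : IsMeridianDomain Ω) : Convex ℝ (closure Ω) := by
  intro x hx y hy s t hs ht hst
  have hmem : ∀ z ∈ closure Ω, (!₂[z 0, 0, z 1] : EuclideanSpace ℝ (Fin 3)) ∈
      rotate (closure Ω) := by
    intro z hz
    have h0 := hΩ.radius_nonneg hz
    have : (!₂[z 0, z 1] : Plane) = z := by ext i; fin_cases i <;> rfl
    simpa [rotate, Real.sqrt_sq h0, this] using hz
  have h := hΩ.convex_rotate (hmem x hx) (hmem y hy) hs ht hst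
  have h0 : 0 ≤ s * x 0 + t * y 0 :=
    add_nonneg (mul_nonneg hs (hΩ.radius_nonneg hx)) (mul_nonneg ht (hΩ.radius_nonneg hy))
  have h2 : s • x + t • y = !₂[s * x 0 + t * y 0, s * x 1 + t * y 1] := by
    ext i; fin_cases i <;> simp
  rw [h2]
  simpa [rotate, Real.sqrt_sq h0] using h

theorem volume_closure_diff (hΩ : IsMeridianDomain Ω) : volume (closure Ω \ Ω) = 0 := by
  have h := hΩ.convex_closure.addHaar_frontier volume
  rwa [frontier, closure_closure, hΩ.interior_closure] at h

theorem inter_ae_eq (hΩ : IsMeridianDomain Ω) {X : Set Plane} (hX : X ⊆ closure Ω) :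
    (X ∩ Ω : Set Plane) =ᵐ[volume] X := by
  rw [ae_eq_set]
  refine ⟨by rw [sdiff_eq_empty.2 inter_subset_left, measure_empty], measure_mono_null ?_ hΩ.volume_closure_diff⟩
  rintro x ⟨h1, h2⟩
  exact ⟨hX h1, fun h => h2 ⟨h1, h⟩⟩

theorem restrict_restrict (hΩ : IsMeridianDomain Ω) {X : Set Plane} (hX : X ⊆ closure Ω) (hXm : MeasurableSet X) :
    (volume.restrict Ω).restrict X = volume.restrict X := by
  rw [Measure.restrict_restrict hXm, Measure.restrict_congr_set (hΩ.inter_ae_eq hX)]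

theorem wMeasure_restrict (hΩ : IsMeridianDomain Ω) (α : ℤ) {X : Set Plane} (hX : X ⊆ closure Ω) (hXm : MeasurableSet X) :
    (wMeasure Ω α).restrict X =
      (volume.restrict X).withDensity fun x => ENNReal.ofReal (x 0 ^ α) := by
  rw [wMeasure, restrict_withDensity hXm, hΩ.restrict_restrict hX hXm]

theorem setLIntegral_wMeasure_one (hΩ : IsMeridianDomain Ω) {X : Set Plane} (hX : X ⊆ closure Ω) (hXm : MeasurableSet X)
    {F : Plane → ENNReal} (hF : Measurable F) :
    ∫⁻ x in X, F x ∂(wMeasure Ω 1) = ∫⁻ x in X, F x * ENNReal.ofReal (x 0) := by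
  rw [hΩ.wMeasure_restrict 1 hX hXm, lintegral_withDensity_eq_lintegral_mul _ (by fun_prop) hF]
  refine lintegral_congr fun x => ?_
  simp [mul_comm]

theorem wMeasure_one_apply (hΩ : IsMeridianDomain Ω) {X : Set Plane} (hX : X ⊆ closure Ω) (hXm : MeasurableSet X) :
    wMeasure Ω 1 X = ∫⁻ x in X, ENNReal.ofReal (x 0) := by
  have := hΩ.setLIntegral_wMeasure_one hX hXm (F := fun _ => 1) measurable_const
  simpa using this

theorem restrict_absolutelyContinuous (hΩ : IsMeridianDomain Ω) (α : ℤ) : volume.restrict Ω ≪ wMeasure Ω α := by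
  refine withDensity_absolutelyContinuous' ?_ ?_
  · fun_prop
  · refine (ae_restrict_mem hΩ.isOpen.measurableSet).mono fun x hx => ?_
    have := zpow_pos (hΩ.pos_radius x hx) α
    simpa using this

theorem isFiniteMeasure_wMeasure_one (hΩ : IsMeridianDomain Ω) : IsFiniteMeasure (wMeasure Ω 1) := by
  obtain ⟨R, hR⟩ := hΩ.isBounded.exists_norm_le
  refine ⟨?_⟩
  rw [wMeasure, withDensity_apply _ MeasurableSet.univ, Measure.restrict_univ]
  have hvol : volume Ω < ⊤ := hΩ.isBounded.measure_lt_top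
  calc ∫⁻ x in Ω, ENNReal.ofReal (x 0 ^ (1 : ℤ)) ≤ ∫⁻ _ in Ω, ENNReal.ofReal R := by
        refine setLIntegral_mono' hΩ.isOpen.measurableSet fun x hx => ?_
        apply ENNReal.ofReal_le_ofReal
        rw [zpow_one]
        exact (le_abs_self _).trans ((PiLp.norm_apply_le x 0).trans (hR x hx))
    _ < ⊤ := by
        rw [setLIntegral_const]
        exact ENNReal.mul_lt_top ENNReal.ofReal_lt_top hvol

/-- The weighted Poincaré inequality on convex subsets of the closure of the domain. -/
theorem poincare (hΩ : IsMeridianDomain Ω) {X : Set Plane} (hX : X ⊆ closure Ω) (hXm : MeasurableSet X) (hXc : Convex ℝ X)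
    {d : ℝ} (hd : ∀ x ∈ X, ∀ y ∈ X, dist x y ≤ d)
    {f g₀ g₁ : Plane → ℝ} (hf : Measurable f) (hg₀ : Measurable g₀) (hg₁ : Measurable g₁)
    (h₀ : HasWeakPartial Ω 0 f g₀) (h₁ : HasWeakPartial Ω 1 f g₁) :
    ∫⁻ x in X, ∫⁻ y in X, ENNReal.ofReal ((f x - f y) ^ 2) ∂(wMeasure Ω 1) ∂(wMeasure Ω 1)
      ≤ ENNReal.ofReal (8 * d ^ 2) *
        (∫⁻ x in X, ENNReal.ofReal (g₀ x ^ 2 + g₁ x ^ 2) ∂(wMeasure Ω 1)) * wMeasure Ω 1 X := by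
  have hfr : interior X =ᵐ[volume] X := interior_ae_eq_of_null_frontier
    (hXc.addHaar_frontier volume)
  have hKΩ : interior X ⊆ Ω := by
    rw [← hΩ.interior_closure]
    exact interior_mono hX
  have h := poincare_of_isOpen isOpen_interior hXc.interior hKΩ
    (fun x hx => (hΩ.pos_radius x (hKΩ hx)).le)
    (fun x hx y hy => hd x (interior_subset hx) y (interior_subset hy)) hf hg₀ hg₁ h₀ h₁
  simp only [Measure.restrict_congr_set hfr] at h
  have hm : Measurable fun x => ∫⁻ y in X, ENNReal.ofReal ((f x - f y) ^ 2) ∂(wMeasure Ω 1) := by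
    have := hΩ.isFiniteMeasure_wMeasure_one
    exact Measurable.lintegral_prod_right' (f := fun p : Plane × Plane =>
      ENNReal.ofReal ((f p.1 - f p.2) ^ 2)) (by fun_prop)
  rw [hΩ.setLIntegral_wMeasure_one hX hXm hm, hΩ.wMeasure_one_apply hX hXm,
    hΩ.setLIntegral_wMeasure_one hX hXm (by fun_prop)]
  · refine le_of_eq_of_le ?_ h
    refine lintegral_congr fun x => ?_
    rw [hΩ.setLIntegral_wMeasure_one hX hXm (by fun_prop), ← lintegral_mul_const _ (by fun_prop)]
    refine lintegral_congr fun y => ?_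
    ring

theorem exists_const_approx (hΩ : IsMeridianDomain Ω) {X : Set Plane} (hX : X ⊆ closure Ω) (hXm : MeasurableSet X)
    (hXc : Convex ℝ X) (hX0 : wMeasure Ω 1 X ≠ 0)
    {d : ℝ} (hd : ∀ x ∈ X, ∀ y ∈ X, dist x y ≤ d)
    {f g₀ g₁ : Plane → ℝ} (hf : Measurable f) (hg₀ : Measurable g₀) (hg₁ : Measurable g₁)
    (h₀ : HasWeakPartial Ω 0 f g₀) (h₁ : HasWeakPartial Ω 1 f g₁) :
    ∃ c : ℝ, ∫⁻ x in X, ENNReal.ofReal ((f x - c) ^ 2) ∂(wMeasure Ω 1) ≤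
      ENNReal.ofReal (8 * d ^ 2) *
        ∫⁻ x in X, ENNReal.ofReal (g₀ x ^ 2 + g₁ x ^ 2) ∂(wMeasure Ω 1) := by
  have := hΩ.isFiniteMeasure_wMeasure_one
  have hp := hΩ.poincare hX hXm hXc hd hf hg₀ hg₁ h₀ h₁
  have hm : Measurable fun x => ∫⁻ y in X, ENNReal.ofReal ((f x - f y) ^ 2) ∂(wMeasure Ω 1) :=
    Measurable.lintegral_prod_right' (f := fun p : Plane × Plane =>
      ENNReal.ofReal ((f p.1 - f p.2) ^ 2)) (by fun_prop)
  obtain ⟨x, -, hx⟩ := exists_le_setLAverage hX0 (measure_ne_top _ _) hm.aemeasurable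
  refine ⟨f x, ?_⟩
  have e : ∀ y, (f y - f x) ^ 2 = (f x - f y) ^ 2 := fun y => by ring
  simp_rw [e]
  refine hx.trans ?_
  rw [setLAverage_eq]
  exact ENNReal.div_le_of_le_mul hp

theorem wMeasure_triangle (hΩ : IsMeridianDomain Ω) {a b p : Plane} (hX : convexHull ℝ {a, b, p} ⊆ closure Ω)
    (h : cr (a - p) (b - p) ≠ 0) : wMeasure Ω 1 (convexHull ℝ {a, b, p}) =
      ENNReal.ofReal (|cr (a - p) (b - p)| * ((a 0 + b 0 + p 0) / 6)) := by
  have hcomp : IsCompact (convexHull ℝ {a, b, p}) :=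
    (Set.toFinite {a, b, p}).isCompact_convexHull (𝕜 := ℝ)
  rw [hΩ.wMeasure_one_apply hX hcomp.measurableSet, ← setIntegral_radius_triangle h,
    ofReal_integral_eq_lintegral_ofReal]
  · exact ContinuousOn.integrableOn_compact hcomp (by fun_prop)
  · exact (ae_restrict_mem hcomp.measurableSet).mono fun x hx => hΩ.radius_nonneg (hX hx)

end IsMeridianDomain

/-! ### Comparison of local approximations on neighbouring sets -/

theorem ofReal_sq_sub_le (x c y c' : ℝ) : ENNReal.ofReal ((c - c') ^ 2) ≤
    3 * (ENNReal.ofReal ((x - c) ^ 2) + ENNReal.ofReal ((x - y) ^ 2) +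
      ENNReal.ofReal ((y - c') ^ 2)) := by
  rw [← ENNReal.ofReal_add (by positivity) (by positivity),
    ← ENNReal.ofReal_add (by positivity) (by positivity),
    show (3 : ENNReal) = ENNReal.ofReal 3 by simp, ← ENNReal.ofReal_mul (by norm_num)]
  apply ENNReal.ofReal_le_ofReal
  nlinarith [sq_nonneg ((c - x) - (x - y)), sq_nonneg ((c - x) - (y - c')),
    sq_nonneg ((x - y) - (y - c')), sq_nonneg ((x - c) - (x - y)), sq_nonneg ((x - c) + (x - y)),
    sq_nonneg ((x - c) + (y - c'))]

theorem sq_sub_mul_measure_le {ν : Measure Plane} [IsFiniteMeasure ν] {K K' S S' Q : Set Plane}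
    (hSK : S ⊆ K) (hSK' : S' ⊆ K') (hSQ : S ⊆ Q) (hSQ' : S' ⊆ Q) (hQ : Q ⊆ K ∪ K')
    {t B κ : ENNReal} (ht0 : t ≠ 0) (ht1 : t ≠ ⊤) (hS : t * ν K ≤ ν S) (hS' : t * ν K' ≤ ν S')
    (hB : ν K ≤ B * ν K') (hK'0 : ν K' ≠ 0) {f : Plane → ℝ} (hf : Measurable f)
    {g : Plane → ENNReal} {c c' : ℝ}
    (hc : ∫⁻ x in K, ENNReal.ofReal ((f x - c) ^ 2) ∂ν ≤ κ * ∫⁻ x in K, g x ∂ν)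
    (hc' : ∫⁻ x in K', ENNReal.ofReal ((f x - c') ^ 2) ∂ν ≤ κ * ∫⁻ x in K', g x ∂ν)
    (hp : ∫⁻ x in Q, ∫⁻ y in Q, ENNReal.ofReal ((f x - f y) ^ 2) ∂ν ∂ν ≤
      4 * κ * (∫⁻ x in Q, g x ∂ν) * ν Q) :
    ENNReal.ofReal ((c - c') ^ 2) * ν K ≤
      (18 * κ * (B + 1) / t ^ 2) * (∫⁻ x in K, g x ∂ν + ∫⁻ x in K', g x ∂ν) := by
  set D := ∫⁻ x in K, g x ∂ν
  set D' := ∫⁻ x in K', g x ∂ν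
  set e := ENNReal.ofReal ((c - c') ^ 2)
  have hDQ : ∫⁻ x in Q, g x ∂ν ≤ D + D' :=
    (lintegral_mono_set hQ).trans (lintegral_union_le _ _ _)
  have hνQ : ν Q ≤ ν K + ν K' := (measure_mono hQ).trans (measure_union_le _ _)
  have hm2 : ∀ x, Measurable fun y => ENNReal.ofReal ((f x - f y) ^ 2) := fun x => by fun_prop
  have hm1 : Measurable fun x => ∫⁻ y in S', ENNReal.ofReal ((f x - f y) ^ 2) ∂ν :=
    Measurable.lintegral_prod_right' (f := fun p : Plane × Plane =>
      ENNReal.ofReal ((f p.1 - f p.2) ^ 2)) (by fun_prop)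
  have h1 : e * ν S' * ν S ≤ 3 * (κ * D * ν S' + 4 * κ * (D + D') * (ν K + ν K') +
      κ * D' * ν S) := by
    calc e * ν S' * ν S = ∫⁻ _ in S, ∫⁻ _ in S', e ∂ν ∂ν := by
          rw [setLIntegral_const, setLIntegral_const]
      _ ≤ ∫⁻ x in S, ∫⁻ y in S', 3 * (ENNReal.ofReal ((f x - c) ^ 2) +
            ENNReal.ofReal ((f x - f y) ^ 2) + ENNReal.ofReal ((f y - c') ^ 2)) ∂ν ∂ν :=
          lintegral_mono fun x => lintegral_mono fun y => ofReal_sq_sub_le _ _ _ _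
      _ = 3 * ((∫⁻ x in S, ENNReal.ofReal ((f x - c) ^ 2) ∂ν) * ν S' +
            (∫⁻ x in S, ∫⁻ y in S', ENNReal.ofReal ((f x - f y) ^ 2) ∂ν ∂ν) +
            (∫⁻ y in S', ENNReal.ofReal ((f y - c') ^ 2) ∂ν) * ν S) := by
          have hin : ∀ x, ∫⁻ y in S', 3 * (ENNReal.ofReal ((f x - c) ^ 2) +
              ENNReal.ofReal ((f x - f y) ^ 2) + ENNReal.ofReal ((f y - c') ^ 2)) ∂ν
              = 3 * (ENNReal.ofReal ((f x - c) ^ 2) * ν S' +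
                (∫⁻ y in S', ENNReal.ofReal ((f x - f y) ^ 2) ∂ν) +
                ∫⁻ y in S', ENNReal.ofReal ((f y - c') ^ 2) ∂ν) := by
            intro x
            rw [lintegral_const_mul _ (by fun_prop), lintegral_add_left (by fun_prop),
              lintegral_add_left (by fun_prop), setLIntegral_const]
          simp_rw [hin]
          rw [lintegral_const_mul _ (by fun_prop), lintegral_add_left (by fun_prop),
            lintegral_add_left (by fun_prop), lintegral_mul_const _ (by fun_prop),
            setLIntegral_const]
      _ ≤ _ := by
          gcongr
          · exact (lintegral_mono_set hSK).trans hc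
          · calc _ ≤ ∫⁻ x in Q, ∫⁻ y in Q, ENNReal.ofReal ((f x - f y) ^ 2) ∂ν ∂ν :=
                  (lintegral_mono_set hSQ).trans (lintegral_mono fun x => lintegral_mono_set hSQ')
              _ ≤ _ := hp
              _ ≤ _ := by gcongr
          · exact (lintegral_mono_set hSK').trans hc'
  have h2 : e * ν K * t ^ 2 * ν K' ≤ 18 * κ * (B + 1) * (D + D') * ν K' := by
    calc e * ν K * t ^ 2 * ν K' = e * (t * ν K') * (t * ν K) := by ring
      _ ≤ e * ν S' * ν S := by gcongr
      _ ≤ _ := h1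
      _ ≤ 3 * (κ * (D + D') * (ν K + ν K') + 4 * κ * (D + D') * (ν K + ν K') +
          κ * (D + D') * (ν K + ν K')) := by
          gcongr
          · exact le_self_add
          · exact (measure_mono hSK').trans le_add_self
          · exact le_add_self
          · exact (measure_mono hSK).trans le_self_add
      _ = 18 * κ * (D + D') * (ν K + ν K') := by ring
      _ ≤ 18 * κ * (D + D') * (B * ν K' + ν K') := by gcongr
      _ = _ := by ring
  have h3 : e * ν K * t ^ 2 ≤ 18 * κ * (B + 1) * (D + D') :=
    (ENNReal.mul_le_mul_iff_left hK'0 (measure_ne_top _ _)).1 h2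
  calc e * ν K = e * ν K * t ^ 2 / t ^ 2 := by
        rw [ENNReal.mul_div_cancel_right (by simp [ht0]) (by simp [ht1])]
    _ ≤ 18 * κ * (B + 1) * (D + D') / t ^ 2 := by gcongr
    _ = _ := by rw [ENNReal.mul_div_right_comm]

namespace Triangulation

/-! ### Shape regularity -/

variable {Ω : Set Plane} (T : Triangulation Ω)

theorem tri_subset_closure (s : T.cells) : tri s.1 ⊆ closure Ω := by
  rw [← T.cover]
  exact subset_biUnion_of_mem (u := fun s => tri s) s.2

theorem isCompact_tri (s : Finset Plane) : IsCompact (tri s) :=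
  s.finite_toSet.isCompact_convexHull (𝕜 := ℝ)

theorem dist_le_diam {s : Finset Plane} {x y : Plane} (hx : x ∈ tri s) (hy : y ∈ tri s) :
    dist x y ≤ Metric.diam (tri s) :=
  Metric.dist_le_diam_of_mem (isCompact_tri s).isBounded hx hy

theorem diam_le_meshSize (s : T.cells) : Metric.diam (tri s.1) ≤ T.meshSize :=
  le_ciSup (f := fun s : T.cells => Metric.diam (tri s.1)) (Set.finite_range _).bddAbove s

theorem meshSize_nonneg : 0 ≤ T.meshSize := Real.iSup_nonneg fun _ => Metric.diam_nonneg

theorem va_mem (q : T.cells × Fin 3) : T.va q ∈ tri q.1.1 := by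
  rw [T.tri_eq q]; exact subset_convexHull ℝ _ (by simp)

theorem vb_mem (q : T.cells × Fin 3) : T.vb q ∈ tri q.1.1 := by
  rw [T.tri_eq q]; exact subset_convexHull ℝ _ (by simp)

theorem vp_mem (q : T.cells × Fin 3) : T.vp q ∈ tri q.1.1 := by
  rw [T.tri_eq q]; exact subset_convexHull ℝ _ (by simp)

theorem norm_sub_le_diam {s : Finset Plane} {x y : Plane} (hx : x ∈ tri s) (hy : y ∈ tri s) :
    ‖x - y‖ ≤ Metric.diam (tri s) := by
  rw [← dist_eq_norm]; exact dist_le_diam hx hy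

theorem diam_pos (s : T.cells) : 0 < Metric.diam (tri s.1) :=
  (dist_pos.2 (T.va_ne_vb (s, 0))).trans_le (dist_le_diam (T.va_mem (s, 0)) (T.vb_mem (s, 0)))

theorem abs_orient_pos (s : T.cells) : 0 < |T.orient s| := abs_pos.2 (T.orient_ne_zero s)

theorem abs_orient_le (q : T.cells × Fin 3) :
    |T.orient q.1| ≤ dist (T.va q) (T.vb q) * Metric.diam (tri q.1.1) := by
  have : T.orient q.1 = cr (T.va q - T.vb q) (T.vb q - T.vp q) := by
    rw [← T.cr_eq_orient q]; simp [cr]; ring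
  rw [this, dist_eq_norm]
  refine (abs_cr_le _ _).trans ?_
  gcongr
  exact norm_sub_le_diam (T.vb_mem q) (T.vp_mem q)

theorem abs_orient_le_sq (s : T.cells) : |T.orient s| ≤ Metric.diam (tri s.1) ^ 2 := by
  refine (T.abs_orient_le (s, 0)).trans ?_
  rw [sq]
  gcongr
  exact dist_le_diam (T.va_mem (s, 0)) (T.vb_mem (s, 0))

variable {T} {σ : ℝ}

theorem ShapeRegular.pos_and_sq_le (hσ : T.ShapeRegular σ) (s : T.cells) :
    0 < σ ∧ Metric.diam (tri s.1) ^ 2 ≤ σ * |T.orient s| := by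
  obtain ⟨c, ρ, hρ, hball, hdiam⟩ := hσ s.1 s.2
  have hpos := T.diam_pos s
  have hσ0 : 0 < σ := by
    by_contra h
    have := mul_nonpos_of_nonpos_of_nonneg (not_lt.1 h) hρ
    linarith
  have hρ0 : 0 < ρ := by
    rcases hρ.eq_or_lt with rfl | h
    · simp only [mul_zero] at hdiam; linarith
    · exact h
  refine ⟨hσ0, ?_⟩
  have hedge : ∀ q : Fin 3, dist (T.va (s, q)) (T.vb (s, q)) ≤ |T.orient s| / ρ := by
    intro i
    rw [le_div_iff₀ hρ0, mul_comm]
    have := mul_dist_le_of_closedBall_subset hρ (a := T.va (s, i)) (b := T.vb (s, i))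
      (p := T.vp (s, i)) (by rw [← T.tri_eq (s, i)]; exact hball)
    rwa [T.cr_eq_orient] at this
  have hd : Metric.diam (tri s.1) ≤ |T.orient s| / ρ := by
    rw [convexHull_diam]
    refine Metric.diam_le_of_forall_dist_le (by positivity) ?_
    rw [T.coe_cell (s, 0)]
    have e0 : dist (T.vtx s 1) (T.vtx s 2) ≤ |T.orient s| / ρ := hedge 0
    have e1 : dist (T.vtx s 2) (T.vtx s 0) ≤ |T.orient s| / ρ := hedge 1
    have e2 : dist (T.vtx s 0) (T.vtx s 1) ≤ |T.orient s| / ρ := hedge 2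
    have hz : 0 ≤ |T.orient s| / ρ := by positivity
    have hx1 : T.va (s, 0) = T.vtx s 1 := rfl
    have hx2 : T.vb (s, 0) = T.vtx s 2 := rfl
    have hx3 : T.vp (s, 0) = T.vtx s 0 := rfl
    rw [hx1, hx2, hx3]
    rintro x (rfl | rfl | rfl) y (rfl | rfl | rfl) <;>
      first
      | (rw [dist_self]; exact hz)
      | assumption
      | (rw [dist_comm]; assumption)
  calc Metric.diam (tri s.1) ^ 2 = Metric.diam (tri s.1) * Metric.diam (tri s.1) := sq _
    _ ≤ (σ * ρ) * (|T.orient s| / ρ) := by gcongr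
    _ = σ * |T.orient s| := by field_simp

theorem ShapeRegular.diam_le_of_edge_eq (hσ : T.ShapeRegular σ) {q q' : T.cells × Fin 3}
    (h : T.edge q = T.edge q') :
    Metric.diam (tri q'.1.1) ≤ σ * Metric.diam (tri q.1.1) := by
  obtain ⟨h0, h1⟩ := hσ.pos_and_sq_le q'.1
  have h2 := T.abs_orient_le q'
  have h3 : dist (T.va q') (T.vb q') = dist (T.va q) (T.vb q) := by
    rcases Set.pair_eq_pair_iff.1 h with ⟨e1, e2⟩ | ⟨e1, e2⟩
    · rw [e1, e2]
    · rw [e1, e2, dist_comm]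
  rw [h3] at h2
  have h4 := dist_le_diam (T.va_mem q) (T.vb_mem q)
  have hp := T.diam_pos q'.1
  have : Metric.diam (tri q'.1.1) * Metric.diam (tri q'.1.1) ≤
      σ * Metric.diam (tri q.1.1) * Metric.diam (tri q'.1.1) := by
    calc _ = Metric.diam (tri q'.1.1) ^ 2 := (sq _).symm
      _ ≤ σ * |T.orient q'.1| := h1
      _ ≤ σ * (dist (T.va q) (T.vb q) * Metric.diam (tri q'.1.1)) := by gcongr
      _ ≤ σ * (Metric.diam (tri q.1.1) * Metric.diam (tri q'.1.1)) := by gcongr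
      _ = _ := by ring
  exact le_of_mul_le_mul_right this hp

/-- The barycentric coordinates of the vertex opposite to a common edge. -/
theorem ShapeRegular.exists_barycentric (hσ : T.ShapeRegular σ) {q q' : T.cells × Fin 3}
    (h : T.edge q = T.edge q') (hne : q.1 ≠ q'.1) :
    ∃ α β γ : ℝ, T.vp q' = α • T.va q + β • T.vb q + γ • T.vp q ∧ α + β + γ = 1 ∧ γ < 0 ∧
      γ * |T.orient q.1| = -|T.orient q'.1| ∧ |α| ≤ σ ^ 2 ∧ |β| ≤ σ ^ 2 ∧
      |-α / γ| ≤ σ ^ 2 ∧ |-β / γ| ≤ σ ^ 2 := by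
  have hc : cr (T.va q - T.vp q) (T.vb q - T.vp q) ≠ 0 := by
    rw [T.cr_eq_orient]; exact T.orient_ne_zero _
  obtain ⟨h0, h1⟩ := hσ.pos_and_sq_le q.1
  have hJ := T.abs_orient_pos q.1
  have hd := hσ.diam_le_of_edge_eq h
  have hopp := T.cr_mul_cr_neg_of_edge_eq h hne
  have habs := T.abs_cr_eq_of_edge_eq h
  have ha' : T.va q ∈ tri q'.1.1 := by
    rw [T.tri_eq_of_edge_eq h]; exact subset_convexHull ℝ _ (by simp)
  have hb' : T.vb q ∈ tri q'.1.1 := by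
    rw [T.tri_eq_of_edge_eq h]; exact subset_convexHull ℝ _ (by simp)
  obtain ⟨-, h1'⟩ := hσ.pos_and_sq_le q'.1
  have hJ' := T.abs_orient_pos q'.1
  have hd' := hσ.diam_le_of_edge_eq h.symm
  have hc' : cr (T.va q - T.vp q') (T.vb q - T.vp q') ≠ 0 := by
    rw [← abs_ne_zero, habs]; exact hJ'.ne'
  have bound : ∀ x y z w : Plane, x ∈ tri q'.1.1 → y ∈ tri q'.1.1 → z ∈ tri q.1.1 →
      w ∈ tri q.1.1 →
      |cr (x - y) (z - w) / cr (T.va q - T.vp q) (T.vb q - T.vp q)| ≤ σ ^ 2 := by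
    intro x y z w hx hy hz hw
    rw [abs_div, T.cr_eq_orient, div_le_iff₀ hJ]
    calc |cr (x - y) (z - w)| ≤ ‖x - y‖ * ‖z - w‖ := abs_cr_le _ _
      _ ≤ (σ * Metric.diam (tri q.1.1)) * Metric.diam (tri q.1.1) := by
          gcongr
          · exact (norm_sub_le_diam hx hy).trans hd
          · exact norm_sub_le_diam hz hw
      _ = σ * Metric.diam (tri q.1.1) ^ 2 := by ring
      _ ≤ σ * (σ * |T.orient q.1|) := by gcongr
      _ = _ := by ring
  have bound' : ∀ x y z w : Plane, x ∈ tri q'.1.1 → y ∈ tri q'.1.1 → z ∈ tri q.1.1 →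
      w ∈ tri q.1.1 →
      |-(cr (x - y) (z - w) / cr (T.va q - T.vp q) (T.vb q - T.vp q)) /
        (cr (T.va q - T.vp q') (T.vb q - T.vp q') / cr (T.va q - T.vp q) (T.vb q - T.vp q))|
        ≤ σ ^ 2 := by
    intro x y z w hx hy hz hw
    rw [neg_div, abs_neg, div_div_div_cancel_right₀ hc, abs_div, habs, div_le_iff₀ hJ']
    calc |cr (x - y) (z - w)| ≤ ‖x - y‖ * ‖z - w‖ := abs_cr_le _ _
      _ ≤ Metric.diam (tri q'.1.1) * (σ * Metric.diam (tri q'.1.1)) := by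
          gcongr
          · exact norm_sub_le_diam hx hy
          · exact (norm_sub_le_diam hz hw).trans hd'
      _ = σ * Metric.diam (tri q'.1.1) ^ 2 := by ring
      _ ≤ σ * (σ * |T.orient q'.1|) := by gcongr
      _ = _ := by ring
  have hswap : cr (T.vp q - T.vp q') (T.va q - T.vp q)
      = cr (T.va q - T.vp q') (T.va q - T.vp q) := by
    simp [cr]; ring
  refine ⟨_, _, _, eq_barycentric hc (T.vp q'), barycentric_sum hc (T.vp q'), ?_, ?_, ?_, ?_,
    ?_, ?_⟩
  · exact div_neg_iff.2 (by
      rcases mul_neg_iff.1 hopp with ⟨h1, h2⟩ | ⟨h1, h2⟩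
      · exact Or.inr ⟨h2, h1⟩
      · exact Or.inl ⟨h2, h1⟩)
  · rw [← habs, ← T.cr_eq_orient q]
    rcases mul_neg_iff.1 hopp with ⟨h1, h2⟩ | ⟨h1, h2⟩
    · rw [abs_of_pos h1, abs_of_neg h2, neg_neg, div_mul_cancel₀ _ hc]
    · rw [abs_of_neg h1, abs_of_pos h2, mul_neg, div_mul_cancel₀ _ hc]
  · exact bound _ _ _ _ hb' (T.vp_mem q') (T.vp_mem q) (T.vb_mem q)
  · rw [hswap]
    exact bound _ _ _ _ ha' (T.vp_mem q') (T.va_mem q) (T.vp_mem q)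
  · exact bound' _ _ _ _ hb' (T.vp_mem q') (T.vp_mem q) (T.vb_mem q)
  · rw [hswap]
    exact bound' _ _ _ _ ha' (T.vp_mem q') (T.va_mem q) (T.vp_mem q)

theorem wMeasure_cell (hΩ : IsMeridianDomain Ω) (q : T.cells × Fin 3) :
    wMeasure Ω 1 (tri q.1.1) =
      ENNReal.ofReal (|T.orient q.1| * ((T.va q 0 + T.vb q 0 + T.vp q 0) / 6)) := by
  have hX := T.tri_subset_closure q.1
  rw [T.tri_eq q] at hX ⊢
  rw [hΩ.wMeasure_triangle hX (by rw [T.cr_eq_orient]; exact T.orient_ne_zero _), T.cr_eq_orient]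

theorem wMeasure_cell_ne_zero (hΩ : IsMeridianDomain Ω) (s : T.cells) :
    wMeasure Ω 1 (tri s.1) ≠ 0 := by
  rw [T.wMeasure_cell hΩ (s, 0)]
  have hr : ∀ x ∈ tri s.1, 0 ≤ x 0 := fun x hx => hΩ.radius_nonneg (T.tri_subset_closure s hx)
  have h1 := hr _ (T.va_mem (s, 0))
  have h2 := hr _ (T.vb_mem (s, 0))
  have h3 := hr _ (T.vp_mem (s, 0))
  have hpos : 0 < T.va (s, 0) 0 + T.vb (s, 0) 0 + T.vp (s, 0) 0 := by
    by_contra hcon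
    have e1 : T.va (s, 0) 0 = 0 := by linarith
    have e2 : T.vb (s, 0) 0 = 0 := by linarith
    have e3 : T.vp (s, 0) 0 = 0 := by linarith
    apply T.orient_ne_zero s
    rw [← T.cr_eq_orient (s, 0)]
    simp [cr, e1, e2, e3]
  have := T.abs_orient_pos s
  simp only [ne_eq, ENNReal.ofReal_eq_zero, not_le]
  positivity

/-- Contraction factor in the comparison of neighbouring cells. -/
def contractFactor (σ : ℝ) : ℝ := 1 / (1 + 2 * σ ^ 2)

/-- Constant in the comparison of neighbouring cells. -/
def neighborConst (σ : ℝ) : ℝ :=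
  144 * (σ ^ 3 + σ ^ 8 + 1) / (contractFactor σ ^ 2) ^ 2

theorem contractFactor_pos (σ : ℝ) : 0 < contractFactor σ := by unfold contractFactor; positivity

theorem contractFactor_le_one (σ : ℝ) : contractFactor σ ≤ 1 := by
  unfold contractFactor
  rw [div_le_one (by positivity)]
  nlinarith [sq_nonneg σ]

theorem contractFactor_mul_le {σ α : ℝ} (h : |α| ≤ σ ^ 2) :
    contractFactor σ * (1 - 2 * α) ≤ 1 := by
  unfold contractFactor
  rw [one_div, inv_mul_le_iff₀ (by positivity)]
  linarith [neg_abs_le α]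

theorem wMeasure_contract_ge (hΩ : IsMeridianDomain Ω) {a b p : Plane} {t : ℝ} (ht0 : 0 < t)
    (ht1 : t ≤ 1) (hX : convexHull ℝ {a, b, p} ⊆ closure Ω) (hc : cr (a - p) (b - p) ≠ 0) :
    ENNReal.ofReal (t ^ 2) * wMeasure Ω 1 (convexHull ℝ {a, b, p}) ≤
      wMeasure Ω 1 (convexHull ℝ {a, b, contractVertex t a b p}) := by
  have hr : ∀ x ∈ ({a, b, p} : Set Plane), 0 ≤ x 0 := fun x hx =>
    hΩ.radius_nonneg (hX (subset_convexHull ℝ _ hx))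
  have h1 := hr a (by simp)
  have h2 := hr b (by simp)
  have h3 := hr p (by simp)
  rw [hΩ.wMeasure_triangle hX hc, hΩ.wMeasure_triangle ((contract_subset ht0.le ht1 a b p).trans hX)
    (by rw [cr_contractVertex]; exact mul_ne_zero ht0.ne' hc), cr_contractVertex,
    ← ENNReal.ofReal_mul (by positivity)]
  apply ENNReal.ofReal_le_ofReal
  rw [abs_mul, abs_of_pos ht0]
  have : t * (a 0 + b 0 + p 0) ≤ a 0 + b 0 + contractVertex t a b p 0 := by
    simp only [contractVertex, PiLp.add_apply, PiLp.smul_apply, smul_eq_mul]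
    nlinarith
  calc t ^ 2 * (|cr (a - p) (b - p)| * ((a 0 + b 0 + p 0) / 6))
      = t * |cr (a - p) (b - p)| * (t * (a 0 + b 0 + p 0) / 6) := by ring
    _ ≤ _ := by gcongr

theorem ShapeRegular.wMeasure_le_of_edge_eq (hσ : T.ShapeRegular σ) (hΩ : IsMeridianDomain Ω)
    {q q' : T.cells × Fin 3} (h : T.edge q = T.edge q') (hne : q.1 ≠ q'.1) :
    wMeasure Ω 1 (tri q.1.1) ≤ ENNReal.ofReal (σ ^ 3 + σ ^ 8) * wMeasure Ω 1 (tri q'.1.1) := by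
  obtain ⟨hσ0, -⟩ := hσ.pos_and_sq_le q.1
  obtain ⟨-, hsq'⟩ := hσ.pos_and_sq_le q'.1
  obtain ⟨α, β, γ, hp', hsum, hγ, hγJ, hα, hβ, -⟩ := hσ.exists_barycentric h hne
  have hr : ∀ (s : T.cells), ∀ x ∈ tri s.1, 0 ≤ x 0 := fun s x hx =>
    hΩ.radius_nonneg (T.tri_subset_closure s hx)
  have h1 := hr _ _ (T.va_mem q)
  have h2 := hr _ _ (T.vb_mem q)
  have h3 := hr _ _ (T.vp_mem q)
  have h4 := hr _ _ (T.vp_mem q')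
  have hJ := T.abs_orient_pos q.1
  have hJ' := T.abs_orient_pos q'.1
  have hJJ : |T.orient q.1| ≤ σ ^ 3 * |T.orient q'.1| := by
    have hd := hσ.diam_le_of_edge_eq h.symm
    calc |T.orient q.1| ≤ Metric.diam (tri q.1.1) ^ 2 := T.abs_orient_le_sq q.1
      _ ≤ (σ * Metric.diam (tri q'.1.1)) ^ 2 := by
          gcongr
      _ = σ ^ 2 * Metric.diam (tri q'.1.1) ^ 2 := by ring
      _ ≤ σ ^ 2 * (σ * |T.orient q'.1|) := by gcongr
      _ = _ := by ring
  have hab : T.va q' 0 + T.vb q' 0 = T.va q 0 + T.vb q 0 := by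
    rcases Set.pair_eq_pair_iff.1 h with ⟨e1, e2⟩ | ⟨e1, e2⟩
    · rw [e1, e2]
    · rw [e1, e2, add_comm]
  rw [T.wMeasure_cell hΩ q, T.wMeasure_cell hΩ q', ← ENNReal.ofReal_mul (by positivity), hab]
  apply ENNReal.ofReal_le_ofReal
  have hp0 : T.vp q' 0 = α * T.va q 0 + β * T.vb q 0 + γ * T.vp q 0 := by
    rw [hp']; simp
  have hrp : |T.orient q'.1| * T.vp q 0 ≤ |T.orient q.1| * (σ ^ 2 * (T.va q 0 + T.vb q 0)) := by
    have : |T.orient q'.1| * T.vp q 0 =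
        |T.orient q.1| * (α * T.va q 0 + β * T.vb q 0 - T.vp q' 0) := by
      have e : |T.orient q'.1| = -(γ * |T.orient q.1|) := by rw [hγJ]; ring
      rw [e, hp0]; ring
    rw [this]
    gcongr
    have ea : α * T.va q 0 ≤ σ ^ 2 * T.va q 0 := by
      gcongr; exact (le_abs_self α).trans hα
    have eb : β * T.vb q 0 ≤ σ ^ 2 * T.vb q 0 := by
      gcongr; exact (le_abs_self β).trans hβ
    linarith
  have hJrp : |T.orient q.1| * T.vp q 0 ≤ σ ^ 8 * |T.orient q'.1| * (T.va q 0 + T.vb q 0) := by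
    have e : |T.orient q'.1| * (|T.orient q.1| * T.vp q 0) ≤
        |T.orient q'.1| * (σ ^ 8 * |T.orient q'.1| * (T.va q 0 + T.vb q 0)) := by
      calc _ = |T.orient q.1| * (|T.orient q'.1| * T.vp q 0) := by ring
        _ ≤ |T.orient q.1| * (|T.orient q.1| * (σ ^ 2 * (T.va q 0 + T.vb q 0))) := by gcongr
        _ ≤ (σ ^ 3 * |T.orient q'.1|) * ((σ ^ 3 * |T.orient q'.1|) *
              (σ ^ 2 * (T.va q 0 + T.vb q 0))) := by gcongr
        _ = _ := by ring
    exact le_of_mul_le_mul_left e hJ'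
  have hfirst : |T.orient q.1| * (T.va q 0 + T.vb q 0) ≤
      σ ^ 3 * |T.orient q'.1| * (T.va q 0 + T.vb q 0) := by gcongr
  have hlast : 0 ≤ (σ ^ 3 + σ ^ 8) * (|T.orient q'.1| * T.vp q' 0) := by positivity
  linarith

/-- Constants that approximate a function on neighbouring cells are close to each other. -/
theorem ShapeRegular.sq_sub_mul_wMeasure_le (hσ : T.ShapeRegular σ) (hΩ : IsMeridianDomain Ω)
    {q q' : T.cells × Fin 3} (h : T.edge q = T.edge q') (hne : q.1 ≠ q'.1)
    {f g₀ g₁ : Plane → ℝ} (hf : Measurable f) (hg₀ : Measurable g₀) (hg₁ : Measurable g₁)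
    (h₀ : HasWeakPartial Ω 0 f g₀) (h₁ : HasWeakPartial Ω 1 f g₁) {c : T.cells → ℝ}
    (hc : ∀ s : T.cells, ∫⁻ x in tri s.1, ENNReal.ofReal ((f x - c s) ^ 2) ∂(wMeasure Ω 1) ≤
      ENNReal.ofReal (8 * T.meshSize ^ 2) *
        ∫⁻ x in tri s.1, ENNReal.ofReal (g₀ x ^ 2 + g₁ x ^ 2) ∂(wMeasure Ω 1)) :
    ENNReal.ofReal ((c q.1 - c q'.1) ^ 2) * wMeasure Ω 1 (tri q.1.1) ≤
      ENNReal.ofReal (neighborConst σ * T.meshSize ^ 2) *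
        (∫⁻ x in tri q.1.1, ENNReal.ofReal (g₀ x ^ 2 + g₁ x ^ 2) ∂(wMeasure Ω 1) +
         ∫⁻ x in tri q'.1.1, ENNReal.ofReal (g₀ x ^ 2 + g₁ x ^ 2) ∂(wMeasure Ω 1)) := by
  have := hΩ.isFiniteMeasure_wMeasure_one
  obtain ⟨hσ0, -⟩ := hσ.pos_and_sq_le q.1
  set t := contractFactor σ with ht
  have ht0 : 0 < t := contractFactor_pos σ
  have ht1 : t ≤ 1 := contractFactor_le_one σ
  have hK := T.tri_eq q
  have hK' := T.tri_eq_of_edge_eq h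
  have hX := T.tri_subset_closure q.1
  have hX' := T.tri_subset_closure q'.1
  have hcr : cr (T.va q - T.vp q) (T.vb q - T.vp q) ≠ 0 := by
    rw [T.cr_eq_orient]; exact T.orient_ne_zero _
  have hcr' : cr (T.va q - T.vp q') (T.vb q - T.vp q') ≠ 0 := by
    rw [← abs_ne_zero, T.abs_cr_eq_of_edge_eq h, abs_ne_zero]; exact T.orient_ne_zero _
  set a := T.va q with ha
  set b := T.vb q with hb
  set p := T.vp q with hp
  set p' := T.vp q' with hpp'
  set S := convexHull ℝ {a, b, contractVertex t a b p}
  set S' := convexHull ℝ {a, b, contractVertex t a b p'}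
  set Q := convexHull ℝ (S ∪ S')
  have hQ : Q ⊆ tri q.1.1 ∪ tri q'.1.1 := by
    obtain ⟨α, β, γ, hp1, hsum, hγ, -, hα, hβ, hα', hβ'⟩ := hσ.exists_barycentric h hne
    rw [hK, hK']
    exact convexHull_contract_union_subset ht0.le ht1 hp1 hsum hγ (contractFactor_mul_le hα)
      (contractFactor_mul_le hβ) (contractFactor_mul_le hα') (contractFactor_mul_le hβ')
  have hQm : MeasurableSet Q := by
    have : Q = convexHull ℝ ({a, b, contractVertex t a b p} ∪ {a, b, contractVertex t a b p'}) := by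
      simp only [Q, S, S', convexHull_convexHull_union_left, convexHull_convexHull_union_right]
    rw [this]
    exact ((Set.toFinite _).isCompact_convexHull (𝕜 := ℝ)).measurableSet
  have hdQ : ∀ x ∈ Q, ∀ y ∈ Q, dist x y ≤ 2 * T.meshSize := by
    have hax : ∀ x ∈ Q, dist x a ≤ T.meshSize := by
      intro x hx
      rcases hQ hx with hx | hx
      · exact (dist_le_diam hx (T.va_mem q)).trans (T.diam_le_meshSize _)
      · refine (dist_le_diam hx ?_).trans (T.diam_le_meshSize _)
        rw [hK']; exact subset_convexHull ℝ _ (by simp)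
    intro x hx y hy
    have := dist_triangle_right x y a
    linarith [hax x hx, hax y hy]
  have hpo := hΩ.poincare (hQ.trans (union_subset hX hX')) hQm (convex_convexHull ℝ _) hdQ
    hf hg₀ hg₁ h₀ h₁
  have key := sq_sub_mul_measure_le (ν := wMeasure Ω 1) (K := tri q.1.1) (K' := tri q'.1.1)
    (S := S) (S' := S') (Q := Q) (t := ENNReal.ofReal (t ^ 2))
    (B := ENNReal.ofReal (σ ^ 3 + σ ^ 8)) (κ := ENNReal.ofReal (8 * T.meshSize ^ 2))
    (g := fun x => ENNReal.ofReal (g₀ x ^ 2 + g₁ x ^ 2))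
    (by rw [hK]; exact contract_subset ht0.le ht1 a b p)
    (by rw [hK']; exact contract_subset ht0.le ht1 a b p')
    (subset_union_left.trans (subset_convexHull ℝ _))
    (subset_union_right.trans (subset_convexHull ℝ _)) hQ
    (by simp only [ne_eq, ENNReal.ofReal_eq_zero, not_le]; positivity) ENNReal.ofReal_ne_top
    (by rw [hK] at hX ⊢; exact wMeasure_contract_ge hΩ ht0 ht1 hX hcr)
    (by rw [hK'] at hX' ⊢; exact wMeasure_contract_ge hΩ ht0 ht1 hX' hcr')
    (hσ.wMeasure_le_of_edge_eq hΩ h hne) (T.wMeasure_cell_ne_zero hΩ q'.1) hf (hc q.1) (hc q'.1)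
    (by
      refine hpo.trans (le_of_eq ?_)
      congr 2
      rw [show (4 : ENNReal) = ENNReal.ofReal 4 by simp, ← ENNReal.ofReal_mul (by norm_num)]
      congr 1
      ring)
  refine key.trans (le_of_eq ?_)
  congr 1
  rw [← ENNReal.ofReal_one, ← ENNReal.ofReal_add (by positivity) (by norm_num),
    ← ENNReal.ofReal_pow (by positivity), show (18 : ENNReal) = ENNReal.ofReal 18 by simp,
    ← ENNReal.ofReal_mul (by norm_num), ← ENNReal.ofReal_mul (by positivity),
    ← ENNReal.ofReal_div_of_pos (by positivity)]
  congr 1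
  rw [neighborConst]
  ring

end Triangulation

namespace Triangulation

/-! ### Piecewise defined fields and their distributional divergence -/

variable {Ω : Set Plane} (T : Triangulation Ω)

theorem volume_convexHull_pair {a b p : Plane} (h : cr (a - p) (b - p) ≠ 0) :
    volume (convexHull ℝ {a, b}) = 0 := by
  set L : Plane →ₗ[ℝ] ℝ :=
    { toFun := fun y => cr (b - a) y
      map_add' := fun x y => by simp [cr]; ring
      map_smul' := fun c x => by simp [cr]; ring } with hL
  have hker : LinearMap.ker L ≠ ⊤ := by
    intro htop
    have hp : p - a ∈ LinearMap.ker L := htop ▸ Submodule.mem_top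
    have h0 : cr (b - a) (p - a) = 0 := hp
    apply h
    rw [← h0]
    simp [cr]; ring
  have h0 := Measure.addHaar_submodule (volume : Measure Plane) (LinearMap.ker L) hker
  rw [← measure_preimage_add_right volume (-a)] at h0
  refine measure_mono_null (fun x hx => ?_) h0
  have hx0 := cr_eq_zero_of_mem_segment hx
  change cr (b - a) (x + -a) = 0
  rw [← hx0]
  simp [cr]; ring

theorem volume_inter_eq_zero {s t : T.cells} (hst : s ≠ t) : volume (tri s.1 ∩ tri t.1) = 0 := by
  rw [T.conforming _ s.2 _ t.2]
  obtain ⟨i, hi⟩ : ∃ i, T.vtx s i ∉ t.1 := by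
    by_contra hcon
    push Not at hcon
    apply hst
    refine Subtype.ext (Finset.eq_of_subset_of_card_le (Finset.coe_subset.1 ?_)
      (by rw [T.card_eq _ s.2, T.card_eq _ t.2]))
    rw [T.coe_cell (s, 0)]
    rintro x (rfl | rfl | rfl)
    · exact hcon _
    · exact hcon _
    · exact hcon _
  have hsub : (s.1 : Set Plane) ∩ t.1 ⊆ {T.va (s, i), T.vb (s, i)} := by
    rintro x ⟨hx, hxt⟩
    rw [T.coe_cell_eq_insert (s, i)] at hx
    rcases hx with rfl | hx
    · exact absurd hxt hi
    · exact hx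
  refine measure_mono_null (convexHull_mono hsub) (volume_convexHull_pair (p := T.vp (s, i)) ?_)
  rw [T.cr_eq_orient]
  exact T.orient_ne_zero s

theorem measurableSet_tri (s : Finset Plane) : MeasurableSet (tri s) :=
  (isCompact_tri s).measurableSet

theorem restrict_eq_sum (hΩ : IsMeridianDomain Ω) :
    volume.restrict Ω = ∑ s : T.cells, volume.restrict (tri s.1) := by
  have h1 : (Ω : Set Plane) =ᵐ[volume] (⋃ s : T.cells, tri s.1 : Set Plane) := by
    have : (⋃ s : T.cells, tri s.1) = closure Ω := by
      rw [← T.cover]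
      ext x
      simp
    rw [this]
    have := hΩ.inter_ae_eq (X := closure Ω) subset_rfl
    rwa [inter_eq_self_of_subset_right subset_closure] at this
  rw [Measure.restrict_congr_set h1, Measure.restrict_iUnion_ae, Measure.sum_fintype]
  · exact fun s t hst => T.volume_inter_eq_zero hst
  · exact fun s => (measurableSet_tri s.1).nullMeasurableSet

theorem wMeasure_eq_sum (hΩ : IsMeridianDomain Ω) (α : ℤ) :
    wMeasure Ω α = ∑ s : T.cells, (wMeasure Ω α).restrict (tri s.1) := by
  have h : ∀ s : T.cells, (wMeasure Ω α).restrict (tri s.1) =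
      (volume.restrict (tri s.1)).withDensity fun x => ENNReal.ofReal (x 0 ^ α) := fun s =>
    hΩ.wMeasure_restrict α (T.tri_subset_closure s) (measurableSet_tri s.1)
  simp_rw [h]
  rw [wMeasure, T.restrict_eq_sum hΩ, ← Measure.sum_fintype, withDensity_sum, Measure.sum_fintype]

theorem lintegral_eq_sum (hΩ : IsMeridianDomain Ω) (α : ℤ) (F : Plane → ENNReal) :
    ∫⁻ x, F x ∂(wMeasure Ω α) = ∑ s : T.cells, ∫⁻ x in tri s.1, F x ∂(wMeasure Ω α) := by
  conv_lhs => rw [T.wMeasure_eq_sum hΩ α]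
  rw [lintegral_finsetSum_measure]

theorem setIntegral_eq_sum (hΩ : IsMeridianDomain Ω) {F : Plane → ℝ} {G : T.cells → Plane → ℝ}
    (hG : ∀ s, Continuous (G s)) (hFG : ∀ s : T.cells, F =ᵐ[volume.restrict (tri s.1)] G s) :
    ∫ x in Ω, F x = ∑ s : T.cells, ∫ x in tri s.1, G s x := by
  rw [T.restrict_eq_sum hΩ, integral_finsetSum_measure]
  · exact Finset.sum_congr rfl fun s _ => integral_congr_ae (hFG s)
  · intro s _
    have : IntegrableOn (G s) (tri s.1) :=
      ContinuousOn.integrableOn_compact (isCompact_tri s.1) (hG s).continuousOn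
    exact Integrable.congr this (hFG s).symm

theorem absolutelyContinuous_tri (hΩ : IsMeridianDomain Ω) (s : T.cells) :
    volume.restrict (tri s.1) ≪ volume.restrict Ω := by
  rw [← hΩ.restrict_restrict (T.tri_subset_closure s) (measurableSet_tri s.1)]
  exact Measure.restrict_le_self.absolutelyContinuous

/-- Piecewise continuous functions belong to the weighted Lebesgue space. -/
theorem exists_piecewise {E : Type*} [NormedAddCommGroup E] [MeasurableSpace E] [BorelSpace E]
    [SecondCountableTopology E] (hΩ : IsMeridianDomain Ω) (F : T.cells → Plane → E)
    (hF : ∀ s, Continuous (F s)) :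
    ∃ w : Lp E 2 (wMeasure Ω 1), ∀ s : T.cells, ∀ᵐ x ∂(volume.restrict (tri s.1)), w x = F s x := by
  classical
  have := hΩ.isFiniteMeasure_wMeasure_one
  set P : Plane → E := fun x => ∑ s : T.cells, (tri s.1).indicator (F s) x with hP
  have hmem : MemLp P 2 (wMeasure Ω 1) := by
    refine memLp_finsetSum _ fun s _ => ?_
    obtain ⟨A, hA⟩ := (isCompact_tri s.1).exists_bound_of_continuousOn (hF s).continuousOn
    refine MemLp.of_bound ((hF s).measurable.indicator
      (measurableSet_tri s.1)).aestronglyMeasurable (max A 0) ?_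
    refine Filter.Eventually.of_forall fun x => ?_
    by_cases hx : x ∈ tri s.1
    · rw [indicator_of_mem hx]; exact (hA x hx).trans (le_max_left _ _)
    · rw [indicator_of_notMem hx, norm_zero]; exact le_max_right _ _
  refine ⟨hmem.toLp P, fun s => ?_⟩
  have h1 : ∀ᵐ x ∂(volume.restrict (tri s.1)), hmem.toLp P x = P x :=
    (T.absolutelyContinuous_tri hΩ s).ae_le
      ((hΩ.restrict_absolutelyContinuous 1).ae_le hmem.coeFn_toLp)
  have h2 : ∀ᵐ x ∂(volume.restrict (tri s.1)), ∀ t : T.cells, t ≠ s → x ∉ tri t.1 := by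
    rw [ae_all_iff]
    intro t
    by_cases ht : t = s
    · simp [ht]
    · simp only [ne_eq, ht, not_false_eq_true, forall_true_left]
      rw [ae_iff]
      simp only [not_not]
      rw [Measure.restrict_apply' (measurableSet_tri s.1)]
      exact T.volume_inter_eq_zero ht
  filter_upwards [h1, h2, ae_restrict_mem (measurableSet_tri s.1)] with x hx1 hx2 hx3
  rw [hx1, hP]
  simp only
  rw [Finset.sum_eq_single s]
  · exact indicator_of_mem hx3 _
  · intro t _ ht
    exact indicator_of_notMem (hx2 t ht) _
  · simp

/-- The lowest order Raviart–Thomas field on a cell with given (scaled) edge fluxes. -/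
def rtField (Λ : T.cells × Fin 3 → ℝ) (s : T.cells) (x : Plane) : Plane :=
  -∑ i, Λ (s, i) • (x - T.vp (s, i))

theorem integral_edge_eq {φ : Plane → ℝ} {q q' : T.cells × Fin 3} (h : T.edge q = T.edge q') :
    ∫ t in (0 : ℝ)..1, φ (T.va q + t • (T.vb q - T.va q)) =
      ∫ t in (0 : ℝ)..1, φ (T.va q' + t • (T.vb q' - T.va q')) := by
  rcases Set.pair_eq_pair_iff.1 h with ⟨e1, e2⟩ | ⟨e1, e2⟩
  · rw [e1, e2]
  · rw [e1, e2]
    have := intervalIntegral.integral_comp_sub_left (a := (0 : ℝ)) (b := 1)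
      (fun t : ℝ => φ (T.va q' + t • (T.vb q' - T.va q'))) 1
    simp only [sub_self, sub_zero] at this
    rw [← this]
    refine intervalIntegral.integral_congr fun t _ => ?_
    beta_reduce
    congr 1
    module

/-- If the fluxes of interior edges match, the field has no jumps of its normal component. -/
theorem sum_integral_rtField_eq_zero (hΩ : IsMeridianDomain Ω) {Λ : T.cells × Fin 3 → ℝ}
    (hΛ : ∀ q q', T.edge q = T.edge q' → q.1 ≠ q'.1 →
      Λ q * |T.orient q.1| + Λ q' * |T.orient q'.1| = 0)
    {φ : Plane → ℝ} (hφ : IsTest Ω φ) :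
    ∑ s : T.cells, ∫ x in tri s.1,
      (fderiv ℝ φ x (T.rtField Λ s x) - 2 * (∑ i, Λ (s, i)) * φ x) = 0 := by
  have hφ1 : ContDiff ℝ 1 φ := hφ.1.of_le (by simp)
  have hφc := hφ.1.continuous
  have hcell : ∀ s : T.cells, ∫ x in tri s.1,
      (fderiv ℝ φ x (T.rtField Λ s x) - 2 * (∑ i, Λ (s, i)) * φ x) =
      ∑ i, -(Λ (s, i) * |T.orient s| *
        ∫ t in (0 : ℝ)..1, φ (T.va (s, i) + t • (T.vb (s, i) - T.va (s, i)))) := by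
    intro s
    have hpt : ∀ x, fderiv ℝ φ x (T.rtField Λ s x) - 2 * (∑ i, Λ (s, i)) * φ x =
        ∑ i, -Λ (s, i) * (fderiv ℝ φ x (x - T.vp (s, i)) + 2 * φ x) := by
      intro x
      rw [rtField, map_neg, map_sum, Finset.mul_sum, Finset.sum_mul, ← Finset.sum_neg_distrib,
        ← Finset.sum_sub_distrib]
      refine Finset.sum_congr rfl fun i _ => ?_
      rw [map_smul, smul_eq_mul]
      ring
    simp_rw [hpt]
    rw [integral_finsetSum]
    · refine Finset.sum_congr rfl fun i _ => ?_
      rw [integral_const_mul, T.tri_eq (s, i), gauss_green_triangle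
        (by rw [T.cr_eq_orient]; exact T.orient_ne_zero s) hφ1, T.cr_eq_orient]
      ring
    · intro i _
      refine ContinuousOn.integrableOn_compact (isCompact_tri s.1) ?_
      have : Continuous fun x => fderiv ℝ φ x (x - T.vp (s, i)) :=
        (hφ1.continuous_fderiv one_ne_zero).clm_apply (by fun_prop)
      fun_prop
  simp_rw [hcell]
  rw [← Fintype.sum_prod_type' (f := fun s i => -(Λ (s, i) * |T.orient s| *
        ∫ t in (0 : ℝ)..1, φ (T.va (s, i) + t • (T.vb (s, i) - T.va (s, i)))))]
  refine T.sum_edges_eq_zero (fun q => -(Λ q * |T.orient q.1| *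
    ∫ t in (0 : ℝ)..1, φ (T.va q + t • (T.vb q - T.va q)))) ?_ ?_
  · intro q q' h hne
    beta_reduce
    rw [T.integral_edge_eq h]
    linear_combination -(hΛ q q' h hne) *
      ∫ t in (0 : ℝ)..1, φ (T.va q' + t • (T.vb q' - T.va q'))
  · intro q hq
    have : ∫ t in (0 : ℝ)..1, φ (T.va q + t • (T.vb q - T.va q)) = 0 := by
      rw [intervalIntegral.integral_of_le zero_le_one, integral_Ioc_eq_integral_Ioo]
      refine setIntegral_eq_zero_of_forall_eq_zero fun t ht => ?_
      refine image_eq_zero_of_notMem_tsupport fun hmem => ?_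
      exact T.notMem_of_boundary_edge hq hΩ.isOpen ht (hφ.2.2 hmem)
    beta_reduce
    rw [this]
    ring

/-- Matching edge fluxes and arbitrary piecewise constants determine an element of `C_h`. -/
theorem exists_mem_spaceC (hΩ : IsMeridianDomain Ω) {k : ℤ} (hk : k ≠ 0) {Λ : T.cells × Fin 3 → ℝ}
    (hΛ : ∀ q q', T.edge q = T.edge q' → q.1 ≠ q'.1 →
      Λ q * |T.orient q.1| + Λ q' * |T.orient q'.1| = 0) (e : T.cells → ℝ) :
    ∃ w ∈ T.spaceC k, ∀ s : T.cells, ∀ᵐ x ∂(volume.restrict (tri s.1)),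
      w x 0 = T.rtField Λ s x 0 ∧ w x 2 = T.rtField Λ s x 1 ∧
        (k : ℝ) * w x 1 - w x 0 = x 0 * e s := by
  have hk' : (k : ℝ) ≠ 0 := by exact_mod_cast hk
  set c1 : T.cells → ℝ := fun s => -∑ i, Λ (s, i) with hc1
  set R : T.cells → Plane := fun s => ∑ i, Λ (s, i) • T.vp (s, i) with hR
  have hrt : ∀ s x, T.rtField Λ s x = R s + c1 s • x := by
    intro s x
    simp only [rtField, hR, hc1, smul_sub, Finset.sum_sub_distrib, ← Finset.sum_smul]
    module
  set c : T.cells → Fin 4 → ℝ := fun s =>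
    ![R s 0 / k, c1 s, (c1 s + e s) / k, R s 1] with hc
  obtain ⟨w, hw⟩ := T.exists_piecewise hΩ
    (fun s x => (!₂[(k : ℝ) * c s 0 + c s 1 * x 0, c s 0 + c s 2 * x 0,
      c s 3 + c s 1 * x 1] : Vec3)) (fun s => by fun_prop)
  obtain ⟨v, hv⟩ := T.exists_piecewise hΩ (fun s _ => 3 * c s 1 - k * c s 2)
    (fun s => continuous_const)
  have hcomp : ∀ s : T.cells, ∀ᵐ x ∂(volume.restrict (tri s.1)),
      w x 0 = T.rtField Λ s x 0 ∧ w x 2 = T.rtField Λ s x 1 ∧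
        (k : ℝ) * w x 1 - w x 0 = x 0 * e s := by
    intro s
    filter_upwards [hw s] with x hx
    rw [hx, hrt]
    refine ⟨?_, ?_, ?_⟩
    · simp [hc]
      field_simp
    · simp [hc]
    · simp [hc]
      field_simp
      ring
  refine ⟨w, ⟨⟨v, ?_⟩, fun s hs => ⟨c ⟨s, hs⟩, hw ⟨s, hs⟩⟩⟩, hcomp⟩
  intro φ hφ
  have hφ1 : ContDiff ℝ 1 φ := hφ.1.of_le (by simp)
  have hφc := hφ.1.continuous
  have hpd : ∀ i, Continuous (pd i φ) := fun i =>
    (hφ1.continuous_fderiv one_ne_zero).clm_apply continuous_const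
  have hpd0 := hpd 0
  have hpd1 := hpd 1
  have hrtc : ∀ s, Continuous (T.rtField Λ s) := fun s => by
    have : T.rtField Λ s = fun x => R s + c1 s • x := funext (hrt s)
    rw [this]
    fun_prop
  have hfd : ∀ x (ξ : Plane), fderiv ℝ φ x ξ = ξ 0 * pd 0 φ x + ξ 1 * pd 1 φ x := by
    intro x ξ
    have : ξ = ξ 0 • EuclideanSpace.single 0 1 + ξ 1 • EuclideanSpace.single 1 1 := by
      ext i; fin_cases i <;> simp
    conv_lhs => rw [this]
    simp [pd]
  have hpos : ∀ s : T.cells, ∀ᵐ x ∂(volume.restrict (tri s.1)), 0 < x 0 := fun s =>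
    (T.absolutelyContinuous_tri hΩ s).ae_le
      ((ae_restrict_mem hΩ.isOpen.measurableSet).mono fun x hx => hΩ.pos_radius x hx)
  rw [T.setIntegral_eq_sum hΩ (G := fun s x => (3 * c s 1 - k * c s 2) * φ x)
    (fun s => by fun_prop) (fun s => by filter_upwards [hv s] with x hx; rw [hx])]
  rw [T.setIntegral_eq_sum hΩ (G := fun s x => -T.rtField Λ s x 0 * pd 0 φ x +
    (c s 1 - k * c s 2) * φ x - T.rtField Λ s x 1 * pd 1 φ x)
    (fun s => by have := hrtc s; fun_prop) (fun s => by
      filter_upwards [hw s, hcomp s, hpos s] with x hx hx2 hx3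
      have : (w x 0 - (k : ℝ) * w x 1) / x 0 = c s 1 - k * c s 2 := by
        rw [div_eq_iff hx3.ne', hx]
        simp
        ring
      rw [this, hx2.1, hx2.2.1])]
  rw [← sub_eq_zero, ← Finset.sum_sub_distrib]
  refine Eq.trans (Finset.sum_congr rfl fun s _ => ?_) (T.sum_integral_rtField_eq_zero hΩ hΛ hφ)
  have := hrtc s
  rw [← integral_sub]
  · refine integral_congr_ae (Filter.Eventually.of_forall fun x => ?_)
    simp only [hfd]
    have : c s 1 = -∑ i, Λ (s, i) := by simp [hc, hc1]
    rw [this]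
    ring
  · exact ContinuousOn.integrableOn_compact (isCompact_tri s.1) (by fun_prop)
  · exact ContinuousOn.integrableOn_compact (isCompact_tri s.1) (by fun_prop)

end Triangulation

/-! ### Norms of weak derivatives -/

variable {Ω : Set Plane}

theorem wMeasure_absolutelyContinuous (α : ℤ) : wMeasure Ω α ≪ volume.restrict Ω :=
  withDensity_absolutelyContinuous _ _

theorem LocallyIntegrableOn.congr_ae {Ω : Set Plane} {f g : Plane → ℝ}
    (hΩ : IsOpen Ω) (hf : LocallyIntegrableOn f Ω) (h : f =ᵐ[volume.restrict Ω] g) :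
    LocallyIntegrableOn g Ω := by
  rw [locallyIntegrableOn_iff hΩ.isLocallyClosed] at hf ⊢
  exact fun C hC hCc => (hf C hC hCc).congr (ae_restrict_of_ae_restrict_of_subset hC h)

theorem HasWeakPartial.congr_ae (hΩ : IsOpen Ω) {i : Fin 2} {f g g' : Plane → ℝ}
    (h : HasWeakPartial Ω i f g) (hg : g =ᵐ[volume.restrict Ω] g') : HasWeakPartial Ω i f g' := by
  refine ⟨h.1, LocallyIntegrableOn.congr_ae hΩ h.2.1 hg, fun φ hφ => ?_⟩
  rw [h.2.2 φ hφ]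
  congr 1
  refine integral_congr_ae ?_
  filter_upwards [hg] with x hx
  rw [hx]

theorem HasWeakPartial.integrable_mul {i : Fin 2} {f g : Plane → ℝ}
    (h : HasWeakPartial Ω i f g) {φ : Plane → ℝ} (hφ : IsTest Ω φ) :
    Integrable (fun x => g x * φ x) (volume.restrict Ω) := by
  have hc : IsCompact (tsupport φ) := hφ.2.1
  have : IntegrableOn (fun x => g x * φ x) (tsupport φ) :=
    (h.2.1.integrableOn_compact_subset hφ.2.2 hc).mul_continuousOn hφ.1.continuous.continuousOn hc
  exact ((integrableOn_iff_integrable_of_support_subset (fun x hx => subset_tsupport _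
    (fun h => hx (by simp [h])))).1 this).integrableOn

/-- Weak derivatives are unique almost everywhere. -/
theorem HasWeakPartial.unique (hΩ : IsOpen Ω) {i : Fin 2} {f g g' : Plane → ℝ}
    (h : HasWeakPartial Ω i f g) (h' : HasWeakPartial Ω i f g') :
    g =ᵐ[volume.restrict Ω] g' := by
  have key := hΩ.ae_eq_zero_of_integral_contDiff_smul_eq_zero (μ := volume) (f := g - g')
    (h.2.1.sub h'.2.1) ?_
  · rw [Filter.EventuallyEq, ae_restrict_iff' hΩ.measurableSet]
    filter_upwards [key] with x hx hxΩ
    exact sub_eq_zero.1 (hx hxΩ)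
  · intro φ hφ hφc hφs
    have ht : IsTest Ω φ := ⟨hφ, hφc, hφs⟩
    have e1 := h.2.2 φ ht
    have e2 := h'.2.2 φ ht
    rw [← setIntegral_eq_integral_of_forall_compl_eq_zero (s := Ω)]
    · have : ∫ x in Ω, φ x • (g - g') x = (∫ x in Ω, g x * φ x) - ∫ x in Ω, g' x * φ x := by
        rw [← integral_sub (h.integrable_mul ht) (h'.integrable_mul ht)]
        refine integral_congr_ae (Filter.Eventually.of_forall fun x => ?_)
        simp
        ring
      rw [this]
      linarith
    · intro x hx
      rw [image_eq_zero_of_notMem_tsupport fun hm => hx (hφs hm), zero_smul]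

theorem ofReal_wNorm_sq {α : ℤ} {f : Plane → ℝ} (hf : MemLp f 2 (wMeasure Ω α)) :
    ENNReal.ofReal (wNorm Ω α f ^ 2) = ∫⁻ x, ENNReal.ofReal (f x ^ 2) ∂(wMeasure Ω α) := by
  rw [wNorm, ENNReal.ofReal_pow ENNReal.toReal_nonneg, ENNReal.ofReal_toReal hf.2.ne]
  have := eLpNorm_nnreal_pow_eq_lintegral (f := f) (p := 2) (μ := wMeasure Ω α) (by norm_num)
  simp only [ofReal_sq_eq_enorm_sq]
  simpa using this

/-- A weak gradient with measurable components whose norm is the seminorm of the function. -/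
theorem MemH1r.exists_gradient (hΩ : IsMeridianDomain Ω) {f : Plane → ℝ} (hf : MemH1r Ω f) :
    ∃ g₀ g₁ : Plane → ℝ, Measurable g₀ ∧ Measurable g₁ ∧ HasWeakPartial Ω 0 f g₀ ∧
      HasWeakPartial Ω 1 f g₁ ∧ ENNReal.ofReal (h1rSeminorm Ω f ^ 2) =
        ∫⁻ x, ENNReal.ofReal (g₀ x ^ 2 + g₁ x ^ 2) ∂(wMeasure Ω 1) := by
  have key : ∀ i, ∃ g : Plane → ℝ, Measurable g ∧ HasWeakPartial Ω i f g ∧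
      MemLp g 2 (wMeasure Ω 1) ∧ wNorm Ω 1 (weakPartial Ω i f) = wNorm Ω 1 g := by
    intro i
    obtain ⟨g, hg, hgm⟩ := hf.2 i
    have hex : ∃ g, HasWeakPartial Ω i f g := ⟨g, hg⟩
    have hw : HasWeakPartial Ω i f (weakPartial Ω i f) := by
      rw [weakPartial, dif_pos hex]
      exact hex.choose_spec
    have hae : g =ᵐ[wMeasure Ω 1] hgm.1.mk g := hgm.1.ae_eq_mk
    have hae' : g =ᵐ[volume.restrict Ω] hgm.1.mk g :=
      (hΩ.restrict_absolutelyContinuous 1).ae_le hae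
    refine ⟨hgm.1.mk g, hgm.1.stronglyMeasurable_mk.measurable, hg.congr_ae hΩ.isOpen hae',
      hgm.ae_eq hae, ?_⟩
    rw [wNorm, wNorm]
    congr 1
    refine eLpNorm_congr_ae ?_
    have hwg : weakPartial Ω i f =ᵐ[wMeasure Ω 1] g :=
      (wMeasure_absolutelyContinuous 1).ae_le (hw.unique hΩ.isOpen hg)
    exact hwg.trans hae
  obtain ⟨g₀, hm₀, h₀, hl₀, e₀⟩ := key 0
  obtain ⟨g₁, hm₁, h₁, hl₁, e₁⟩ := key 1
  refine ⟨g₀, g₁, hm₀, hm₁, h₀, h₁, ?_⟩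
  rw [h1rSeminorm, Real.sq_sqrt (Finset.sum_nonneg fun i _ => sq_nonneg _), Fin.sum_univ_two,
    e₀, e₁, ENNReal.ofReal_add (sq_nonneg _) (sq_nonneg _), ofReal_wNorm_sq hl₀,
    ofReal_wNorm_sq hl₁, ← lintegral_add_left (by fun_prop)]
  refine lintegral_congr fun x => ?_
  rw [ENNReal.ofReal_add (sq_nonneg _) (sq_nonneg _)]

theorem HasWeakPartial.const_mul_sub {i : Fin 2} {f g f' g' : Plane → ℝ} (k : ℝ)
    (h : HasWeakPartial Ω i f g) (h' : HasWeakPartial Ω i f' g') :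
    HasWeakPartial Ω i (fun x => k * f x - f' x) (fun x => k * g x - g' x) := by
  refine ⟨(h.1.smul k).sub h'.1, (h.2.1.smul k).sub h'.2.1, fun φ hφ => ?_⟩
  have hφ1 : ContDiff ℝ 1 φ := hφ.1.of_le (by simp)
  have hpd : Continuous (pd i φ) :=
    (hφ1.continuous_fderiv one_ne_zero).clm_apply continuous_const
  have hc : IsCompact (tsupport φ) := hφ.2.1
  have hInt : ∀ {a : Plane → ℝ}, LocallyIntegrableOn a Ω →
      Integrable (fun x => a x * pd i φ x) (volume.restrict Ω) := by
    intro a ha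
    have : IntegrableOn (fun x => a x * pd i φ x) (tsupport φ) :=
      (ha.integrableOn_compact_subset hφ.2.2 hc).mul_continuousOn hpd.continuousOn hc
    exact ((integrableOn_iff_integrable_of_support_subset (fun x hx =>
      tsupport_fderiv_apply_subset ℝ _ (subset_tsupport _
        (fun h => hx (by simp only [pd]; rw [h, mul_zero]))))).1 this).integrableOn
  have e := h.2.2 φ hφ
  have e' := h'.2.2 φ hφ
  have l : ∫ x in Ω, (k * f x - f' x) * pd i φ x =
      k * (∫ x in Ω, f x * pd i φ x) - ∫ x in Ω, f' x * pd i φ x := by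
    rw [← integral_const_mul, ← integral_sub ((hInt h.1).const_mul k) (hInt h'.1)]
    refine integral_congr_ae (Filter.Eventually.of_forall fun x => ?_)
    simp only
    ring
  have r : ∫ x in Ω, (k * g x - g' x) * φ x =
      k * (∫ x in Ω, g x * φ x) - ∫ x in Ω, g' x * φ x := by
    rw [← integral_const_mul, ← integral_sub ((h.integrable_mul hφ).const_mul k)
      (h'.integrable_mul hφ)]
    refine integral_congr_ae (Filter.Eventually.of_forall fun x => ?_)
    simp only
    ring
  rw [l, r, e, e']
  ring

theorem MemH1r.const_mul_sub {f f' : Plane → ℝ} (k : ℝ) (h : MemH1r Ω f) (h' : MemH1r Ω f') :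
    MemH1r Ω (fun x => k * f x - f' x) := by
  refine ⟨(h.1.const_mul k).sub h'.1, fun i => ?_⟩
  obtain ⟨g, hg, hgm⟩ := h.2 i
  obtain ⟨g', hg', hgm'⟩ := h'.2 i
  exact ⟨_, hg.const_mul_sub k hg', (hgm.const_mul k).sub hgm'⟩

namespace Triangulation

/-! ### Approximation by `r` times piecewise constants -/

variable (T : Triangulation Ω)

theorem exists_const_approx_cell (hΩ : IsMeridianDomain Ω) {f g₀ g₁ : Plane → ℝ}
    (hf : Measurable f) (hg₀ : Measurable g₀) (hg₁ : Measurable g₁)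
    (h₀ : HasWeakPartial Ω 0 f g₀) (h₁ : HasWeakPartial Ω 1 f g₁) :
    ∃ c : T.cells → ℝ, ∀ s : T.cells,
      ∫⁻ x in tri s.1, ENNReal.ofReal ((f x - c s) ^ 2) ∂(wMeasure Ω 1) ≤
        ENNReal.ofReal (8 * T.meshSize ^ 2) *
          ∫⁻ x in tri s.1, ENNReal.ofReal (g₀ x ^ 2 + g₁ x ^ 2) ∂(wMeasure Ω 1) := by
  have : ∀ s : T.cells, ∃ c : ℝ,
      ∫⁻ x in tri s.1, ENNReal.ofReal ((f x - c) ^ 2) ∂(wMeasure Ω 1) ≤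
        ENNReal.ofReal (8 * T.meshSize ^ 2) *
          ∫⁻ x in tri s.1, ENNReal.ofReal (g₀ x ^ 2 + g₁ x ^ 2) ∂(wMeasure Ω 1) := fun s =>
    hΩ.exists_const_approx (T.tri_subset_closure s) (measurableSet_tri s.1)
      (convex_convexHull ℝ _) (T.wMeasure_cell_ne_zero hΩ s)
      (fun x hx y hy => (dist_le_diam hx hy).trans (T.diam_le_meshSize s)) hf hg₀ hg₁ h₀ h₁
  choose c hc using this
  exact ⟨c, hc⟩

theorem setLIntegral_wMeasure_neg_one (hΩ : IsMeridianDomain Ω) (s : T.cells)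
    {F : Plane → ENNReal} (hF : Measurable F) :
    ∫⁻ x in tri s.1, F x ∂(wMeasure Ω (-1)) =
      ∫⁻ x in tri s.1, F x * ENNReal.ofReal ((x 0)⁻¹) := by
  rw [hΩ.wMeasure_restrict (-1) (T.tri_subset_closure s) (measurableSet_tri s.1),
    lintegral_withDensity_eq_lintegral_mul _ (by fun_prop) hF]
  refine lintegral_congr fun x => ?_
  simp [mul_comm]

theorem exists_radial_approx_cell (hΩ : IsMeridianDomain Ω) {f g₀ g₁ : Plane → ℝ}
    (hf : Measurable f) (hg₀ : Measurable g₀) (hg₁ : Measurable g₁)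
    (h₀ : HasWeakPartial Ω 0 f g₀) (h₁ : HasWeakPartial Ω 1 f g₁) :
    ∃ e : T.cells → ℝ, ∀ s : T.cells,
      ∫⁻ x in tri s.1, ENNReal.ofReal ((f x - x 0 * e s) ^ 2) ∂(wMeasure Ω 1) ≤
        ENNReal.ofReal (24 * T.meshSize ^ 2) *
          (∫⁻ x in tri s.1, ENNReal.ofReal (g₀ x ^ 2 + g₁ x ^ 2) ∂(wMeasure Ω 1) +
            ∫⁻ x in tri s.1, ENNReal.ofReal (f x ^ 2) ∂(wMeasure Ω (-1))) := by
  obtain ⟨c, hc⟩ := T.exists_const_approx_cell hΩ hf hg₀ hg₁ h₀ h₁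
  set H := T.meshSize with hH
  have hH0 : 0 ≤ H := T.meshSize_nonneg
  have : ∀ s : T.cells, ∃ e : ℝ,
      ∫⁻ x in tri s.1, ENNReal.ofReal ((f x - x 0 * e) ^ 2) ∂(wMeasure Ω 1) ≤
        ENNReal.ofReal (24 * H ^ 2) *
          (∫⁻ x in tri s.1, ENNReal.ofReal (g₀ x ^ 2 + g₁ x ^ 2) ∂(wMeasure Ω 1) +
            ∫⁻ x in tri s.1, ENNReal.ofReal (f x ^ 2) ∂(wMeasure Ω (-1))) := by
    intro s
    have hX := T.tri_subset_closure s
    have hXm := measurableSet_tri s.1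
    have hr : ∀ x ∈ tri s.1, 0 ≤ x 0 := fun x hx => hΩ.radius_nonneg (hX hx)
    by_cases hnear : ∀ x ∈ tri s.1, x 0 ≤ 2 * H
    · refine ⟨0, ?_⟩
      rw [mul_add]
      refine le_trans ?_ le_add_self
      rw [hΩ.setLIntegral_wMeasure_one hX hXm (by fun_prop),
        T.setLIntegral_wMeasure_neg_one hΩ s (by fun_prop), ← lintegral_const_mul _ (by fun_prop)]
      refine setLIntegral_mono' hXm fun x hx => ?_
      rw [← ENNReal.ofReal_mul (by positivity), ← ENNReal.ofReal_mul (by positivity),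
        ← ENNReal.ofReal_mul (by positivity)]
      apply ENNReal.ofReal_le_ofReal
      rw [mul_zero, sub_zero, mul_left_comm]
      gcongr
      rcases (hr x hx).eq_or_lt with h0 | h0
      · rw [← h0]; simp
      · rw [← div_eq_mul_inv, le_div_iff₀ h0]
        have := hnear x hx
        nlinarith
    · push Not at hnear
      obtain ⟨y, hy, hyH⟩ := hnear
      have hy0 : 0 < y 0 := by linarith
      refine ⟨c s / y 0, ?_⟩
      have hbound : ∀ x ∈ tri s.1, (f x - x 0 * (c s / y 0)) ^ 2 * x 0 ≤
          3 * ((f x - c s) ^ 2 * x 0) + 9 * H ^ 2 * (f x ^ 2 * (x 0)⁻¹) := by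
        intro x hx
        have hd : |x 0 - y 0| ≤ H := by
          have h1 := (norm_sub_le_diam hx hy).trans (T.diam_le_meshSize s)
          have h2 := PiLp.norm_apply_le (x - y) 0
          simp only [PiLp.sub_apply, Real.norm_eq_abs] at h2
          exact h2.trans h1
        obtain ⟨hd1, hd2⟩ := abs_le.1 hd
        have hx0 : 0 < x 0 := by linarith
        have hz : f x - x 0 * (c s / y 0) = (f x - c s) + c s * ((y 0 - x 0) / y 0) := by
          field_simp
          ring
        set δ := (y 0 - x 0) / y 0 with hδ
        have hδ1 : δ ^ 2 ≤ 1 / 4 := by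
          rw [hδ, div_pow, div_le_iff₀ (by positivity)]
          nlinarith
        have hδ2 : δ ^ 2 * x 0 ^ 2 ≤ 9 / 4 * H ^ 2 := by
          have : δ * x 0 = (y 0 - x 0) * (x 0 / y 0) := by rw [hδ]; ring
          rw [← mul_pow, this, mul_pow]
          have h1 : (y 0 - x 0) ^ 2 ≤ H ^ 2 := by nlinarith
          have h2 : (x 0 / y 0) ^ 2 ≤ 9 / 4 := by
            rw [div_pow, div_le_iff₀ (by positivity)]
            nlinarith
          calc _ ≤ H ^ 2 * (9 / 4) := by gcongr
            _ = _ := by ring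
        rw [hz]
        have e1 : ((f x - c s) + c s * δ) ^ 2 ≤ 3 * (f x - c s) ^ 2 + 4 * f x ^ 2 * δ ^ 2 := by
          have a1 : ((f x - c s) + c s * δ) ^ 2 ≤ 2 * (f x - c s) ^ 2 + 2 * (c s ^ 2 * δ ^ 2) := by
            nlinarith [sq_nonneg ((f x - c s) - c s * δ)]
          have a2 : c s ^ 2 ≤ 2 * (f x - c s) ^ 2 + 2 * f x ^ 2 := by
            nlinarith [sq_nonneg (c s - 2 * f x), sq_nonneg (f x - (c s - f x))]
          have a3 : c s ^ 2 * δ ^ 2 ≤ (2 * (f x - c s) ^ 2 + 2 * f x ^ 2) * δ ^ 2 := by gcongr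
          have a4 : (f x - c s) ^ 2 * δ ^ 2 ≤ (f x - c s) ^ 2 * (1 / 4) := by gcongr
          nlinarith
        have e2 : δ ^ 2 * x 0 ≤ 9 / 4 * H ^ 2 * (x 0)⁻¹ := by
          rw [← div_eq_mul_inv, le_div_iff₀ hx0]
          linarith [hδ2, show δ ^ 2 * x 0 * x 0 = δ ^ 2 * x 0 ^ 2 by ring]
        calc _ ≤ (3 * (f x - c s) ^ 2 + 4 * f x ^ 2 * δ ^ 2) * x 0 := by gcongr
          _ = 3 * ((f x - c s) ^ 2 * x 0) + 4 * f x ^ 2 * (δ ^ 2 * x 0) := by ring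
          _ ≤ 3 * ((f x - c s) ^ 2 * x 0) + 4 * f x ^ 2 * (9 / 4 * H ^ 2 * (x 0)⁻¹) := by gcongr
          _ = _ := by ring
      calc _ = ∫⁻ x in tri s.1, ENNReal.ofReal ((f x - x 0 * (c s / y 0)) ^ 2) *
              ENNReal.ofReal (x 0) := hΩ.setLIntegral_wMeasure_one hX hXm (by fun_prop)
        _ ≤ ∫⁻ x in tri s.1, (3 * (ENNReal.ofReal ((f x - c s) ^ 2) * ENNReal.ofReal (x 0)) +
              ENNReal.ofReal (9 * H ^ 2) *
                (ENNReal.ofReal (f x ^ 2) * ENNReal.ofReal ((x 0)⁻¹))) := by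
            refine setLIntegral_mono' hXm fun x hx => ?_
            have h0 := hr x hx
            rw [← ENNReal.ofReal_mul (by positivity), ← ENNReal.ofReal_mul (by positivity),
              ← ENNReal.ofReal_mul (by positivity), ← ENNReal.ofReal_mul (by positivity),
              show (3 : ENNReal) = ENNReal.ofReal 3 by simp, ← ENNReal.ofReal_mul (by positivity),
              ← ENNReal.ofReal_add (by positivity) (by positivity)]
            exact ENNReal.ofReal_le_ofReal (hbound x hx)
        _ = 3 * (∫⁻ x in tri s.1, ENNReal.ofReal ((f x - c s) ^ 2) ∂(wMeasure Ω 1)) +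
              ENNReal.ofReal (9 * H ^ 2) *
                ∫⁻ x in tri s.1, ENNReal.ofReal (f x ^ 2) ∂(wMeasure Ω (-1)) := by
            rw [hΩ.setLIntegral_wMeasure_one hX hXm (by fun_prop),
              T.setLIntegral_wMeasure_neg_one hΩ s (by fun_prop),
              lintegral_add_left (by fun_prop), lintegral_const_mul _ (by fun_prop),
              lintegral_const_mul _ (by fun_prop)]
        _ ≤ 3 * (ENNReal.ofReal (8 * H ^ 2) *
              ∫⁻ x in tri s.1, ENNReal.ofReal (g₀ x ^ 2 + g₁ x ^ 2) ∂(wMeasure Ω 1)) +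
              ENNReal.ofReal (24 * H ^ 2) *
                ∫⁻ x in tri s.1, ENNReal.ofReal (f x ^ 2) ∂(wMeasure Ω (-1)) := by
            gcongr
            · exact hc s
            · norm_num
        _ = _ := by
            rw [mul_add, ← mul_assoc, show (3 : ENNReal) = ENNReal.ofReal 3 by simp,
              ← ENNReal.ofReal_mul (by positivity), show 3 * (8 * H ^ 2) = 24 * H ^ 2 by ring]
  choose e he using this
  exact ⟨e, he⟩

end Triangulation

theorem two_mul_ofReal (y : ℝ) : 2 * ENNReal.ofReal y = ENNReal.ofReal (2 * y) := by
  rw [ENNReal.ofReal_mul zero_le_two, ENNReal.ofReal_ofNat]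

theorem three_mul_ofReal (y : ℝ) : 3 * ENNReal.ofReal y = ENNReal.ofReal (3 * y) := by
  rw [ENNReal.ofReal_mul zero_le_three, ENNReal.ofReal_ofNat]

namespace Triangulation

/-! ### The quasi-interpolation of the meridian part -/

variable {Ω : Set Plane} (T : Triangulation Ω)

theorem exists_edge_choice : ∃ ch : T.cells × Fin 3 → T.cells × Fin 3,
    (∀ q, T.edge (ch q) = T.edge q) ∧ ∀ q q', T.edge q = T.edge q' → ch q = ch q' := by
  have hs : Function.Surjective (Set.rangeFactorization T.edge) :=
    Set.rangeFactorization_surjective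
  refine ⟨fun q => Function.surjInv hs (Set.rangeFactorization T.edge q), fun q => ?_,
    fun q q' h => ?_⟩
  · exact congrArg Subtype.val (Function.surjInv_eq hs (Set.rangeFactorization T.edge q))
  · have : Set.rangeFactorization T.edge q = Set.rangeFactorization T.edge q' := Subtype.ext h
    simp only [this]

theorem sum_choice_le {ch : T.cells × Fin 3 → T.cells × Fin 3}
    (hch : ∀ q, T.edge (ch q) = T.edge q) (D : T.cells → ENNReal) :
    ∑ q, D (ch q).1 ≤ 6 * ∑ s, D s := by
  classical
  calc ∑ q, D (ch q).1 ≤ ∑ q, ∑ q', if T.edge q = T.edge q' then D q'.1 else 0 := by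
        refine Finset.sum_le_sum fun q _ => ?_
        refine le_trans (le_of_eq ?_) (Finset.single_le_sum
          (f := fun q' => if T.edge q = T.edge q' then D q'.1 else 0)
          (fun _ _ => zero_le) (Finset.mem_univ (ch q)))
        simp [hch q]
    _ = ∑ q', ∑ q, if T.edge q = T.edge q' then D q'.1 else 0 := Finset.sum_comm
    _ ≤ ∑ q' : T.cells × Fin 3, 2 * D q'.1 := by
        refine Finset.sum_le_sum fun q' _ => ?_
        rw [← Finset.sum_filter, Finset.sum_const, nsmul_eq_mul]
        gcongr
        exact_mod_cast T.card_filter_edge_le q'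
    _ = _ := by
        rw [Fintype.sum_prod_type]
        simp only [Finset.sum_const, Finset.card_univ, Fintype.card_fin]
        rw [Finset.mul_sum]
        refine Finset.sum_congr rfl fun s _ => ?_
        simp only [nsmul_eq_mul, ← mul_assoc]
        norm_num

/-- The edge fluxes of a piecewise constant field, taken from a chosen cell at every edge and
divided by the doubled area of the cell. -/
def fluxCoeff (C : T.cells → Plane) (ch : T.cells × Fin 3 → T.cells × Fin 3)
    (q : T.cells × Fin 3) : ℝ :=
  cr (T.vb q - T.va q) (C (ch q).1) / T.orient q.1

theorem fluxCoeff_add_eq_zero (C : T.cells → Plane) {ch : T.cells × Fin 3 → T.cells × Fin 3}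
    (hch : ∀ q q', T.edge q = T.edge q' → ch q = ch q') {q q' : T.cells × Fin 3}
    (h : T.edge q = T.edge q') (hne : q.1 ≠ q'.1) :
    T.fluxCoeff C ch q * |T.orient q.1| + T.fluxCoeff C ch q' * |T.orient q'.1| = 0 := by
  have hopp := T.cr_mul_cr_neg_of_edge_eq h hne
  have key : ∀ d x y : ℝ, x * y < 0 → d / x * |x| + d / y * |y| = 0 := by
    intro d x y hxy
    rcases mul_neg_iff.1 hxy with ⟨h1, h2⟩ | ⟨h1, h2⟩
    · rw [abs_of_pos h1, abs_of_neg h2]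
      have := h1.ne'
      have := h2.ne
      field_simp
      ring
    · rw [abs_of_neg h1, abs_of_pos h2]
      have := h1.ne
      have := h2.ne'
      field_simp
      ring
  rw [fluxCoeff, fluxCoeff, hch q q' h, ← T.cr_eq_orient q, ← T.cr_eq_orient q']
  rcases Set.pair_eq_pair_iff.1 h with ⟨e1, e2⟩ | ⟨e1, e2⟩
  · rw [← e1, ← e2]
    exact key _ _ _ hopp
  · rw [← e1, ← e2, cr_neg_swap (T.vb q - T.vp q')]
    have hd : cr (T.va q - T.vb q) (C (ch q').1) = -cr (T.vb q - T.va q) (C (ch q').1) := by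
      simp [cr]; ring
    rw [hd, abs_neg, neg_div_neg_eq]
    exact key _ _ _ hopp

theorem sum_cr_smul_eq (s : T.cells) (v x : Plane) :
    ∑ i, cr (T.vb (s, i) - T.va (s, i)) v • (x - T.vp (s, i)) = -(T.orient s • v) := by
  have h0 : T.vb (s, 0) = T.vtx s 2 := rfl
  have h1 : T.vb (s, 1) = T.vtx s 0 := rfl
  have h2 : T.vb (s, 2) = T.vtx s 1 := rfl
  have h3 : T.va (s, 0) = T.vtx s 1 := rfl
  have h4 : T.va (s, 1) = T.vtx s 2 := rfl
  have h5 : T.va (s, 2) = T.vtx s 0 := rfl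
  have h6 : ∀ i, T.vp (s, i) = T.vtx s i := fun _ => rfl
  rw [Fin.sum_univ_three, h0, h1, h2, h3, h4, h5, h6, h6, h6, orient]
  ext j
  fin_cases j <;> (simp [cr]; ring)

theorem rtField_fluxCoeff_sub (C : T.cells → Plane) (ch : T.cells × Fin 3 → T.cells × Fin 3)
    (s : T.cells) (x : Plane) : T.rtField (T.fluxCoeff C ch) s x - C s =
      -∑ i, (cr (T.vb (s, i) - T.va (s, i)) (C (ch (s, i)).1 - C s) / T.orient s) •
        (x - T.vp (s, i)) := by
  have h : C s = -∑ i, (cr (T.vb (s, i) - T.va (s, i)) (C s) / T.orient s) •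
      (x - T.vp (s, i)) := by
    have e : ∀ i : Fin 3, (cr (T.vb (s, i) - T.va (s, i)) (C s) / T.orient s) • (x - T.vp (s, i)) =
        (T.orient s)⁻¹ • (cr (T.vb (s, i) - T.va (s, i)) (C s) • (x - T.vp (s, i))) := by
      intro i
      rw [smul_smul, div_eq_inv_mul]
    simp_rw [e]
    rw [← Finset.smul_sum, T.sum_cr_smul_eq, smul_neg, neg_neg,
      inv_smul_smul₀ (T.orient_ne_zero s)]
  conv_lhs => rw [h]
  rw [rtField, neg_sub_neg, ← Finset.sum_sub_distrib, ← Finset.sum_neg_distrib]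
  refine Finset.sum_congr rfl fun i _ => ?_
  rw [fluxCoeff, ← sub_smul, ← neg_smul]
  congr 1
  simp only [cr, PiLp.sub_apply]
  ring

variable {T} {σ : ℝ}

theorem ShapeRegular.norm_rtField_sub_sq_le (hσ : T.ShapeRegular σ) (C : T.cells → Plane)
    (ch : T.cells × Fin 3 → T.cells × Fin 3) (s : T.cells) {x : Plane} (hx : x ∈ tri s.1) :
    ‖T.rtField (T.fluxCoeff C ch) s x - C s‖ ^ 2 ≤
      3 * σ ^ 2 * ∑ i, ‖C s - C (ch (s, i)).1‖ ^ 2 := by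
  obtain ⟨h0, h1⟩ := hσ.pos_and_sq_le s
  have hJ := T.abs_orient_pos s
  have hle : ‖T.rtField (T.fluxCoeff C ch) s x - C s‖ ≤
      ∑ i, σ * ‖C s - C (ch (s, i)).1‖ := by
    rw [T.rtField_fluxCoeff_sub, norm_neg]
    refine norm_sum_le_of_le _ fun i _ => ?_
    rw [norm_smul, norm_div, Real.norm_eq_abs, Real.norm_eq_abs, div_mul_eq_mul_div,
      div_le_iff₀ hJ]
    calc |cr (T.vb (s, i) - T.va (s, i)) (C (ch (s, i)).1 - C s)| * ‖x - T.vp (s, i)‖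
        ≤ (‖T.vb (s, i) - T.va (s, i)‖ * ‖C (ch (s, i)).1 - C s‖) * ‖x - T.vp (s, i)‖ := by
          gcongr
          exact abs_cr_le _ _
      _ ≤ (Metric.diam (tri s.1) * ‖C (ch (s, i)).1 - C s‖) * Metric.diam (tri s.1) := by
          gcongr
          · exact norm_sub_le_diam (T.vb_mem (s, i)) (T.va_mem (s, i))
          · exact norm_sub_le_diam hx (T.vp_mem (s, i))
      _ = ‖C s - C (ch (s, i)).1‖ * Metric.diam (tri s.1) ^ 2 := by
          rw [norm_sub_rev]; ring
      _ ≤ ‖C s - C (ch (s, i)).1‖ * (σ * |T.orient s|) := by gcongr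
      _ = _ := by ring
  calc _ ≤ (∑ i, σ * ‖C s - C (ch (s, i)).1‖) ^ 2 := by gcongr
    _ ≤ (Finset.univ : Finset (Fin 3)).card * ∑ i, (σ * ‖C s - C (ch (s, i)).1‖) ^ 2 :=
        sq_sum_le_card_mul_sum_sq
    _ = _ := by
        simp only [mul_pow, ← Finset.mul_sum, Finset.card_univ, Fintype.card_fin]
        push_cast
        ring

/-- Constant of the quasi-interpolation estimate. -/
def interpConst (σ : ℝ) : ℝ := 16 + 54 * σ ^ 2 * |neighborConst σ|

theorem ShapeRegular.exists_rt_approx (hσ : T.ShapeRegular σ) (hΩ : IsMeridianDomain Ω)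
    {f g₀ g₁ f' g₀' g₁' : Plane → ℝ} (hf : Measurable f) (hg₀ : Measurable g₀)
    (hg₁ : Measurable g₁) (h₀ : HasWeakPartial Ω 0 f g₀) (h₁ : HasWeakPartial Ω 1 f g₁)
    (hf' : Measurable f') (hg₀' : Measurable g₀')
    (hg₁' : Measurable g₁') (h₀' : HasWeakPartial Ω 0 f' g₀') (h₁' : HasWeakPartial Ω 1 f' g₁') :
    ∃ Λ : T.cells × Fin 3 → ℝ, (∀ q q', T.edge q = T.edge q' → q.1 ≠ q'.1 →
      Λ q * |T.orient q.1| + Λ q' * |T.orient q'.1| = 0) ∧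
      ∑ s : T.cells, ∫⁻ x in tri s.1, ENNReal.ofReal ((f x - T.rtField Λ s x 0) ^ 2 +
        (f' x - T.rtField Λ s x 1) ^ 2) ∂(wMeasure Ω 1) ≤
      ENNReal.ofReal (interpConst σ * T.meshSize ^ 2) *
        (∫⁻ x, ENNReal.ofReal (g₀ x ^ 2 + g₁ x ^ 2) ∂(wMeasure Ω 1) +
          ∫⁻ x, ENNReal.ofReal (g₀' x ^ 2 + g₁' x ^ 2) ∂(wMeasure Ω 1)) := by
  obtain ⟨c, hc⟩ := T.exists_const_approx_cell hΩ hf hg₀ hg₁ h₀ h₁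
  obtain ⟨c', hc'⟩ := T.exists_const_approx_cell hΩ hf' hg₀' hg₁' h₀' h₁'
  obtain ⟨ch, hch1, hch2⟩ := T.exists_edge_choice
  set H := T.meshSize
  set ν := wMeasure Ω 1
  set N := |neighborConst σ|
  have hH0 : 0 ≤ H := T.meshSize_nonneg
  set C : T.cells → Plane := fun s => !₂[c s, c' s] with hC
  set D₀ : T.cells → ENNReal := fun s =>
    ∫⁻ x in tri s.1, ENNReal.ofReal (g₀ x ^ 2 + g₁ x ^ 2) ∂ν with hD₀
  set D₁ : T.cells → ENNReal := fun s =>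
    ∫⁻ x in tri s.1, ENNReal.ofReal (g₀' x ^ 2 + g₁' x ^ 2) ∂ν with hD₁
  refine ⟨T.fluxCoeff C ch, fun q q' h hne => T.fluxCoeff_add_eq_zero C hch2 h hne, ?_⟩
  have hN : neighborConst σ * H ^ 2 ≤ N * H ^ 2 := by gcongr; exact le_abs_self _
  -- differences of the constants on neighbouring cells
  have hdiff : ∀ q : T.cells × Fin 3,
      ENNReal.ofReal (‖C q.1 - C (ch q).1‖ ^ 2) * ν (tri q.1.1) ≤ ENNReal.ofReal (N * H ^ 2) *
        (D₀ q.1 + D₁ q.1 + (D₀ (ch q).1 + D₁ (ch q).1)) := by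
    intro q
    by_cases hq : q.1 = (ch q).1
    · rw [← hq]; simp
    · have e1 := hσ.sq_sub_mul_wMeasure_le hΩ (hch1 q).symm hq hf hg₀ hg₁ h₀ h₁ hc
      have e2 := hσ.sq_sub_mul_wMeasure_le hΩ (hch1 q).symm hq hf' hg₀' hg₁' h₀' h₁' hc'
      have hnorm : ‖C q.1 - C (ch q).1‖ ^ 2 =
          (c q.1 - c (ch q).1) ^ 2 + (c' q.1 - c' (ch q).1) ^ 2 := by
        rw [EuclideanSpace.norm_sq_eq]
        simp [hC]
      rw [hnorm, ENNReal.ofReal_add (sq_nonneg _) (sq_nonneg _), add_mul]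
      calc _ ≤ ENNReal.ofReal (neighborConst σ * H ^ 2) * (D₀ q.1 + D₀ (ch q).1) +
            ENNReal.ofReal (neighborConst σ * H ^ 2) * (D₁ q.1 + D₁ (ch q).1) := add_le_add e1 e2
        _ = ENNReal.ofReal (neighborConst σ * H ^ 2) *
            (D₀ q.1 + D₁ q.1 + (D₀ (ch q).1 + D₁ (ch q).1)) := by ring
        _ ≤ _ := by gcongr
  -- the estimate on one cell
  have hcell : ∀ s : T.cells, ∫⁻ x in tri s.1, ENNReal.ofReal
      ((f x - T.rtField (T.fluxCoeff C ch) s x 0) ^ 2 +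
        (f' x - T.rtField (T.fluxCoeff C ch) s x 1) ^ 2) ∂ν ≤
      ENNReal.ofReal (16 * H ^ 2) * (D₀ s + D₁ s) + ENNReal.ofReal (6 * σ ^ 2) *
        ∑ i, ENNReal.ofReal (N * H ^ 2) *
          (D₀ s + D₁ s + (D₀ (ch (s, i)).1 + D₁ (ch (s, i)).1)) := by
    intro s
    set B : ℝ := ∑ i, ‖C s - C (ch (s, i)).1‖ ^ 2 with hB
    have hB0 : 0 ≤ B := Finset.sum_nonneg fun i _ => sq_nonneg _
    calc _ ≤ ∫⁻ x in tri s.1, (2 * (ENNReal.ofReal ((f x - c s) ^ 2) +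
            ENNReal.ofReal ((f' x - c' s) ^ 2)) + ENNReal.ofReal (6 * σ ^ 2 * B)) ∂ν := by
          refine setLIntegral_mono' (measurableSet_tri s.1) fun x hx => ?_
          have hn := hσ.norm_rtField_sub_sq_le C ch s hx
          rw [EuclideanSpace.norm_sq_eq] at hn
          simp only [Fin.sum_univ_two, Real.norm_eq_abs, sq_abs, PiLp.sub_apply] at hn
          have e0 : C s 0 = c s := by simp [hC]
          have e1 : C s 1 = c' s := by simp [hC]
          rw [e0, e1, ← hB] at hn
          rw [← ENNReal.ofReal_add (sq_nonneg _) (sq_nonneg _),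
            two_mul_ofReal, ← ENNReal.ofReal_add (by positivity) (by positivity)]
          apply ENNReal.ofReal_le_ofReal
          set a := T.rtField (T.fluxCoeff C ch) s x 0
          set b := T.rtField (T.fluxCoeff C ch) s x 1
          nlinarith [sq_nonneg ((f x - c s) + (a - c s)), sq_nonneg ((f' x - c' s) + (b - c' s))]
      _ = 2 * ((∫⁻ x in tri s.1, ENNReal.ofReal ((f x - c s) ^ 2) ∂ν) +
            ∫⁻ x in tri s.1, ENNReal.ofReal ((f' x - c' s) ^ 2) ∂ν) +
            ENNReal.ofReal (6 * σ ^ 2 * B) * ν (tri s.1) := by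
          rw [lintegral_add_left (by fun_prop), lintegral_const_mul _ (by fun_prop),
            lintegral_add_left (by fun_prop), setLIntegral_const]
      _ ≤ 2 * (ENNReal.ofReal (8 * H ^ 2) * D₀ s + ENNReal.ofReal (8 * H ^ 2) * D₁ s) +
            ENNReal.ofReal (6 * σ ^ 2) * ∑ i, ENNReal.ofReal (N * H ^ 2) *
          (D₀ s + D₁ s + (D₀ (ch (s, i)).1 + D₁ (ch (s, i)).1)) := by
          refine add_le_add (by gcongr; exacts [hc s, hc' s]) ?_
          · rw [ENNReal.ofReal_mul (by positivity), mul_assoc]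
            refine mul_le_mul_right ?_ _
            rw [hB, ENNReal.ofReal_sum_of_nonneg fun i _ => sq_nonneg _, Finset.sum_mul]
            exact Finset.sum_le_sum fun i _ => hdiff (s, i)
      _ = _ := by
          rw [← mul_add, ← mul_assoc, two_mul_ofReal, show 2 * (8 * H ^ 2) = 16 * H ^ 2 by ring]
  have hsumD : ∑ s, (D₀ s + D₁ s) = (∫⁻ x, ENNReal.ofReal (g₀ x ^ 2 + g₁ x ^ 2) ∂ν) +
      ∫⁻ x, ENNReal.ofReal (g₀' x ^ 2 + g₁' x ^ 2) ∂ν := by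
    rw [Finset.sum_add_distrib, T.lintegral_eq_sum hΩ, T.lintegral_eq_sum hΩ]
  rw [← hsumD]
  have hsum2 : ∑ s : T.cells, ∑ i : Fin 3,
      (D₀ s + D₁ s + (D₀ (ch (s, i)).1 + D₁ (ch (s, i)).1)) ≤ 9 * ∑ s, (D₀ s + D₁ s) := by
    rw [← Fintype.sum_prod_type' (f := fun s i =>
      (D₀ s + D₁ s + (D₀ (ch (s, i)).1 + D₁ (ch (s, i)).1))), Finset.sum_add_distrib]
    have := T.sum_choice_le hch1 fun s => D₀ s + D₁ s
    have h3 : ∑ q : T.cells × Fin 3, (D₀ q.1 + D₁ q.1) = 3 * ∑ s, (D₀ s + D₁ s) := by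
      rw [Fintype.sum_prod_type, Finset.mul_sum]
      simp [mul_add]
    calc _ ≤ 3 * ∑ s, (D₀ s + D₁ s) + 6 * ∑ s, (D₀ s + D₁ s) := add_le_add h3.le this
      _ = _ := by rw [← add_mul]; norm_num
  calc _ ≤ ∑ s, (ENNReal.ofReal (16 * H ^ 2) * (D₀ s + D₁ s) + ENNReal.ofReal (6 * σ ^ 2) *
        ∑ i, ENNReal.ofReal (N * H ^ 2) *
          (D₀ s + D₁ s + (D₀ (ch (s, i)).1 + D₁ (ch (s, i)).1))) :=
        Finset.sum_le_sum fun s _ => hcell s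
    _ = ENNReal.ofReal (16 * H ^ 2) * ∑ s, (D₀ s + D₁ s) + ENNReal.ofReal (6 * σ ^ 2) *
        (ENNReal.ofReal (N * H ^ 2) * ∑ s, ∑ i,
          (D₀ s + D₁ s + (D₀ (ch (s, i)).1 + D₁ (ch (s, i)).1))) := by
        rw [Finset.sum_add_distrib]
        simp only [Finset.mul_sum]
    _ ≤ ENNReal.ofReal (16 * H ^ 2) * ∑ s, (D₀ s + D₁ s) + ENNReal.ofReal (6 * σ ^ 2) *
        (ENNReal.ofReal (N * H ^ 2) * (9 * ∑ s, (D₀ s + D₁ s))) := by gcongr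
    _ = _ := by
        have : ENNReal.ofReal (interpConst σ * H ^ 2) = ENNReal.ofReal (16 * H ^ 2) +
            ENNReal.ofReal (6 * σ ^ 2) * (ENNReal.ofReal (N * H ^ 2) * 9) := by
          rw [show (9 : ENNReal) = ENNReal.ofReal 9 by simp, ← ENNReal.ofReal_mul (by positivity),
            ← ENNReal.ofReal_mul (by positivity),
            ← ENNReal.ofReal_add (by positivity) (by positivity), interpConst]
          congr 1
          ring
        rw [this]
        ring

end Triangulation

/-! ### Best approximation in `C_h` -/

theorem exists_approx {Ω : Set Plane} (hΩ : IsMeridianDomain Ω) {k : ℤ} (hk : 1 ≤ |k|) {σ : ℝ}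
    {T : Triangulation Ω} (hσ : T.ShapeRegular σ) {u : L2rVec Ω} (hu : MemH1star k u) :
    ∃ w ∈ T.spaceC k, ‖u - w‖ ≤ Real.sqrt (3 * Triangulation.interpConst σ + 48) * T.meshSize *
      (rzSeminorm u + h1tildeNorm Ω (kThetaSubR k u)) := by
  have hk0 : k ≠ 0 := by rintro rfl; simp at hk
  have hk1 : (1 : ℝ) ≤ (k : ℝ) ^ 2 := by
    have h1 : (1 : ℝ) ≤ |(k : ℝ)| := by exact_mod_cast hk
    rw [← sq_abs]
    nlinarith
  have hum : ∀ j : Fin 3, Measurable fun x => u x j := fun j => by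
    have := (Lp.stronglyMeasurable u).measurable
    fun_prop
  obtain ⟨g₀, g₁, hg₀, hg₁, h₀, h₁, hD⟩ := (hu.1 0).exists_gradient hΩ
  obtain ⟨g₀', g₁', hg₀', hg₁', h₀', h₁', hD'⟩ := (hu.1 2).exists_gradient hΩ
  have hG : MemH1r Ω (kThetaSubR k u) := (hu.1 1).const_mul_sub (k : ℝ) (hu.1 0)
  have hGm : Measurable (kThetaSubR k u) := ((hum 1).const_mul _).sub (hum 0)
  obtain ⟨γ₀, γ₁, hγ₀, hγ₁, hθ₀, hθ₁, hDθ⟩ := hG.exists_gradient hΩ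
  obtain ⟨Λ, hΛ, hrt⟩ := hσ.exists_rt_approx hΩ (hum 0) hg₀ hg₁ h₀ h₁ (hum 2) hg₀' hg₁' h₀' h₁'
  obtain ⟨e, he⟩ := T.exists_radial_approx_cell hΩ hGm hγ₀ hγ₁ hθ₀ hθ₁
  obtain ⟨w, hw, hwc⟩ := T.exists_mem_spaceC hΩ hk0 hΛ e
  refine ⟨w, hw, ?_⟩
  set H := T.meshSize with hH
  have hH0 : 0 ≤ H := T.meshSize_nonneg
  set A := Triangulation.interpConst σ with hA
  have hA0 : 0 ≤ A := by rw [hA, Triangulation.interpConst]; positivity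
  set ν := wMeasure Ω 1 with hν
  set rz := rzSeminorm u with hrz
  set th := h1tildeNorm Ω (kThetaSubR k u) with hth
  have hrz0 : 0 ≤ rz := Real.sqrt_nonneg _
  have hth0 : 0 ≤ th := Real.sqrt_nonneg _
  -- the norm of the error as a sum over the cells
  have hnorm : ENNReal.ofReal (‖u - w‖ ^ 2) = ∑ s : T.cells, ∫⁻ x in tri s.1,
      ‖u x - w x‖ₑ ^ 2 ∂ν := by
    rw [← T.lintegral_eq_sum hΩ, Lp.norm_def, ENNReal.ofReal_pow ENNReal.toReal_nonneg,
      ENNReal.ofReal_toReal (Lp.eLpNorm_ne_top _)]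
    have h2 := eLpNorm_nnreal_pow_eq_lintegral (f := (u - w : L2rVec Ω)) (p := 2) (μ := ν)
      (by norm_num)
    have h3 : eLpNorm (u - w : L2rVec Ω) 2 ν ^ 2 = ∫⁻ x, ‖(u - w : L2rVec Ω) x‖ₑ ^ 2 ∂ν := by
      simpa using h2
    rw [h3]
    refine lintegral_congr_ae ?_
    filter_upwards [Lp.coeFn_sub u w] with x hx
    rw [hx, Pi.sub_apply]
  have hcell : ∀ s : T.cells, ∫⁻ x in tri s.1, ‖u x - w x‖ₑ ^ 2 ∂ν ≤
      3 * (∫⁻ x in tri s.1, ENNReal.ofReal ((u x 0 - T.rtField Λ s x 0) ^ 2 +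
        (u x 2 - T.rtField Λ s x 1) ^ 2) ∂ν) +
      2 * ∫⁻ x in tri s.1, ENNReal.ofReal ((kThetaSubR k u x - x 0 * e s) ^ 2) ∂ν := by
    intro s
    rw [← lintegral_const_mul' _ _ (by simp), ← lintegral_const_mul _ (by fun_prop),
      ← lintegral_add_right _ (by fun_prop)]
    refine lintegral_mono_ae ?_
    have hac : ν.restrict (tri s.1) ≪ volume.restrict (tri s.1) := by
      rw [hν, hΩ.wMeasure_restrict 1 (T.tri_subset_closure s)
        (Triangulation.measurableSet_tri s.1)]
      exact withDensity_absolutelyContinuous _ _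
    filter_upwards [hac.ae_le (hwc s)] with x hx
    obtain ⟨hx0, hx2, hx1⟩ := hx
    rw [← hx0, ← hx2, ← hx1]
    have hn : ‖u x - w x‖ₑ ^ 2 = ENNReal.ofReal ((u x 0 - w x 0) ^ 2 + (u x 1 - w x 1) ^ 2 +
        (u x 2 - w x 2) ^ 2) := by
      rw [← ofReal_norm, ← ENNReal.ofReal_pow (norm_nonneg _), EuclideanSpace.norm_sq_eq]
      simp [Fin.sum_univ_three]
    rw [hn, three_mul_ofReal, two_mul_ofReal, ← ENNReal.ofReal_add (by positivity) (by positivity)]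
    apply ENNReal.ofReal_le_ofReal
    rw [kThetaSubR]
    have hb : (u x 1 - w x 1) ^ 2 ≤ (k : ℝ) ^ 2 * (u x 1 - w x 1) ^ 2 :=
      le_mul_of_one_le_left (sq_nonneg _) hk1
    have hb2 : (k : ℝ) ^ 2 * (u x 1 - w x 1) ^ 2 ≤
        2 * ((k : ℝ) * u x 1 - u x 0 - ((k : ℝ) * w x 1 - w x 0)) ^ 2 +
          2 * (u x 0 - w x 0) ^ 2 := by
      have := sq_nonneg (((k : ℝ) * u x 1 - u x 0 - ((k : ℝ) * w x 1 - w x 0)) - (u x 0 - w x 0))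
      nlinarith
    nlinarith [sq_nonneg (u x 2 - w x 2)]
  have hrzsq : ENNReal.ofReal (rz ^ 2) = (∫⁻ x, ENNReal.ofReal (g₀ x ^ 2 + g₁ x ^ 2) ∂ν) +
      ∫⁻ x, ENNReal.ofReal (g₀' x ^ 2 + g₁' x ^ 2) ∂ν := by
    rw [hrz, rzSeminorm, Real.sq_sqrt (by positivity),
      ENNReal.ofReal_add (sq_nonneg _) (sq_nonneg _), hD, hD']
  have hthsq : (∫⁻ x, ENNReal.ofReal (γ₀ x ^ 2 + γ₁ x ^ 2) ∂ν) +
      ∫⁻ x, ENNReal.ofReal (kThetaSubR k u x ^ 2) ∂(wMeasure Ω (-1)) ≤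
        ENNReal.ofReal (th ^ 2) := by
    rw [← hDθ, ← ofReal_wNorm_sq hu.2, ← ENNReal.ofReal_add (sq_nonneg _) (sq_nonneg _), hth,
      h1tildeNorm, Real.sq_sqrt (by positivity)]
    apply ENNReal.ofReal_le_ofReal
    linarith [sq_nonneg (wNorm Ω 1 (kThetaSubR k u))]
  have htotal : ENNReal.ofReal (‖u - w‖ ^ 2) ≤
      ENNReal.ofReal (3 * (A * H ^ 2 * rz ^ 2) + 2 * (24 * H ^ 2 * th ^ 2)) := by
    rw [hnorm]
    calc _ ≤ ∑ s : T.cells, (3 * (∫⁻ x in tri s.1, ENNReal.ofReal ((u x 0 - T.rtField Λ s x 0) ^ 2 +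
        (u x 2 - T.rtField Λ s x 1) ^ 2) ∂ν) +
        2 * ∫⁻ x in tri s.1, ENNReal.ofReal ((kThetaSubR k u x - x 0 * e s) ^ 2) ∂ν) :=
          Finset.sum_le_sum fun s _ => hcell s
      _ = 3 * (∑ s : T.cells, ∫⁻ x in tri s.1, ENNReal.ofReal ((u x 0 - T.rtField Λ s x 0) ^ 2 +
        (u x 2 - T.rtField Λ s x 1) ^ 2) ∂ν) +
        2 * ∑ s : T.cells,
          ∫⁻ x in tri s.1, ENNReal.ofReal ((kThetaSubR k u x - x 0 * e s) ^ 2) ∂ν := by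
          rw [Finset.sum_add_distrib, Finset.mul_sum, Finset.mul_sum]
      _ ≤ 3 * (ENNReal.ofReal (A * H ^ 2) * ENNReal.ofReal (rz ^ 2)) +
          2 * (ENNReal.ofReal (24 * H ^ 2) * ENNReal.ofReal (th ^ 2)) := by
          gcongr
          · rw [hrzsq]; exact hrt
          · refine (Finset.sum_le_sum fun s _ => he s).trans ?_
            rw [← Finset.mul_sum, Finset.sum_add_distrib, ← T.lintegral_eq_sum hΩ,
              ← T.lintegral_eq_sum hΩ]
            gcongr
      _ = _ := by
          rw [← ENNReal.ofReal_mul (by positivity), ← ENNReal.ofReal_mul (by positivity),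
            three_mul_ofReal, two_mul_ofReal,
            ← ENNReal.ofReal_add (by positivity) (by positivity)]
  have hreal := (ENNReal.ofReal_le_ofReal_iff (by positivity)).1 htotal
  refine le_of_sq_le_sq ?_ (by positivity)
  rw [mul_pow, mul_pow, Real.sq_sqrt (by positivity)]
  refine hreal.trans ?_
  have h1 : 0 ≤ H ^ 2 * (A * (rz * th)) := by positivity
  have h2 : 0 ≤ H ^ 2 * (A * th ^ 2) := by positivity
  have h3 : 0 ≤ H ^ 2 * rz ^ 2 := by positivity
  have h4 : 0 ≤ H ^ 2 * (rz * th) := by positivity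
  nlinarith

end Axisym

end

theorem theorem3p2 (Ω : Set Axisym.Plane) (hΩ : Axisym.IsMeridianDomain Ω)
    (k : ℤ) (hk : 1 ≤ |k|) (σ M : ℝ) :
    ∃ C : ℝ, 0 < C ∧
      ∀ T : Axisym.Triangulation Ω, T.ShapeRegular σ →
        ∀ u : Axisym.L2rVec Ω, Axisym.MemH1star k u →
          (∀ P : Axisym.CommutingProjections T k M,
            ‖u - P.projD u‖ ≤ C * T.meshSize *
              (Axisym.rzSeminorm u + Axisym.h1tildeNorm Ω (Axisym.kThetaSubR k u))) ∧
          (∃ w ∈ T.spaceC k,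
            ‖u - w‖ ≤ C * T.meshSize *
              (Axisym.rzSeminorm u + Axisym.h1tildeNorm Ω (Axisym.kThetaSubR k u))) := by
  set A := Real.sqrt (3 * Axisym.Triangulation.interpConst σ + 48) with hA
  have hA0 : 0 < A := by
    refine Real.sqrt_pos.2 ?_
    rw [Axisym.Triangulation.interpConst]
    positivity
  refine ⟨(1 + |M|) * A, by positivity, fun T hσ u hu => ?_⟩
  obtain ⟨w, hw, hle⟩ := Axisym.exists_approx hΩ hk hσ hu
  set E := Axisym.rzSeminorm u + Axisym.h1tildeNorm Ω (Axisym.kThetaSubR k u) with hE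
  have hE0 : 0 ≤ E := add_nonneg (Real.sqrt_nonneg _) (Real.sqrt_nonneg _)
  have hH0 := T.meshSize_nonneg
  have hmul : (1 + |M|) * A * T.meshSize * E = (1 + |M|) * (A * T.meshSize * E) := by ring
  have hpos : 0 ≤ A * T.meshSize * E := by positivity
  refine ⟨fun P => ?_, w, hw, hle.trans ?_⟩
  · have hid : u - P.projD u = (u - w) - P.projD (u - w) := by
      rw [map_sub, P.id_d w hw]
      abel
    have hP : ‖P.projD (u - w)‖ ≤ |M| * ‖u - w‖ :=
      (P.projD.le_opNorm _).trans
        (mul_le_mul_of_nonneg_right (P.norm_d.trans (le_abs_self M)) (norm_nonneg _))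
    calc ‖u - P.projD u‖ ≤ ‖u - w‖ + ‖P.projD (u - w)‖ := by rw [hid]; exact norm_sub_le _ _
      _ ≤ (1 + |M|) * ‖u - w‖ := by linarith
      _ ≤ (1 + |M|) * (A * T.meshSize * E) := by gcongr
      _ = _ := hmul.symm
  · rw [hmul]
    nlinarith [abs_nonneg M]
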